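/- There is an absolute constant $A>0$ with the following property. Let $n\ge 3$, let $d_1,\dots,d_{n-1}\ge 1$ be integers with $d:=\max_i d_i\ge 2$, put $N_i:=\binom{n+d_i-1}{d_i}$ and $N:=\sum_{i=1}^{n-1}N_i$. For $i=1,\dots,n-1$ let $C_i=(c_{i,\alpha})_{\alpha_1+\cdots+\alpha_n=d_i}$ be independent random vectors in $\mathbb{R}^{N_i}$ for which there are constants $K,c_0>0$ such that for every $i$: 1. (Centering) $\mathbb{E}\langle C_i,\theta\rangle=0$ for every $\theta\in S^{N_i-1}$; 2. (Sub-Gaussian) $\mathrm{Prob}(|\langle C_i,\theta\rangle|\ge t)\le 2e^{-t^2/K^2}$ for every $\theta\in S^{N_i-1}$ and every $t>0$; 3. (Small Ball) $\mathrm{Prob}(|\langle a,C_i\rangle|\le \varepsilon\|a\|_2)\le c_0\varepsilon$ for every nonzero $a\in\mathbb{R}^{N_i}$ and every $\varepsilon>0$. Let $P=(p_1,\dots,p_{n-1})$ be the random system of homogeneous polynomials $p_i(x)=\sum_{\alpha_1+\cdots+\alpha_n=d_i}\sqrt{\binom{d_i}{\alpha}}\,c_{i,\alpha}x^\alpha$,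 where $\binom{d_i}{\alpha}=\frac{d_i!}{\alpha_1!\cdots\alpha_n!}$. Here the condition number for real solving of a system $P=(p_1,\dots,p_{n-1})$ of homogeneous polynomials in $\mathbb{R}[x_1,\dots,x_n]$ of degrees $d_1,\dots,d_{n-1}$ is defined as follows. If $b_{i,\alpha}$ is the coefficient of $x^\alpha$ in $p_i$, let $\|P\|_W:=\big(\sum_{i}\sum_{\alpha}|b_{i,\alpha}|^2/\binom{d_i}{\alpha}\big)^{1/2}$. For $x$ in the unit sphere $S^{n-1}\subset\mathbb{R}^n$ let $D_xP$ be the restriction of the derivative $DP(x)$ to the tangent space $T_xS^{n-1}=x^\perp$, let $\Delta$ be the diagonal matrix with entries $\sqrt{d_1},\dots,\sqrt{d_{n-1}}$, and put $\tilde\mu_{\mathrm{norm}}(P,x):=\|P\|_W\,\sigma_{\max}\big((D_xP)^{-1}\Delta\big)$ if $D_xP$ is invertible and $\tilde\mu_{\mathrm{norm}}(P,x):=\infty$ otherwise, where $\sigma_{\max}$ is the largest singular value. Then $$\tilde\kappa(P,x):=\frac{\|P\|_W}{\sqrt{\|P\|_W^2\,\tilde\mu_{\mathrm{norm}}(P,x)^{-2}+\|P(x)\|_2^2}}\in[0,\infty],\qquad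 \tilde\kappa(P):=\sup_{x\in S^{n-1}}\tilde\kappa(P,x),$$ where $\infty^{-2}=0$, the quotient is $\infty$ if $P\neq 0$ and its denominator vanishes, and $\tilde\kappa(P,x):=0$ if $P=0$. Put $M:=A\sqrt{N}\,(Kc_0)^{2(n-1)}\,(3d^2\log(ed))^{2n-3}\,\sqrt{n}$. Then: 1. $$\mathrm{Prob}\big(\tilde\kappa(P)\ge tM\big)\le\begin{cases}3t^{-1/2} & \text{if } 1\le t\le (ed)^{2(n-1)},\\[2pt] 3t^{-1/2}\left(\dfrac{t}{(ed)^{2(n-1)}}\right)^{\frac{1}{4\log(ed)}} & \text{if } t\ge (ed)^{2(n-1)}.\end{cases}$$ 2. Almost surely $0<\tilde\kappa(P)<\infty$, the random variable $\log\tilde\kappa(P)$ is integrable, and $\mathbb{E}\log\tilde\kappa(P)\le 1+\log M$. -/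

import Mathlib

open MeasureTheory ProbabilityTheory
open scoped ENNReal

namespace RandomSystem

noncomputable section

/-- The exponent vectors `α = (α₁, …, αₙ)` with `α₁ + ⋯ + αₙ = d`. -/
abbrev Exponent (n d : ℕ) : Type :=
  ↥(Finset.finsuppAntidiag (Finset.univ : Finset (Fin n)) d)

/-- The form `∑_{|α| = d} √(multinomial d α) · c_α · x^α` with coefficient vector `c`. -/
def form {n d : ℕ} (c : EuclideanSpace ℝ (Exponent n d)) : MvPolynomial (Fin n) ℝ :=
  ∑ α : Exponent n d,
    MvPolynomial.monomial (α : Fin n →₀ ℕ)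
      (Real.sqrt ((α : Fin n →₀ ℕ).multinomial : ℝ) * c α)

/-- The Weyl-Bombieri norm of a form of degree `d`. -/
def formNorm {n : ℕ} (d : ℕ) (p : MvPolynomial (Fin n) ℝ) : ℝ :=
  Real.sqrt (∑ α : Exponent n d,
    |MvPolynomial.coeff (α : Fin n →₀ ℕ) p| ^ 2 / ((α : Fin n →₀ ℕ).multinomial : ℝ))

/-- The Weyl-Bombieri norm `‖P‖_W` of a system of forms with degrees `d i`. -/
def sysNorm {m n : ℕ} (d : Fin m → ℕ) (P : Fin m → MvPolynomial (Fin n) ℝ) : ℝ :=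
  Real.sqrt (∑ i, formNorm (d i) (P i) ^ 2)

/-- The value `P(x)`. -/
def sysEval {m n : ℕ} (P : Fin m → MvPolynomial (Fin n) ℝ) (x : EuclideanSpace ℝ (Fin n)) :
    EuclideanSpace ℝ (Fin m) :=
  WithLp.toLp 2 (fun i => MvPolynomial.eval (fun j => x j) (P i))

/-- The Jacobian matrix of `P` at `x`. -/
def jacobian {m n : ℕ} (P : Fin m → MvPolynomial (Fin n) ℝ) (x : EuclideanSpace ℝ (Fin n)) :
    Matrix (Fin m) (Fin n) ℝ :=
  Matrix.of fun i j => MvPolynomial.eval (fun k => x k) (MvPolynomial.pderiv j (P i))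

/-- The tangent space `T_x S^{n-1}`, as the orthogonal complement of `x`. -/
abbrev tangent {n : ℕ} (x : EuclideanSpace ℝ (Fin n)) :
    Submodule ℝ (EuclideanSpace ℝ (Fin n)) :=
  (Submodule.span ℝ {x})ᗮ

/-- `DP(x)` restricted to `T_x S^{n-1}`. -/
def tangentDeriv {m n : ℕ} (P : Fin m → MvPolynomial (Fin n) ℝ)
    (x : EuclideanSpace ℝ (Fin n)) : tangent x →ₗ[ℝ] EuclideanSpace ℝ (Fin m) :=
  (Matrix.toEuclideanLin (jacobian P x)) ∘ₗ (tangent x).subtype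

/-- The diagonal map `Δ` with diagonal entries `√(d i)`. -/
def degreeScaling {m : ℕ} (d : Fin m → ℕ) :
    EuclideanSpace ℝ (Fin m) →ₗ[ℝ] EuclideanSpace ℝ (Fin m) :=
  Matrix.toEuclideanLin (Matrix.diagonal fun i => Real.sqrt (d i : ℝ))

open Classical in
/-- The normalized local condition number
`‖P‖_W · σ_max (DP(x)|_{T_x S^{n-1}}⁻¹ ∘ Δ)`, which is `∞` if `DP(x)|_{T_x S^{n-1}}` is not
invertible. Mathlib lists the singular values in descending order, starting from index `0`. -/
def muNorm {m n : ℕ} (d : Fin m → ℕ) (P : Fin m → MvPolynomial (Fin n) ℝ)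
    (x : EuclideanSpace ℝ (Fin n)) : ℝ≥0∞ :=
  if h : Function.Bijective (tangentDeriv P x) then
    ENNReal.ofReal (sysNorm d P *
      (((LinearEquiv.ofBijective (tangentDeriv P x) h).symm.toLinearMap ∘ₗ
        degreeScaling d).singularValues 0))
  else ∞

/-- The local condition number for real solving,
`‖P‖_W / √(‖P‖_W² · μ_norm(P, x)⁻² + ‖P(x)‖²)`, with values in `[0, ∞]`:
it is `∞` when `P ≠ 0` and the denominator vanishes. (For `P = 0`, where the quotient reads
`0/0`, it gets the value `0`.) -/
def kappaAt {m n : ℕ} (d : Fin m → ℕ) (P : Fin m → MvPolynomial (Fin n) ℝ)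
    (x : EuclideanSpace ℝ (Fin n)) : ℝ≥0∞ :=
  ENNReal.ofReal (sysNorm d P) /
    (ENNReal.ofReal (sysNorm d P) ^ 2 * (muNorm d P x ^ 2)⁻¹
      + ENNReal.ofReal ‖sysEval P x‖ ^ 2) ^ (1 / 2 : ℝ)

/-- The global condition number for real solving: the supremum of the local ones over the
unit sphere. -/
def kappa {m n : ℕ} (d : Fin m → ℕ) (P : Fin m → MvPolynomial (Fin n) ℝ) : ℝ≥0∞ :=
  ⨆ x ∈ Metric.sphere (0 : EuclideanSpace ℝ (Fin n)) 1, kappaAt d P x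

/-- Centering: all one-dimensional marginals have expectation zero. -/
def Centered {Ω ι : Type*} [MeasurableSpace Ω] [Fintype ι] (μ : Measure Ω)
    (X : Ω → EuclideanSpace ℝ ι) : Prop :=
  ∀ θ : EuclideanSpace ℝ ι, ‖θ‖ = 1 →
    Integrable (fun ω => inner ℝ (X ω) θ) μ ∧ ∫ ω, inner ℝ (X ω) θ ∂μ = 0

/-- Sub-Gaussian tails with constant `K` in every direction. -/
def SubGaussian {Ω ι : Type*} [MeasurableSpace Ω] [Fintype ι] (μ : Measure Ω)
    (X : Ω → EuclideanSpace ℝ ι) (K : ℝ) : Prop :=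
  ∀ θ : EuclideanSpace ℝ ι, ‖θ‖ = 1 → ∀ t : ℝ, 0 < t →
    μ.real {ω | t ≤ |inner ℝ (X ω) θ|} ≤ 2 * Real.exp (-(t ^ 2 / K ^ 2))

/-- The small ball property with constant `c₀`, for every nonzero direction `a`
(for `a = 0` the inequality would fail for every random vector). -/
def SmallBall {Ω ι : Type*} [MeasurableSpace Ω] [Fintype ι] (μ : Measure Ω)
    (X : Ω → EuclideanSpace ℝ ι) (c₀ : ℝ) : Prop :=
  ∀ a : EuclideanSpace ℝ ι, a ≠ 0 → ∀ ε : ℝ, 0 < ε →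
    μ.real {ω | |inner ℝ a (X ω)| ≤ ε * ‖a‖} ≤ c₀ * ε

/-- `N = ∑ i, (n + d i - 1 choose d i)`. -/
def numCoeffs {m : ℕ} (n : ℕ) (d : Fin m → ℕ) : ℕ :=
  ∑ i, (n + d i - 1).choose (d i)

/-- `d = max_i d i`. -/
def maxDeg {m : ℕ} (d : Fin m → ℕ) : ℕ :=
  Finset.univ.sup d

/-- `M = A √N (K c₀)^{2(n-1)} (3 d² log(e d))^{2n-3} √n`. -/
def boundM (A K c₀ : ℝ) (n : ℕ) (d : Fin (n - 1) → ℕ) : ℝ :=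
  A * Real.sqrt (numCoeffs n d : ℝ) * (K * c₀) ^ (2 * (n - 1)) *
    (3 * (maxDeg d : ℝ) ^ 2 * Real.log (Real.exp 1 * maxDeg d)) ^ (2 * n - 3) *
    Real.sqrt (n : ℝ)

/-- The threshold `(e d)^{2(n-1)}`. -/
def threshold (n : ℕ) (d : Fin (n - 1) → ℕ) : ℝ :=
  (Real.exp 1 * (maxDeg d : ℝ)) ^ (2 * (n - 1))

/-- The condition number of the random system whose coefficient vectors are `C i`. -/
def randomKappa {Ω : Type*} {m n : ℕ} {d : Fin m → ℕ}
    (C : ∀ i : Fin m, Ω → EuclideanSpace ℝ (Exponent n (d i))) (ω : Ω) : ℝ≥0∞ :=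
  kappa d (fun i => form (C i ω))

end

end RandomSystem

/- The condition number is `‖P‖_W` divided by the square root of the minimum, over orthonormal pairs
`(x, y)`, of `∑ i, (DPᵢ(x) y)² / dᵢ + ‖P(x)‖²`. Hence if it is large, then `P` is large somewhere on
the sphere, or `‖P‖_W` is large, or this minimum is tiny although `‖P‖ ≤ γ` on the sphere. The
sub-Gaussian hypothesis makes the first two events unlikely. In the third, `P` nearly vanishes at
`x` to first order along `y`, and Bernstein's inequality for trigonometric polynomials on great
circles propagates this: `‖P‖` is at most a multiple of `ε γ` at the radial projections of a whole
tube around `x`, of length of order `√ε` along `y` and of width of order `ε` across. Since the small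
ball property bounds the probability of that at each point, Fubini's theorem bounds the probability
of the third event by the ratio of this pointwise bound to the relative volume of the tube, in which
one power of `√ε` is left over. -/

namespace RandomSystem

section Riesz

variable {D : ℕ}

lemma card_filter_sub_eq (D : ℕ) (c : ℤ) :
    (((Finset.range D ×ˢ Finset.range D).filter fun p => (p.1 : ℤ) - p.2 = c).card : ℤ)
      = max (D - |c|) 0 := by
  have h : (Finset.range D ×ˢ Finset.range D).filter (fun p => (p.1 : ℤ) - p.2 = c)
      = (Finset.range (D - c.natAbs)).image fun b => (b + c.toNat, b + (-c).toNat) := by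
    ext ⟨a, b⟩
    simp only [Finset.mem_filter, Finset.mem_product, Finset.mem_range, Finset.mem_image,
      Prod.mk.injEq]
    constructor
    · intro h
      exact ⟨a - c.toNat, by omega⟩
    · rintro ⟨k, h⟩
      omega
  rw [h, Finset.card_image_of_injective _ fun a b hab => by simpa using hab, Finset.card_range,
    Int.abs_eq_natAbs]
  omega

/-- The interpolation nodes `θ_k` in M. Riesz's formula for trigonometric polynomials of degree
`D`: the zeros of `cos (D θ)` in `[0, 2π]`. -/
noncomputable def rieszNode (D k : ℕ) : ℝ := (2 * k + 1) * Real.pi / (2 * D)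

/-- The absolute values of the weights in M. Riesz's formula. The usual expression is
`1 / (4 D² sin² (θ_k / 2))`; it is written here as a value of the Fejér kernel. -/
noncomputable def rieszWeight (D k : ℕ) : ℝ :=
  Complex.normSq (∑ a ∈ Finset.range D, Complex.exp (a * rieszNode D k * Complex.I))
    / (2 * (D : ℝ) ^ 2)

lemma rieszWeight_nonneg (D k : ℕ) : 0 ≤ rieszWeight D k :=
  div_nonneg (Complex.normSq_nonneg _) (by positivity)

lemma rieszWeight_eq_sum_exp (D k : ℕ) :
    (rieszWeight D k : ℂ) = (∑ p ∈ Finset.range D ×ˢ Finset.range D,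
      Complex.exp (((p.1 : ℤ) - p.2 : ℤ) * rieszNode D k * Complex.I)) / (2 * (D : ℂ) ^ 2) := by
  rw [rieszWeight]
  push_cast
  rw [← Complex.mul_conj, map_sum, Finset.sum_mul_sum, Finset.sum_product]
  congr 1
  refine Finset.sum_congr rfl fun a _ => Finset.sum_congr rfl fun b _ => ?_
  rw [← Complex.exp_conj, ← Complex.exp_add]
  congr 1
  simp only [map_mul, Complex.conj_I, Complex.conj_ofReal, Complex.conj_natCast]
  ring

lemma exp_mul_rieszNode (hD : 0 < D) (k : ℕ) :
    Complex.exp (D * rieszNode D k * Complex.I) = (-1) ^ k * Complex.I := by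
  have hD' : (D : ℂ) ≠ 0 := by exact_mod_cast hD.ne'
  have h : (D : ℂ) * rieszNode D k * Complex.I
      = k * (Real.pi * Complex.I) + Real.pi / 2 * Complex.I := by
    rw [rieszNode]; push_cast; field_simp
  rw [h, Complex.exp_add, Complex.exp_nat_mul, Complex.exp_pi_mul_I,
    Complex.exp_pi_div_two_mul_I]

lemma exp_neg_mul_rieszNode (hD : 0 < D) (k : ℕ) :
    Complex.exp (-(D * rieszNode D k * Complex.I)) = (-1) ^ k * -Complex.I := by
  rw [Complex.exp_neg, exp_mul_rieszNode hD, mul_inv, Complex.inv_I,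
    ← inv_pow, inv_neg_one]

lemma sum_alternating_exp_rieszNode_eq_zero (hD : 0 < D) {r : ℤ} (h : |r| < 2 * D)
    (hr : r ≠ D) (hr' : r ≠ -D) :
    ∑ k ∈ Finset.range (2 * D), (-1 : ℂ) ^ k * Complex.exp (r * rieszNode D k * Complex.I) = 0 := by
  have hD' : (D : ℂ) ≠ 0 := by exact_mod_cast hD.ne'
  set ζ : ℂ := Complex.exp (2 * Real.pi * Complex.I / (2 * D : ℕ)) with hζ_def
  have hζ : IsPrimitiveRoot ζ (2 * D) := Complex.isPrimitiveRoot_exp _ (by omega)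
  have hterm : ∀ k ∈ Finset.range (2 * D),
      (-1 : ℂ) ^ k * Complex.exp (r * rieszNode D k * Complex.I)
        = Complex.exp (r * Real.pi / (2 * D) * Complex.I) * (ζ ^ (r + D)) ^ k := by
    intro k _
    rw [← Complex.exp_pi_mul_I, hζ_def, ← Complex.exp_int_mul, ← Complex.exp_nat_mul,
      ← Complex.exp_nat_mul, ← Complex.exp_add, ← Complex.exp_add, rieszNode]
    congr 1
    push_cast
    field_simp
    ring
  have hne : ζ ^ (r + D) ≠ 1 := by
    rw [Ne, hζ.zpow_eq_one_iff_dvd]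
    rintro ⟨q, hq⟩
    push_cast at hq
    rw [abs_lt] at h
    have hq_lo : -1 < q := by nlinarith
    have hq_hi : q < 2 := by nlinarith
    interval_cases q <;> omega
  have hpow : (ζ ^ (r + D)) ^ (2 * D) = 1 := by
    rw [← zpow_natCast, ← zpow_mul, mul_comm, zpow_mul, zpow_natCast, hζ.pow_eq_one, one_zpow]
  rw [Finset.sum_congr rfl hterm, ← Finset.mul_sum, geom_sum_eq hne, hpow, sub_self, zero_div,
    mul_zero]

lemma sum_alternating_exp_rieszNode (hD : 0 < D) {r : ℤ} (h : |r| < 2 * D) :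
    ∑ k ∈ Finset.range (2 * D), (-1 : ℂ) ^ k * Complex.exp (r * rieszNode D k * Complex.I)
      = 2 * D * Complex.I * ((if r = D then 1 else 0) - if r = -D then 1 else 0) := by
  have hsign (k : ℕ) : (-1 : ℂ) ^ k * (-1) ^ k = 1 := by rw [← mul_pow]; simp
  by_cases hr : r = D
  · have hr' : ¬ (D : ℤ) = -D := by omega
    simp [hr, hr', exp_mul_rieszNode hD, ← mul_assoc, hsign]
  by_cases hr' : r = -D
  · have hr'' : ¬ -(D : ℤ) = D := by omega
    simp [hr', hr'', exp_neg_mul_rieszNode hD, ← mul_assoc, hsign]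
  · simp [hr, hr', sum_alternating_exp_rieszNode_eq_zero hD h]

/-- Expanding the Fejér kernel, both sides count the pairs `a, b < D` with `a - b = D - j`, minus
those with `a - b = -(D + j)`. -/
lemma riesz_identity {j : ℤ} (hj : |j| ≤ D) :
    (D : ℂ) * ∑ k ∈ Finset.range (2 * D), (-1 : ℂ) ^ k * rieszWeight D k *
      Complex.exp (j * rieszNode D k * Complex.I) = j * Complex.I := by
  rcases D.eq_zero_or_pos with rfl | hD
  · simp [abs_nonpos_iff.1 hj]
  have hD' : (D : ℂ) ≠ 0 := by exact_mod_cast hD.ne'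
  have hj' := abs_le.1 hj
  set S := Finset.range D ×ˢ Finset.range D
  have hexpand : ∀ k ∈ Finset.range (2 * D), (-1 : ℂ) ^ k * rieszWeight D k *
      Complex.exp (j * rieszNode D k * Complex.I) = (∑ p ∈ S, (-1 : ℂ) ^ k *
        Complex.exp ((j + (p.1 - p.2) : ℤ) * rieszNode D k * Complex.I)) / (2 * (D : ℂ) ^ 2) := by
    intro k _
    rw [rieszWeight_eq_sum_exp, mul_div_assoc', div_mul_eq_mul_div, Finset.mul_sum, Finset.sum_mul]
    congr 1
    refine Finset.sum_congr rfl fun p _ => ?_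
    rw [mul_assoc, ← Complex.exp_add]
    congr 2
    push_cast; ring
  have hpair : ∀ p ∈ S, ∑ k ∈ Finset.range (2 * D), (-1 : ℂ) ^ k *
      Complex.exp ((j + (p.1 - p.2) : ℤ) * rieszNode D k * Complex.I)
      = 2 * D * Complex.I * ((if (p.1 : ℤ) - p.2 = D - j then 1 else 0)
        - if (p.1 : ℤ) - p.2 = -(D + j) then 1 else 0) := by
    intro p hp
    simp only [S, Finset.mem_product, Finset.mem_range] at hp
    rw [sum_alternating_exp_rieszNode hD (by rw [abs_lt]; omega)]
    congr 3 <;> simp only [eq_iff_iff] <;> omega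
  have hcard : (((S.filter fun p => (p.1 : ℤ) - p.2 = D - j).card : ℤ)
      - ((S.filter fun p => (p.1 : ℤ) - p.2 = -(D + j)).card : ℤ)) = j := by
    rw [card_filter_sub_eq, card_filter_sub_eq, abs_neg, abs_of_nonneg (by omega : 0 ≤ D - j),
      abs_of_nonneg (by omega : 0 ≤ D + j)]
    omega
  rw [Finset.sum_congr rfl hexpand, ← Finset.sum_div, Finset.sum_comm, Finset.sum_congr rfl hpair,
    ← Finset.mul_sum, Finset.sum_sub_distrib, Finset.sum_boole, Finset.sum_boole]
  have hcard' := congrArg (Int.cast : ℤ → ℂ) hcard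
  push_cast at hcard'
  rw [hcard']
  field_simp

/-- The factor `D` makes the identity hold for `D = 0`, where there are no nodes. -/
lemma natCast_mul_sum_rieszWeight (D : ℕ) :
    (D : ℝ) * ∑ k ∈ Finset.range (2 * D), rieszWeight D k = D := by
  rcases D.eq_zero_or_pos with rfl | hD
  · simp
  have hterm : ∀ k ∈ Finset.range (2 * D), (-1 : ℂ) ^ k * rieszWeight D k *
      Complex.exp (((D : ℤ) : ℂ) * rieszNode D k * Complex.I) = rieszWeight D k * Complex.I := by
    intro k _
    have hsign : (-1 : ℂ) ^ k * (-1) ^ k = 1 := by rw [← mul_pow]; simp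
    rw [Int.cast_natCast, exp_mul_rieszNode hD]
    linear_combination (rieszWeight D k * Complex.I) * hsign
  have h := riesz_identity (D := D) (j := D) (by simp)
  rw [Finset.sum_congr rfl hterm, ← Finset.sum_mul, ← mul_assoc, Int.cast_natCast] at h
  exact_mod_cast mul_right_cancel₀ Complex.I_ne_zero h

lemma riesz_cos {j : ℕ} (hj : j ≤ D) (φ : ℝ) :
    (D : ℝ) * ∑ k ∈ Finset.range (2 * D), (-1 : ℝ) ^ k * rieszWeight D k *
      Real.cos (φ + j * rieszNode D k) = -j * Real.sin φ := by
  calc (D : ℝ) * ∑ k ∈ Finset.range (2 * D), (-1 : ℝ) ^ k * rieszWeight D k *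
        Real.cos (φ + j * rieszNode D k)
      = (((D : ℝ) : ℂ) * ∑ k ∈ Finset.range (2 * D), (((-1 : ℝ) ^ k * rieszWeight D k : ℝ) : ℂ) *
          Complex.exp ((φ + j * rieszNode D k : ℝ) * Complex.I)).re := by
        simp only [Complex.re_ofReal_mul, Complex.re_sum, Complex.exp_ofReal_mul_I_re]
    _ = (Complex.exp (φ * Complex.I) * ((D : ℂ) * ∑ k ∈ Finset.range (2 * D),
          (-1 : ℂ) ^ k * rieszWeight D k *
            Complex.exp (((j : ℤ) : ℂ) * rieszNode D k * Complex.I))).re := by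
        congr 1
        rw [mul_left_comm, Complex.ofReal_natCast, Finset.mul_sum (a := Complex.exp _)]
        congr 1
        refine Finset.sum_congr rfl fun k _ => ?_
        push_cast
        rw [add_mul, Complex.exp_add]
        ring
    _ = -j * Real.sin φ := by
        rw [riesz_identity (by simpa using hj), Int.cast_natCast, mul_left_comm,
          ← Complex.ofReal_natCast, Complex.re_ofReal_mul, Complex.mul_I_re,
          Complex.exp_ofReal_mul_I_im]
        ring

end Riesz

section TrigPoly

variable {E : Type*} [NormedAddCommGroup E] [NormedSpace ℝ E] {D : ℕ} {f : ℝ → E} {γ : ℝ}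

/-- Trigonometric polynomials of degree at most `D` with coefficients in `E`, as combinations of
phase-shifted waves, so that products and translates of waves are again (sums of) waves. -/
def trigPoly (E : Type*) [NormedAddCommGroup E] [NormedSpace ℝ E] (D : ℕ) :
    Submodule ℝ (ℝ → E) :=
  Submodule.span ℝ {f | ∃ j ≤ D, ∃ (φ : ℝ) (v : E), f = fun θ => Real.cos (j * θ + φ) • v}

lemma wave_mem_trigPoly {j : ℕ} (hj : j ≤ D) (φ : ℝ) (v : E) :
    (fun θ => Real.cos (j * θ + φ) • v) ∈ trigPoly E D :=
  Submodule.subset_span ⟨j, hj, φ, v, rfl⟩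

lemma trigPoly_mono {D D' : ℕ} (h : D ≤ D') : trigPoly E D ≤ trigPoly E D' :=
  Submodule.span_mono fun _ ⟨j, hj, hf⟩ => ⟨j, hj.trans h, hf⟩

lemma const_mem_trigPoly (D : ℕ) (v : E) : (fun _ => v) ∈ trigPoly E D := by
  simpa using wave_mem_trigPoly D.zero_le 0 v

lemma cos_mem_trigPoly : Real.cos ∈ trigPoly ℝ 1 := by
  simpa using wave_mem_trigPoly (le_refl 1) 0 (1 : ℝ)

lemma sin_mem_trigPoly : Real.sin ∈ trigPoly ℝ 1 := by
  simpa [← sub_eq_add_neg, Real.cos_sub_pi_div_two] using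
    wave_mem_trigPoly (le_refl 1) (-(Real.pi / 2)) (1 : ℝ)

lemma comp_add_const_mem_trigPoly (hf : f ∈ trigPoly E D) (a : ℝ) :
    (fun θ => f (θ + a)) ∈ trigPoly E D := by
  induction hf using Submodule.span_induction with
  | mem f hf =>
    obtain ⟨j, hj, φ, v, rfl⟩ := hf
    simpa only [mul_add, add_assoc] using wave_mem_trigPoly hj (j * a + φ) v
  | zero => exact zero_mem _
  | add f g _ _ hf hg => exact add_mem hf hg
  | smul c f _ hf => exact Submodule.smul_mem _ c hf

lemma smul_const_mem_trigPoly {f : ℝ → ℝ} (hf : f ∈ trigPoly ℝ D) (v : E) :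
    (fun θ => f θ • v) ∈ trigPoly E D := by
  induction hf using Submodule.span_induction with
  | mem f hf =>
    obtain ⟨j, hj, φ, c, rfl⟩ := hf
    simpa only [smul_smul, smul_eq_mul] using wave_mem_trigPoly hj φ (c • v)
  | zero => simpa using const_mem_trigPoly D (0 : E)
  | add f g _ _ hf hg =>
    simp only [Pi.add_apply, add_smul]
    exact add_mem hf hg
  | smul c f _ hf =>
    simp only [Pi.smul_apply, smul_eq_mul, mul_smul]
    exact Submodule.smul_mem _ c hf

lemma wave_mul_wave_mem_trigPoly (j k : ℕ) (φ ψ v w : ℝ) :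
    (fun θ => Real.cos (j * θ + φ) * v * (Real.cos (k * θ + ψ) * w)) ∈ trigPoly ℝ (j + k) := by
  wlog hkj : k ≤ j generalizing j k φ ψ v w
  · simpa only [add_comm j k, mul_comm] using this k j ψ φ w v (by omega)
  convert add_mem (wave_mem_trigPoly (le_refl (j + k)) (φ + ψ) (v * w / 2))
    (wave_mem_trigPoly (by omega : j - k ≤ j + k) (φ - ψ) (v * w / 2)) using 1
  funext θ
  have hprod := Real.two_mul_cos_mul_cos (j * θ + φ) (k * θ + ψ)
  have hadd : j * θ + φ + (k * θ + ψ) = ((j + k : ℕ) : ℝ) * θ + (φ + ψ) := by push_cast; ring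
  have hsub : j * θ + φ - (k * θ + ψ) = ((j - k : ℕ) : ℝ) * θ + (φ - ψ) := by
    push_cast [hkj]; ring
  rw [hadd, hsub] at hprod
  simp only [Pi.add_apply, smul_eq_mul]
  linear_combination (v * w / 2) * hprod

lemma mul_mem_trigPoly {D' : ℕ} {f g : ℝ → ℝ} (hf : f ∈ trigPoly ℝ D) (hg : g ∈ trigPoly ℝ D') :
    f * g ∈ trigPoly ℝ (D + D') := by
  have h : trigPoly ℝ D * trigPoly ℝ D' ≤ trigPoly ℝ (D + D') := by
    rw [trigPoly, trigPoly, Submodule.span_mul_span, Submodule.span_le]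
    rintro _ ⟨_, ⟨j, hj, φ, v, rfl⟩, _, ⟨k, hk, ψ, w, rfl⟩, rfl⟩
    exact trigPoly_mono (add_le_add hj hk) (wave_mul_wave_mem_trigPoly j k φ ψ v w)
  exact h (Submodule.mul_mem_mul hf hg)

lemma pow_mem_trigPoly {f : ℝ → ℝ} (hf : f ∈ trigPoly ℝ D) (e : ℕ) :
    f ^ e ∈ trigPoly ℝ (e * D) := by
  induction e with
  | zero => exact const_mem_trigPoly _ _
  | succ e ih => simpa only [pow_succ, Nat.succ_mul] using mul_mem_trigPoly ih hf

lemma prod_mem_trigPoly {σ : Type*} (s : Finset σ) {f : σ → ℝ → ℝ} {e : σ → ℕ}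
    (hf : ∀ j ∈ s, f j ∈ trigPoly ℝ (e j)) : ∏ j ∈ s, f j ∈ trigPoly ℝ (∑ j ∈ s, e j) := by
  classical
  induction s using Finset.induction_on with
  | empty => exact const_mem_trigPoly _ _
  | insert a s ha ih =>
    rw [Finset.prod_insert ha, Finset.sum_insert ha]
    exact mul_mem_trigPoly (hf a (Finset.mem_insert_self _ _))
      (ih fun j hj => hf j (Finset.mem_insert_of_mem hj))

lemma eval_mem_trigPoly {σ : Type*} {p : MvPolynomial σ ℝ} (hp : p.totalDegree ≤ D)
    {g : σ → ℝ → ℝ} (hg : ∀ j, g j ∈ trigPoly ℝ 1) :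
    (fun θ => MvPolynomial.eval (fun j => g j θ) p) ∈ trigPoly ℝ D := by
  have h : (fun θ => MvPolynomial.eval (fun j => g j θ) p)
      = ∑ α ∈ p.support, p.coeff α • ∏ j ∈ α.support, g j ^ α j := by
    funext θ
    simp [MvPolynomial.eval_eq, Finset.sum_apply, Finset.prod_apply]
  rw [h]
  refine Submodule.sum_mem _ fun α hα => Submodule.smul_mem _ _ ?_
  refine trigPoly_mono ((MvPolynomial.le_totalDegree hα).trans hp) ?_
  exact prod_mem_trigPoly _ fun j _ => by simpa using pow_mem_trigPoly (hg j) (α j)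

/-- The right-hand side of M. Riesz's interpolation formula
`f' (θ) = D ∑ (-1)^k w_k f (θ + θ_k)`. -/
noncomputable def rieszDeriv (D : ℕ) (f : ℝ → E) (θ : ℝ) : E :=
  (D : ℝ) • ∑ k ∈ Finset.range (2 * D), ((-1) ^ k * rieszWeight D k) • f (θ + rieszNode D k)

lemma hasDerivAt_rieszDeriv (hf : f ∈ trigPoly E D) (θ : ℝ) :
    HasDerivAt f (rieszDeriv D f θ) θ := by
  induction hf using Submodule.span_induction with
  | mem f hf =>
    obtain ⟨j, hj, φ, v, rfl⟩ := hf
    have h : HasDerivAt (fun θ => Real.cos (j * θ + φ)) (-j * Real.sin (j * θ + φ)) θ := by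
      have := (((hasDerivAt_id θ).const_mul (j : ℝ)).add_const φ).cos
      simpa [mul_comm] using this
    convert h.smul_const v using 1
    rw [← riesz_cos hj, rieszDeriv, mul_smul, Finset.sum_smul]
    congr 1
    refine Finset.sum_congr rfl fun k _ => ?_
    rw [smul_smul]
    congr 3
    ring
  | zero => simp [rieszDeriv]
  | add f g _ _ hf hg => simpa [rieszDeriv, smul_add, Finset.sum_add_distrib] using hf.add hg
  | smul c f _ hf =>
    simpa [rieszDeriv, Finset.smul_sum, smul_smul, mul_comm, mul_left_comm] using hf.const_smul c

lemma deriv_mem_trigPoly (hf : f ∈ trigPoly E D) : deriv f ∈ trigPoly E D := by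
  have h : deriv f = (D : ℝ) • ∑ k ∈ Finset.range (2 * D),
      ((-1) ^ k * rieszWeight D k) • fun θ => f (θ + rieszNode D k) := by
    funext θ
    simp [(hasDerivAt_rieszDeriv hf θ).deriv, rieszDeriv]
  rw [h]
  exact Submodule.smul_mem _ _ <| Submodule.sum_mem _ fun k _ =>
    Submodule.smul_mem _ _ (comp_add_const_mem_trigPoly hf _)

lemma differentiable_of_mem_trigPoly (hf : f ∈ trigPoly E D) : Differentiable ℝ f :=
  fun θ => (hasDerivAt_rieszDeriv hf θ).differentiableAt

theorem bernstein_norm_deriv_le (hf : f ∈ trigPoly E D) (hγ : ∀ θ, ‖f θ‖ ≤ γ) (θ : ℝ) :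
    ‖deriv f θ‖ ≤ D * γ := by
  have hterm : ∀ k ∈ Finset.range (2 * D),
      ‖((-1) ^ k * rieszWeight D k) • f (θ + rieszNode D k)‖ ≤ rieszWeight D k * γ := by
    intro k _
    rw [norm_smul, norm_mul, norm_pow, norm_neg, norm_one, one_pow, one_mul,
      Real.norm_of_nonneg (rieszWeight_nonneg D k)]
    exact mul_le_mul_of_nonneg_left (hγ _) (rieszWeight_nonneg D k)
  rw [(hasDerivAt_rieszDeriv hf θ).deriv, rieszDeriv, norm_smul, Real.norm_natCast]
  calc (D : ℝ) * ‖∑ k ∈ Finset.range (2 * D),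
        ((-1) ^ k * rieszWeight D k) • f (θ + rieszNode D k)‖
      ≤ D * ∑ k ∈ Finset.range (2 * D), rieszWeight D k * γ := by
        gcongr
        exact norm_sum_le_of_le _ hterm
    _ = D * γ := by rw [← Finset.sum_mul, ← mul_assoc, natCast_mul_sum_rieszWeight]

lemma norm_sub_le_of_mem_trigPoly (hf : f ∈ trigPoly E D) (hγ : ∀ θ, ‖f θ‖ ≤ γ) (θ φ : ℝ) :
    ‖f θ - f φ‖ ≤ D * γ * |θ - φ| :=
  Convex.norm_image_sub_le_of_norm_deriv_le (fun x _ => differentiable_of_mem_trigPoly hf x)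
    (fun x _ => bernstein_norm_deriv_le hf hγ x) convex_univ (Set.mem_univ φ) (Set.mem_univ θ)

lemma norm_sub_sub_smul_deriv_le_of_mem_trigPoly (hf : f ∈ trigPoly E D)
    (hγ : ∀ θ, ‖f θ‖ ≤ γ) (θ : ℝ) :
    ‖f θ - f 0 - θ • deriv f 0‖ ≤ D ^ 2 * γ * θ ^ 2 := by
  have hderiv (s : ℝ) : ‖deriv f s - deriv f 0‖ ≤ D * (D * γ) * |s| := by
    simpa using norm_sub_le_of_mem_trigPoly (deriv_mem_trigPoly hf)
      (bernstein_norm_deriv_le hf hγ) s 0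
  have hγ_nonneg : 0 ≤ γ := (norm_nonneg _).trans (hγ 0)
  have h := Convex.norm_image_sub_le_of_norm_hasDerivWithin_le
    (f := fun s => f s - s • deriv f 0) (f' := fun s => deriv f s - deriv f 0)
    (C := D * (D * γ) * |θ|) (s := Set.uIcc 0 θ)
    (fun s _ => by
      simpa using ((differentiable_of_mem_trigPoly hf s).hasDerivAt.fun_sub
        ((hasDerivAt_id s).smul_const (deriv f 0))).hasDerivWithinAt)
    (fun s hs => (hderiv s).trans <| by
      have : |s| ≤ |θ| := by simpa using Set.abs_sub_left_of_mem_uIcc hs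
      gcongr)
    (convex_uIcc 0 θ) Set.left_mem_uIcc Set.right_mem_uIcc
  calc ‖f θ - f 0 - θ • deriv f 0‖ = ‖f θ - θ • deriv f 0 - (f 0 - (0 : ℝ) • deriv f 0)‖ := by
        congr 1
        rw [zero_smul]
        abel
    _ ≤ D * (D * γ) * |θ| * ‖θ - 0‖ := h
    _ = D ^ 2 * γ * θ ^ 2 := by rw [sub_zero, Real.norm_eq_abs, ← sq_abs θ]; ring

end TrigPoly

lemma hasDerivAt_mvPolynomial_eval {σ : Type*} [Fintype σ] (p : MvPolynomial σ ℝ)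
    {c : ℝ → σ → ℝ} {c' : σ → ℝ} {t : ℝ} (hc : ∀ j, HasDerivAt (fun θ => c θ j) (c' j) t) :
    HasDerivAt (fun θ => MvPolynomial.eval (c θ) p)
      (∑ j, MvPolynomial.eval (c t) (MvPolynomial.pderiv j p) * c' j) t := by
  classical
  induction p using MvPolynomial.induction_on with
  | C a => simpa using hasDerivAt_const t a
  | add p q hp hq => simpa [add_mul, Finset.sum_add_distrib] using hp.fun_add hq
  | mul_X p i hp =>
    have hmul := hp.fun_mul (hc i)
    simp only [map_mul, MvPolynomial.eval_X]
    refine hmul.congr_deriv (Eq.symm ?_)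
    simp only [MvPolynomial.pderiv_mul, MvPolynomial.pderiv_X, map_add, map_mul,
      MvPolynomial.eval_X, add_mul, Finset.sum_add_distrib, Finset.sum_mul]
    congr 1
    · exact Finset.sum_congr rfl fun j _ => by ring
    · simp [Pi.single_apply, apply_ite (MvPolynomial.eval (c t))]

section GreatCircle

variable {E : Type*} [NormedAddCommGroup E] [InnerProductSpace ℝ E] {x y : E}

/-- The point at angle `θ` on the great circle that passes through `x` in direction `y`; the pair
`x`, `y` is meant to be orthonormal. -/
noncomputable def greatCircle (x y : E) (θ : ℝ) : E := Real.cos θ • x + Real.sin θ • y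

lemma norm_smul_add_smul_sq (hx : ‖x‖ = 1) (hy : ‖y‖ = 1) (hxy : inner ℝ x y = 0) (a b : ℝ) :
    ‖a • x + b • y‖ ^ 2 = a ^ 2 + b ^ 2 := by
  rw [norm_add_sq_real, norm_smul, norm_smul, hx, hy, inner_smul_left, inner_smul_right, hxy]
  simp

lemma norm_greatCircle (hx : ‖x‖ = 1) (hy : ‖y‖ = 1) (hxy : inner ℝ x y = 0) (θ : ℝ) :
    ‖greatCircle x y θ‖ = 1 := by
  rw [← pow_left_inj₀ (norm_nonneg _) zero_le_one two_ne_zero, greatCircle,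
    norm_smul_add_smul_sq hx hy hxy, Real.cos_sq_add_sin_sq, one_pow]

lemma abs_arctan_le (t : ℝ) : |Real.arctan t| ≤ |t| := by
  have arctan_le : ∀ s : ℝ, 0 ≤ s → Real.arctan s ≤ s := fun s hs => by
    simpa using Real.le_tan (Real.arctan_nonneg.2 hs) (Real.arctan_lt_pi_div_two s)
  rcases le_total 0 t with h | h
  · rw [abs_of_nonneg h, abs_of_nonneg (Real.arctan_nonneg.2 h)]
    exact arctan_le t h
  · rw [abs_of_nonpos h, abs_of_nonpos (Real.arctan_le_zero.2 h), ← Real.arctan_neg]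
    exact arctan_le (-t) (neg_nonneg.2 h)

lemma normalize_eq_greatCircle_arctan (hx : ‖x‖ = 1) (hy : ‖y‖ = 1) (hxy : inner ℝ x y = 0)
    {s : ℝ} (hs : 0 < s) (r : ℝ) :
    ‖s • x + r • y‖⁻¹ • (s • x + r • y) = greatCircle x y (Real.arctan (r / s)) := by
  have hnorm : ‖s • x + r • y‖ = s * √(1 + (r / s) ^ 2) := by
    rw [← pow_left_inj₀ (norm_nonneg _) (by positivity) two_ne_zero,
      norm_smul_add_smul_sq hx hy hxy, mul_pow, Real.sq_sqrt (by positivity)]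
    field_simp
  rw [greatCircle, Real.cos_arctan, Real.sin_arctan, hnorm, smul_add, smul_smul, smul_smul]
  congr 2 <;> field_simp

end GreatCircle

section Sphere

variable {m n D : ℕ} {P : Fin m → MvPolynomial (Fin n) ℝ} {γ : ℝ}
  {x y : EuclideanSpace ℝ (Fin n)}

/-- The directional derivative `DP(x) y`. -/
noncomputable def dirDeriv (P : Fin m → MvPolynomial (Fin n) ℝ)
    (x y : EuclideanSpace ℝ (Fin n)) : EuclideanSpace ℝ (Fin m) :=
  Matrix.toEuclideanLin (jacobian P x) y

lemma dirDeriv_apply (P : Fin m → MvPolynomial (Fin n) ℝ) (x y : EuclideanSpace ℝ (Fin n))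
    (i : Fin m) : dirDeriv P x y i =
      ∑ j, MvPolynomial.eval (fun k => x k) (MvPolynomial.pderiv j (P i)) * y j := by
  simp [dirDeriv, jacobian, Matrix.toLpLin_apply, Matrix.mulVec, dotProduct]

lemma sysEval_greatCircle_mem_trigPoly (hP : ∀ i, (P i).totalDegree ≤ D)
    (x y : EuclideanSpace ℝ (Fin n)) :
    (fun θ => sysEval P (greatCircle x y θ)) ∈ trigPoly (EuclideanSpace ℝ (Fin m)) D := by
  have hcoord : ∀ j, (fun θ => greatCircle x y θ j) ∈ trigPoly ℝ 1 := fun j => by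
    exact Submodule.add_mem (trigPoly ℝ 1) (smul_const_mem_trigPoly cos_mem_trigPoly (x j))
      (smul_const_mem_trigPoly sin_mem_trigPoly (y j))
  have hsum : (fun θ => sysEval P (greatCircle x y θ)) = ∑ i, fun θ =>
      MvPolynomial.eval (fun j => greatCircle x y θ j) (P i) • EuclideanSpace.single i (1 : ℝ) := by
    ext θ i
    simp [sysEval, Finset.sum_apply, Pi.single_apply]
  rw [hsum]
  exact Submodule.sum_mem _ fun i _ => smul_const_mem_trigPoly (eval_mem_trigPoly (hP i) hcoord) _

lemma hasDerivAt_sysEval_greatCircle (P : Fin m → MvPolynomial (Fin n) ℝ)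
    (x y : EuclideanSpace ℝ (Fin n)) :
    HasDerivAt (fun θ => sysEval P (greatCircle x y θ)) (dirDeriv P x y) 0 := by
  have hcoord : ∀ j, HasDerivAt (fun θ => greatCircle x y θ j) (y j) 0 := fun j => by
    simpa [greatCircle] using ((Real.hasDerivAt_cos 0).mul_const (x j)).fun_add
      ((Real.hasDerivAt_sin 0).mul_const (y j))
  refine (PiLp.continuousLinearEquiv 2 ℝ (fun _ : Fin m => ℝ)).symm.hasFDerivAt.comp_hasDerivAt
    (f' := (dirDeriv P x y).ofLp) 0 (hasDerivAt_pi.2 fun i => ?_)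
  exact (hasDerivAt_mvPolynomial_eval (P i) hcoord).congr_deriv
    (by simp [dirDeriv_apply, greatCircle])

/-- The value of `P` at the radial projection of `w` to the unit sphere. -/
noncomputable def projEval (P : Fin m → MvPolynomial (Fin n) ℝ) (w : EuclideanSpace ℝ (Fin n)) :
    EuclideanSpace ℝ (Fin m) :=
  sysEval P (‖w‖⁻¹ • w)

lemma projEval_smul_add_smul (P : Fin m → MvPolynomial (Fin n) ℝ) (hx : ‖x‖ = 1) (hy : ‖y‖ = 1)
    (hxy : inner ℝ x y = 0) {s : ℝ} (hs : 0 < s) (r : ℝ) :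
    projEval P (s • x + r • y) = sysEval P (greatCircle x y (Real.arctan (r / s))) := by
  rw [projEval, normalize_eq_greatCircle_arctan hx hy hxy hs]

lemma norm_projEval_sub_le (hP : ∀ i, (P i).totalDegree ≤ D)
    (hγ : ∀ z, ‖z‖ = 1 → ‖sysEval P z‖ ≤ γ) (hx : ‖x‖ = 1)
    {v : EuclideanSpace ℝ (Fin n)} (hv : inner ℝ x v = 0) {s : ℝ} (hs : 0 < s) :
    ‖projEval P (s • x + v) - sysEval P x‖ ≤ D * γ * (‖v‖ / s) := by
  have hγ0 : 0 ≤ γ := (norm_nonneg _).trans (hγ x hx)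
  rcases eq_or_ne v 0 with rfl | hv0
  · simp [projEval, norm_smul, hx, smul_smul, abs_of_pos hs, hs.ne']
  obtain ⟨y, hy, hvy⟩ : ∃ y : EuclideanSpace ℝ (Fin n), ‖y‖ = 1 ∧ v = ‖v‖ • y :=
    ⟨‖v‖⁻¹ • v, norm_smul_inv_norm (𝕜 := ℝ) hv0,
      by rw [smul_smul, mul_inv_cancel₀ (norm_ne_zero_iff.2 hv0), one_smul]⟩
  have hxy : inner ℝ x y = 0 := by
    rw [hvy, inner_smul_right] at hv
    exact (mul_eq_zero.1 hv).resolve_left (norm_ne_zero_iff.2 hv0)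
  have hlip := norm_sub_le_of_mem_trigPoly (sysEval_greatCircle_mem_trigPoly hP x y)
    (fun θ => hγ _ (norm_greatCircle hx hy hxy θ)) (Real.arctan (‖v‖ / s)) 0
  rw [← projEval_smul_add_smul P hx hy hxy hs, ← hvy, sub_zero] at hlip
  refine (by simpa [greatCircle] using hlip : _ ≤ D * γ * |Real.arctan (‖v‖ / s)|).trans ?_
  gcongr
  exact (abs_arctan_le _).trans_eq (abs_of_nonneg (by positivity))

lemma norm_projEval_le_of_tangent (hP : ∀ i, (P i).totalDegree ≤ D)
    (hγ : ∀ z, ‖z‖ = 1 → ‖sysEval P z‖ ≤ γ) (hx : ‖x‖ = 1) (hy : ‖y‖ = 1)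
    (hxy : inner ℝ x y = 0) {s : ℝ} (hs : 0 < s) (r : ℝ) :
    ‖projEval P (s • x + r • y)‖ ≤
      ‖sysEval P x‖ + |r| / s * ‖dirDeriv P x y‖ + D ^ 2 * γ * (r / s) ^ 2 := by
  have hγ0 : 0 ≤ γ := (norm_nonneg _).trans (hγ x hx)
  rw [projEval_smul_add_smul P hx hy hxy hs]
  set θ := Real.arctan (r / s)
  have htaylor : ‖sysEval P (greatCircle x y θ) - sysEval P x - θ • dirDeriv P x y‖
      ≤ D ^ 2 * γ * θ ^ 2 := by
    rw [← (hasDerivAt_sysEval_greatCircle P x y).deriv]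
    simpa [greatCircle] using norm_sub_sub_smul_deriv_le_of_mem_trigPoly
      (sysEval_greatCircle_mem_trigPoly hP x y)
      (fun θ => hγ _ (norm_greatCircle hx hy hxy θ)) θ
  have hθ : |θ| ≤ |r| / s := (abs_arctan_le _).trans_eq (by rw [abs_div, abs_of_pos hs])
  have hθsq : θ ^ 2 ≤ (r / s) ^ 2 := sq_le_sq.2 (abs_arctan_le _)
  set F := sysEval P (greatCircle x y θ)
  calc ‖F‖ = ‖sysEval P x + θ • dirDeriv P x y + (F - sysEval P x - θ • dirDeriv P x y)‖ := by
        congr 1; abel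
    _ ≤ ‖sysEval P x‖ + ‖θ • dirDeriv P x y‖ + ‖F - sysEval P x - θ • dirDeriv P x y‖ :=
        norm_add₃_le
    _ ≤ ‖sysEval P x‖ + |θ| * ‖dirDeriv P x y‖ + D ^ 2 * γ * θ ^ 2 := by
        rw [norm_smul, Real.norm_eq_abs]
        gcongr
    _ ≤ _ := by gcongr

lemma norm_projEval_tube_le (hP : ∀ i, (P i).totalDegree ≤ D)
    (hγ : ∀ z, ‖z‖ = 1 → ‖sysEval P z‖ ≤ γ) (hx : ‖x‖ = 1) (hy : ‖y‖ = 1)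
    (hxy : inner ℝ x y = 0) {s : ℝ} (hs : 0 < s) (r : ℝ) {z : EuclideanSpace ℝ (Fin n)}
    (hxz : inner ℝ x z = 0) (hyz : inner ℝ y z = 0) :
    ‖projEval P (s • x + r • y + z)‖ ≤
      ‖sysEval P x‖ + |r| / s * ‖dirDeriv P x y‖ + D ^ 2 * γ * (r / s) ^ 2
        + D * γ * (‖z‖ / s) := by
  have hγ0 : 0 ≤ γ := (norm_nonneg _).trans (hγ x hx)
  set u := s • x + r • y with hu
  have hsu : s ≤ ‖u‖ := by
    refine le_of_sq_le_sq ?_ (norm_nonneg u)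
    rw [hu, norm_smul_add_smul_sq hx hy hxy]
    exact le_add_of_nonneg_right (sq_nonneg r)
  have hu_pos : 0 < ‖u‖ := hs.trans_le hsu
  have hunit : ‖‖u‖⁻¹ • u‖ = 1 := norm_smul_inv_norm (𝕜 := ℝ) (norm_pos_iff.1 hu_pos)
  have huz : inner ℝ (‖u‖⁻¹ • u) z = 0 := by
    simp [hu, inner_smul_left, inner_add_left, hxz, hyz]
  have hoffset : ‖projEval P (u + z) - projEval P u‖ ≤ D * γ * (‖z‖ / ‖u‖) := by
    simpa [smul_smul, hu_pos.ne', projEval] using norm_projEval_sub_le hP hγ hunit huz hu_pos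
  calc ‖projEval P (u + z)‖ ≤ ‖projEval P u‖ + ‖projEval P (u + z) - projEval P u‖ :=
        norm_le_norm_add_norm_sub' _ _
    _ ≤ ‖sysEval P x‖ + |r| / s * ‖dirDeriv P x y‖ + D ^ 2 * γ * (r / s) ^ 2
        + D * γ * (‖z‖ / ‖u‖) :=
        add_le_add (norm_projEval_le_of_tangent hP hγ hx hy hxy hs r) hoffset
    _ ≤ _ := by gcongr

lemma norm_dirDeriv_le (hP : ∀ i, (P i).totalDegree ≤ D)
    (hγ : ∀ z, ‖z‖ = 1 → ‖sysEval P z‖ ≤ γ) (hx : ‖x‖ = 1) (hy : ‖y‖ = 1)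
    (hxy : inner ℝ x y = 0) : ‖dirDeriv P x y‖ ≤ D * γ := by
  rw [← (hasDerivAt_sysEval_greatCircle P x y).deriv]
  exact bernstein_norm_deriv_le (sysEval_greatCircle_mem_trigPoly hP x y)
    (fun θ => hγ _ (norm_greatCircle hx hy hxy θ)) 0

end Sphere

section Form

variable {n d : ℕ}

lemma Exponent.sum_eq (α : Exponent n d) : ∑ j, (α : Fin n →₀ ℕ) j = d :=
  (Finset.mem_finsuppAntidiag.1 α.2).1

lemma totalDegree_form_le (c : EuclideanSpace ℝ (Exponent n d)) : (form c).totalDegree ≤ d := by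
  refine MvPolynomial.IsHomogeneous.totalDegree_le
    (MvPolynomial.IsHomogeneous.sum _ _ _ fun α _ => MvPolynomial.isHomogeneous_monomial _ ?_)
  rw [Finsupp.degree_eq_sum, α.sum_eq]

/-- The vector of monomials of degree `d` at `x`, normalized by the square roots of the multinomial
coefficients: a form with coefficient vector `c` takes the value `⟪c, veronese d x⟫` at `x`. -/
noncomputable def veronese (d : ℕ) (x : EuclideanSpace ℝ (Fin n)) :
    EuclideanSpace ℝ (Exponent n d) :=
  WithLp.toLp 2 fun α => √((α : Fin n →₀ ℕ).multinomial : ℝ) * ∏ j, x j ^ (α : Fin n →₀ ℕ) j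

lemma eval_form (c : EuclideanSpace ℝ (Exponent n d)) (x : EuclideanSpace ℝ (Fin n)) :
    MvPolynomial.eval (fun j => x j) (form c) = inner ℝ c (veronese d x) := by
  rw [form, map_sum, PiLp.inner_apply]
  refine Finset.sum_congr rfl fun α _ => ?_
  rw [MvPolynomial.eval_monomial, Finsupp.prod_fintype _ _ fun _ => pow_zero _]
  simp [veronese]
  ring

lemma sum_multinomial_mul_prod_pow (a : Fin n → ℝ) (d : ℕ) :
    ∑ α : Exponent n d, ((α : Fin n →₀ ℕ).multinomial : ℝ) * ∏ j, a j ^ (α : Fin n →₀ ℕ) j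
      = (∑ j, a j) ^ d := by
  rw [Finset.sum_pow_eq_sum_piAntidiag, Finset.sum_coe_sort _
    fun α : Fin n →₀ ℕ => (α.multinomial : ℝ) * ∏ j, a j ^ α j]
  refine Finset.sum_bij' (fun α _ => (α : Fin n → ℕ))
    (fun f _ => Finsupp.equivFunOnFinite.symm f) ?_ ?_ ?_ ?_ ?_
  · intro α hα
    simpa using Finset.mem_finsuppAntidiag.1 hα |>.1
  · intro f hf
    simpa [Finset.mem_finsuppAntidiag] using Finset.mem_piAntidiag.1 hf |>.1
  · exact fun α _ => Finsupp.ext fun _ => rfl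
  · exact fun f _ => rfl
  · intro α _
    rw [Finsupp.multinomial_eq_of_support_subset (Finset.subset_univ α.support)]

lemma norm_veronese (x : EuclideanSpace ℝ (Fin n)) : ‖veronese d x‖ = ‖x‖ ^ d := by
  rw [← pow_left_inj₀ (norm_nonneg _) (by positivity) two_ne_zero, ← pow_mul, mul_comm d, pow_mul,
    EuclideanSpace.real_norm_sq_eq, EuclideanSpace.real_norm_sq_eq x,
    ← sum_multinomial_mul_prod_pow]
  refine Finset.sum_congr rfl fun α _ => ?_
  simp [veronese, mul_pow, ← Finset.prod_pow, pow_right_comm]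

lemma multinomial_cast_pos (α : Fin n →₀ ℕ) : (0 : ℝ) < α.multinomial := by
  rw [Finsupp.multinomial_eq]
  exact_mod_cast Nat.multinomial_pos _ _

lemma coeff_form (c : EuclideanSpace ℝ (Exponent n d)) (α : Exponent n d) :
    MvPolynomial.coeff (α : Fin n →₀ ℕ) (form c)
      = √((α : Fin n →₀ ℕ).multinomial : ℝ) * c α := by
  rw [form, MvPolynomial.coeff_sum, Finset.sum_eq_single α]
  · simp
  · intro β _ hβ
    rw [MvPolynomial.coeff_monomial, if_neg fun h => hβ (Subtype.ext h)]
  · simp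

lemma formNorm_form (c : EuclideanSpace ℝ (Exponent n d)) : formNorm d (form c) = ‖c‖ := by
  rw [formNorm, EuclideanSpace.norm_eq]
  congr 1
  refine Finset.sum_congr rfl fun α _ => ?_
  have hα := multinomial_cast_pos (α : Fin n →₀ ℕ)
  rw [coeff_form, sq_abs, mul_pow, Real.sq_sqrt hα.le, Real.norm_eq_abs, sq_abs]
  field_simp

end Form

section System

variable {m n : ℕ} {d : Fin m → ℕ}

/-- The system of forms with given coefficient vectors. -/
noncomputable def formSys (c : ∀ i, EuclideanSpace ℝ (Exponent n (d i))) :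
    Fin m → MvPolynomial (Fin n) ℝ :=
  fun i => form (c i)

lemma le_maxDeg (i : Fin m) : d i ≤ maxDeg d := Finset.le_sup (Finset.mem_univ i)

lemma totalDegree_formSys_le (c : ∀ i, EuclideanSpace ℝ (Exponent n (d i))) (i : Fin m) :
    (formSys c i).totalDegree ≤ maxDeg d :=
  (totalDegree_form_le (c i)).trans (le_maxDeg i)

lemma sysNorm_formSys (c : ∀ i, EuclideanSpace ℝ (Exponent n (d i))) :
    sysNorm d (formSys c) = √(∑ i, ‖c i‖ ^ 2) := by
  simp [sysNorm, formSys, formNorm_form]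

lemma sysEval_formSys (c : ∀ i, EuclideanSpace ℝ (Exponent n (d i)))
    (x : EuclideanSpace ℝ (Fin n)) (i : Fin m) :
    sysEval (formSys c) x i = inner ℝ (c i) (veronese (d i) x) := by
  simp [sysEval, formSys, eval_form]

lemma norm_sysEval_formSys_le (c : ∀ i, EuclideanSpace ℝ (Exponent n (d i)))
    {x : EuclideanSpace ℝ (Fin n)} (hx : ‖x‖ = 1) :
    ‖sysEval (formSys c) x‖ ≤ sysNorm d (formSys c) := by
  rw [sysNorm_formSys, EuclideanSpace.norm_eq]
  refine Real.sqrt_le_sqrt (Finset.sum_le_sum fun i _ => ?_)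
  have hcauchy := norm_inner_le_norm (𝕜 := ℝ) (c i) (veronese (d i) x)
  rw [norm_veronese, hx, one_pow, mul_one] at hcauchy
  rw [sysEval_formSys]
  gcongr

lemma continuous_veronese (d : ℕ) :
    Continuous (veronese d : EuclideanSpace ℝ (Fin n) → EuclideanSpace ℝ (Exponent n d)) := by
  unfold veronese
  fun_prop

lemma continuous_sysEval_formSys :
    Continuous fun p : (∀ i, EuclideanSpace ℝ (Exponent n (d i))) × EuclideanSpace ℝ (Fin n) =>
      sysEval (formSys p.1) p.2 := by
  refine (PiLp.continuous_toLp 2 _).comp (continuous_pi fun i => ?_)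
  simp only [formSys, eval_form]
  exact ((continuous_apply i).comp continuous_fst).inner
    ((continuous_veronese (d i)).comp continuous_snd)

lemma eval_pderiv_form {d : ℕ} (c : EuclideanSpace ℝ (Exponent n d)) (j : Fin n)
    (x : Fin n → ℝ) : MvPolynomial.eval x (MvPolynomial.pderiv j (form c)) =
      ∑ α : Exponent n d, √((α : Fin n →₀ ℕ).multinomial : ℝ) * c α *
        MvPolynomial.eval x (MvPolynomial.pderiv j
          (MvPolynomial.monomial (α : Fin n →₀ ℕ) (1 : ℝ))) := by
  rw [form, map_sum, map_sum]
  refine Finset.sum_congr rfl fun α _ => ?_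
  rw [← mul_one (√((α : Fin n →₀ ℕ).multinomial : ℝ) * c α), ← MvPolynomial.C_mul_monomial,
    MvPolynomial.pderiv_C_mul, map_mul, MvPolynomial.eval_C, mul_one]

lemma continuous_dirDeriv_formSys (i : Fin m) :
    Continuous fun p : (∀ i, EuclideanSpace ℝ (Exponent n (d i))) ×
      (EuclideanSpace ℝ (Fin n) × EuclideanSpace ℝ (Fin n)) =>
      dirDeriv (formSys p.1) p.2.1 p.2.2 i := by
  simp only [dirDeriv_apply, formSys, eval_pderiv_form]
  refine continuous_finsetSum _ fun j _ => Continuous.mul ?_ (by fun_prop)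
  refine continuous_finsetSum _ fun α _ => Continuous.mul (by fun_prop) ?_
  exact (MvPolynomial.continuous_eval _).comp (by fun_prop)

/-- For orthonormal `x`, `y` the sum `∑ i, (DPᵢ(x) y)² / dᵢ + ‖P(x)‖²`. Minimizing over `y` turns
the first summand into the inverse square of `σ_max ((DP(x)|_{x^⊥})⁻¹ ∘ Δ)`, so the minimum over all
pairs is the squared denominator of the global condition number. -/
noncomputable def gap (d : Fin m → ℕ) (P : Fin m → MvPolynomial (Fin n) ℝ)
    (p : EuclideanSpace ℝ (Fin n) × EuclideanSpace ℝ (Fin n)) : ℝ :=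
  ∑ i, dirDeriv P p.1 p.2 i ^ 2 / d i + ‖sysEval P p.1‖ ^ 2

lemma gap_nonneg (P : Fin m → MvPolynomial (Fin n) ℝ)
    (p : EuclideanSpace ℝ (Fin n) × EuclideanSpace ℝ (Fin n)) : 0 ≤ gap d P p := by
  unfold gap; positivity

/-- The orthonormal pairs: points of the sphere together with a unit tangent direction. -/
def orthoPairs (n : ℕ) : Set (EuclideanSpace ℝ (Fin n) × EuclideanSpace ℝ (Fin n)) :=
  {p | ‖p.1‖ = 1 ∧ ‖p.2‖ = 1 ∧ inner ℝ p.1 p.2 = 0}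

lemma isCompact_orthoPairs (n : ℕ) : IsCompact (orthoPairs n) := by
  refine ((isCompact_sphere (0 : EuclideanSpace ℝ (Fin n)) 1).prod
    (isCompact_sphere (0 : EuclideanSpace ℝ (Fin n)) 1)).of_isClosed_subset ?_ ?_
  · refine (isClosed_eq (by fun_prop) (by fun_prop)).inter
      ((isClosed_eq (by fun_prop) (by fun_prop)).inter
        (isClosed_eq (continuous_fst.inner continuous_snd) (by fun_prop)))
  · rintro ⟨x, y⟩ ⟨hx, hy, -⟩
    simpa using ⟨hx, hy⟩

lemma orthoPairs_nonempty (hn : 2 ≤ n) : (orthoPairs n).Nonempty := by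
  refine ⟨(EuclideanSpace.single ⟨0, by omega⟩ 1, EuclideanSpace.single ⟨1, by omega⟩ 1), ?_⟩
  simp [orthoPairs, EuclideanSpace.inner_single_left]

lemma continuous_gap_formSys :
    Continuous fun p : (∀ i, EuclideanSpace ℝ (Exponent n (d i))) ×
      (EuclideanSpace ℝ (Fin n) × EuclideanSpace ℝ (Fin n)) => gap d (formSys p.1) p.2 := by
  refine (continuous_finsetSum _ fun i _ => ((continuous_dirDeriv_formSys i).pow 2).div_const _).add
    ?_
  exact ((continuous_sysEval_formSys.comp
    (continuous_fst.prodMk (continuous_fst.comp continuous_snd))).norm).pow 2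

/-- The minimum of `gap` over all orthonormal pairs. -/
noncomputable def minGap (c : ∀ i, EuclideanSpace ℝ (Exponent n (d i))) : ℝ :=
  sInf (gap d (formSys c) '' orthoPairs n)

lemma continuous_minGap :
    Continuous (minGap : (∀ i, EuclideanSpace ℝ (Exponent n (d i))) → ℝ) :=
  (isCompact_orthoPairs n).continuous_sInf continuous_gap_formSys

lemma exists_minGap (hn : 2 ≤ n) (c : ∀ i, EuclideanSpace ℝ (Exponent n (d i))) :
    ∃ p ∈ orthoPairs n, gap d (formSys c) p = minGap c := by
  have hc : Continuous (gap d (formSys c)) :=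
    Continuous.uncurry_left c (f := fun c p => gap d (formSys c) p) continuous_gap_formSys
  obtain ⟨p, hp, h⟩ := ((isCompact_orthoPairs n).image hc).sInf_mem
    ((orthoPairs_nonempty hn).image _)
  exact ⟨p, hp, h⟩

lemma minGap_le (c : ∀ i, EuclideanSpace ℝ (Exponent n (d i)))
    {p : EuclideanSpace ℝ (Fin n) × EuclideanSpace ℝ (Fin n)} (hp : p ∈ orthoPairs n) :
    minGap c ≤ gap d (formSys c) p :=
  csInf_le ⟨0, by rintro _ ⟨q, -, rfl⟩; exact gap_nonneg _ _⟩ ⟨p, hp, rfl⟩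

lemma minGap_nonneg (c : ∀ i, EuclideanSpace ℝ (Exponent n (d i))) : 0 ≤ minGap c :=
  Real.sInf_nonneg (by rintro _ ⟨q, -, rfl⟩; exact gap_nonneg _ _)

end System

section SingularValue

variable {E F : Type*} [NormedAddCommGroup E] [InnerProductSpace ℝ E] [FiniteDimensional ℝ E]
  [NormedAddCommGroup F] [InnerProductSpace ℝ F] [FiniteDimensional ℝ F]

lemma norm_apply_le_singularValues (T : E →ₗ[ℝ] F) (u : E) :
    ‖T u‖ ≤ T.singularValues 0 * ‖u‖ := by
  have hσ := T.singularValues_nonneg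
  have hsymm := T.isSymmetric_adjoint_comp_self
  set b := hsymm.eigenvectorBasis rfl with hb
  have hTu : ‖T u‖ ^ 2 = ∑ i, hsymm.eigenvalues rfl i * (b.repr u i) ^ 2 := by
    rw [← real_inner_self_eq_norm_sq, ← LinearMap.adjoint_inner_left, ← LinearMap.comp_apply,
      ← b.repr.inner_map_map, PiLp.inner_apply]
    refine Finset.sum_congr rfl fun i _ => ?_
    rw [hb, hsymm.eigenvectorBasis_apply_self_apply]
    simp
    ring
  refine le_of_sq_le_sq ?_ (mul_nonneg (hσ 0) (norm_nonneg u))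
  rw [hTu, mul_pow, ← b.repr.norm_map u, EuclideanSpace.real_norm_sq_eq, Finset.mul_sum]
  refine Finset.sum_le_sum fun i _ => mul_le_mul_of_nonneg_right ?_ (sq_nonneg _)
  rw [← T.sq_singularValues_fin rfl i]
  exact pow_le_pow_left₀ (hσ i) (T.singularValues_antitone (Nat.zero_le (i : ℕ))) 2

lemma exists_norm_apply_eq_singularValues [Nontrivial E] (T : E →ₗ[ℝ] F) :
    ∃ u : E, ‖u‖ = 1 ∧ ‖T u‖ = T.singularValues 0 := by
  obtain ⟨v, hv⟩ := (T.hasEigenvalue_adjoint_comp_self_sq_singularValues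
    (n := 0) Module.finrank_pos).exists_hasEigenvector
  have hTv : ‖T v‖ = T.singularValues 0 * ‖v‖ := by
    refine (pow_left_inj₀ (norm_nonneg _)
      (mul_nonneg (T.singularValues_nonneg 0) (norm_nonneg _)) two_ne_zero).1 ?_
    rw [← real_inner_self_eq_norm_sq, ← LinearMap.adjoint_inner_left, ← LinearMap.comp_apply,
      hv.apply_eq_smul, inner_smul_left, real_inner_self_eq_norm_sq, mul_pow]
    simp
  refine ⟨‖v‖⁻¹ • v, norm_smul_inv_norm (𝕜 := ℝ) hv.2, ?_⟩
  rw [map_smul, norm_smul, norm_inv, norm_norm, hTv]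
  field_simp [norm_ne_zero_iff.2 hv.2]

end SingularValue

section Kappa

variable {m : ℕ} {d : Fin m → ℕ} {P : Fin m → MvPolynomial (Fin (m + 1)) ℝ}
  {x y : EuclideanSpace ℝ (Fin (m + 1))}

lemma mem_tangent_iff : y ∈ tangent x ↔ inner ℝ x y = 0 :=
  Submodule.mem_orthogonal_singleton_iff_inner_right

lemma finrank_tangent (hx : ‖x‖ = 1) : Module.finrank ℝ (tangent x) = m := by
  have hx0 : x ≠ 0 := norm_ne_zero_iff.1 (hx ▸ one_ne_zero)
  have hadd := Submodule.finrank_add_finrank_orthogonal (Submodule.span ℝ {x})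
  rw [finrank_span_singleton hx0, finrank_euclideanSpace, Fintype.card_fin, add_comm] at hadd
  exact Nat.add_right_cancel hadd

lemma degreeScaling_apply (u : EuclideanSpace ℝ (Fin m)) (i : Fin m) :
    degreeScaling d u i = √(d i : ℝ) * u i := by
  simp [degreeScaling, Matrix.toLpLin_apply, Matrix.mulVec_diagonal]

lemma sum_degreeScaling_sq_div (hd : ∀ i, 1 ≤ d i) (u : EuclideanSpace ℝ (Fin m)) :
    ∑ i, degreeScaling d u i ^ 2 / d i = ‖u‖ ^ 2 := by
  rw [EuclideanSpace.real_norm_sq_eq]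
  refine Finset.sum_congr rfl fun i _ => ?_
  have hdi : (d i : ℝ) ≠ 0 := Nat.cast_ne_zero.2 (Nat.one_le_iff_ne_zero.1 (hd i))
  rw [degreeScaling_apply, mul_pow, Real.sq_sqrt (Nat.cast_nonneg _), mul_div_cancel_left₀ _ hdi]

lemma degreeScaling_injective (hd : ∀ i, 1 ≤ d i) : Function.Injective (degreeScaling d) := by
  refine (injective_iff_map_eq_zero _).2 fun u hu => ?_
  simpa [hu] using (sum_degreeScaling_sq_div hd u).symm

/-- The map `(DP(x)|_{x^⊥})⁻¹ ∘ Δ`, whose largest singular value enters the normalized condition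
number. -/
noncomputable def scaledInverse (d : Fin m → ℕ) (h : Function.Bijective (tangentDeriv P x)) :
    EuclideanSpace ℝ (Fin m) →ₗ[ℝ] tangent x :=
  (LinearEquiv.ofBijective (tangentDeriv P x) h).symm.toLinearMap ∘ₗ degreeScaling d

lemma dirDeriv_scaledInverse (h : Function.Bijective (tangentDeriv P x))
    (u : EuclideanSpace ℝ (Fin m)) :
    dirDeriv P x (scaledInverse d h u) = degreeScaling d u :=
  (LinearEquiv.ofBijective (tangentDeriv P x) h).apply_symm_apply (degreeScaling d u)

lemma singularValues_scaledInverse_pos (hm : 0 < m) (hd : ∀ i, 1 ≤ d i)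
    (h : Function.Bijective (tangentDeriv P x)) : 0 < (scaledInverse d h).singularValues 0 := by
  have hinj : Function.Injective (scaledInverse d h) :=
    (LinearEquiv.ofBijective (tangentDeriv P x) h).symm.injective.comp (degreeScaling_injective hd)
  exact (LinearMap.injective_iff_forall_lt_finrank_singularValues_pos _).1 hinj 0
    (by simpa using hm)

lemma exists_degreeScaling_eq (hd : ∀ i, 1 ≤ d i) (v : EuclideanSpace ℝ (Fin m)) :
    ∃ u, degreeScaling d u = v :=
  LinearMap.injective_iff_surjective.1 (degreeScaling_injective hd) v

/-- The square of the denominator in `kappaAt`. -/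
noncomputable def kappaDenom (d : Fin m → ℕ) (P : Fin m → MvPolynomial (Fin (m + 1)) ℝ)
    (x : EuclideanSpace ℝ (Fin (m + 1))) : ℝ≥0∞ :=
  ENNReal.ofReal (sysNorm d P) ^ 2 * (muNorm d P x ^ 2)⁻¹ + ENNReal.ofReal ‖sysEval P x‖ ^ 2

lemma kappaDenom_of_bijective (hm : 0 < m) (hd : ∀ i, 1 ≤ d i) (hW : 0 < sysNorm d P)
    (h : Function.Bijective (tangentDeriv P x)) :
    kappaDenom d P x =
      ENNReal.ofReal (((scaledInverse d h).singularValues 0 ^ 2)⁻¹ + ‖sysEval P x‖ ^ 2) := by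
  have hσ := singularValues_scaledInverse_pos hm hd h
  rw [kappaDenom, muNorm, dif_pos h, ENNReal.ofReal_add (by positivity) (by positivity),
    ENNReal.ofReal_pow (norm_nonneg _), ← scaledInverse, ← ENNReal.ofReal_pow hW.le,
    ← ENNReal.ofReal_pow (by positivity), ← ENNReal.ofReal_inv_of_pos (by positivity),
    ← ENNReal.ofReal_mul (by positivity)]
  congr 2
  field_simp

lemma kappaDenom_of_not_bijective (h : ¬ Function.Bijective (tangentDeriv P x)) :
    kappaDenom d P x = ENNReal.ofReal (‖sysEval P x‖ ^ 2) := by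
  rw [kappaDenom, muNorm, dif_neg h, ENNReal.ofReal_pow (norm_nonneg _)]
  simp

lemma exists_dirDeriv_eq_zero (hx : ‖x‖ = 1) (h : ¬ Function.Bijective (tangentDeriv P x)) :
    ∃ y, (x, y) ∈ orthoPairs (m + 1) ∧ dirDeriv P x y = 0 := by
  have hfinrank : Module.finrank ℝ (tangent x) = Module.finrank ℝ (EuclideanSpace ℝ (Fin m)) := by
    rw [finrank_tangent hx, finrank_euclideanSpace, Fintype.card_fin]
  have hker : ¬ Function.Injective (tangentDeriv P x) := fun hinj =>
    h ⟨hinj, (LinearMap.injective_iff_surjective_of_finrank_eq_finrank hfinrank).1 hinj⟩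
  rw [injective_iff_map_eq_zero] at hker
  push Not at hker
  obtain ⟨v, hv, hv0 : v ≠ 0⟩ := hker
  have hunit : ‖‖v‖⁻¹ • v‖ = 1 := norm_smul_inv_norm (𝕜 := ℝ) hv0
  refine ⟨↑(‖v‖⁻¹ • v), ⟨hx, hunit, mem_tangent_iff.1 (‖v‖⁻¹ • v).2⟩, ?_⟩
  change tangentDeriv P x (‖v‖⁻¹ • v) = 0
  rw [map_smul, hv, smul_zero]

lemma exists_kappaDenom_eq (hm : 0 < m) (hd : ∀ i, 1 ≤ d i) (hW : 0 < sysNorm d P)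
    (hx : ‖x‖ = 1) :
    ∃ y, (x, y) ∈ orthoPairs (m + 1) ∧ kappaDenom d P x = ENNReal.ofReal (gap d P (x, y)) := by
  by_cases h : Function.Bijective (tangentDeriv P x)
  · have : Nonempty (Fin m) := ⟨⟨0, hm⟩⟩
    obtain ⟨u, hu, hσu⟩ := exists_norm_apply_eq_singularValues (scaledInverse d h)
    have hσ := singularValues_scaledInverse_pos hm hd h
    rw [kappaDenom_of_bijective hm hd hW h]
    set σ := (scaledInverse d h).singularValues 0
    refine ⟨scaledInverse d h (σ⁻¹ • u), ⟨hx, ?_, mem_tangent_iff.1 (Subtype.prop _)⟩, ?_⟩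
    · change ‖scaledInverse d h (σ⁻¹ • u)‖ = 1
      rw [map_smul, norm_smul, hσu, norm_inv, Real.norm_of_nonneg hσ.le, inv_mul_cancel₀ hσ.ne']
    · rw [gap, dirDeriv_scaledInverse, sum_degreeScaling_sq_div hd, norm_smul, hu, norm_inv,
        Real.norm_of_nonneg hσ.le, mul_one, inv_pow]
  · obtain ⟨y, hxy, hy⟩ := exists_dirDeriv_eq_zero hx h
    exact ⟨y, hxy, by simp [kappaDenom_of_not_bijective h, gap, hy]⟩

lemma kappaDenom_le (hm : 0 < m) (hd : ∀ i, 1 ≤ d i) (hW : 0 < sysNorm d P)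
    (hp : (x, y) ∈ orthoPairs (m + 1)) :
    kappaDenom d P x ≤ ENNReal.ofReal (gap d P (x, y)) := by
  obtain ⟨-, hy, hxy⟩ := hp
  by_cases h : Function.Bijective (tangentDeriv P x)
  · obtain ⟨u, hu⟩ := exists_degreeScaling_eq hd (dirDeriv P x y)
    have hσ := singularValues_scaledInverse_pos hm hd h
    have hRu : scaledInverse d h u = ⟨y, mem_tangent_iff.2 hxy⟩ :=
      h.1 ((dirDeriv_scaledInverse h u).trans hu)
    have hσu : 1 ≤ (scaledInverse d h).singularValues 0 * ‖u‖ := by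
      simpa [hRu, hy] using norm_apply_le_singularValues (scaledInverse d h) u
    rw [kappaDenom_of_bijective hm hd hW h, gap, ← hu, sum_degreeScaling_sq_div hd]
    gcongr
    rw [inv_le_iff_one_le_mul₀' (by positivity), ← mul_pow]
    exact one_le_pow₀ hσu
  · rw [kappaDenom_of_not_bijective h, gap]
    exact ENNReal.ofReal_le_ofReal (le_add_of_nonneg_left (by positivity))

lemma kappa_formSys (hm : 0 < m) (hd : ∀ i, 1 ≤ d i)
    (c : ∀ i, EuclideanSpace ℝ (Exponent (m + 1) (d i))) :
    kappa d (formSys c) =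
      ENNReal.ofReal (sysNorm d (formSys c)) / ENNReal.ofReal (√(minGap c)) := by
  rcases (show 0 ≤ sysNorm d (formSys c) from Real.sqrt_nonneg _).eq_or_lt with hW | hW
  · simp [kappa, kappaAt, ← hW]
  have hkappaAt : ∀ x, kappaAt d (formSys c) x =
      ENNReal.ofReal (sysNorm d (formSys c)) / kappaDenom d (formSys c) x ^ (1 / 2 : ℝ) :=
    fun _ => rfl
  rw [Real.sqrt_eq_rpow, ← ENNReal.ofReal_rpow_of_nonneg (minGap_nonneg c) (by norm_num)]
  refine le_antisymm (iSup₂_le fun x hx => ?_) ?_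
  · obtain ⟨y, hy, hxy⟩ := exists_kappaDenom_eq hm hd hW (mem_sphere_zero_iff_norm.1 hx)
    rw [hkappaAt, hxy]
    gcongr
    exact minGap_le c hy
  · obtain ⟨⟨x, y⟩, hp, hxy⟩ := exists_minGap (by omega) c
    refine le_trans ?_ (le_iSup₂ (f := fun x _ => kappaAt d (formSys c) x) x
      (mem_sphere_zero_iff_norm.2 hp.1))
    rw [hkappaAt, ← hxy]
    gcongr
    exact kappaDenom_le hm hd hW hp

lemma measurable_kappa_formSys (hm : 0 < m) (hd : ∀ i, 1 ≤ d i) :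
    Measurable fun c : ∀ i, EuclideanSpace ℝ (Exponent (m + 1) (d i)) => kappa d (formSys c) := by
  simp only [kappa_formSys hm hd, sysNorm_formSys]
  have hnorm : Continuous fun c : ∀ i, EuclideanSpace ℝ (Exponent (m + 1) (d i)) =>
      √(∑ i, ‖c i‖ ^ 2) := by fun_prop
  exact hnorm.measurable.ennreal_ofReal.div
    (Real.continuous_sqrt.comp continuous_minGap).measurable.ennreal_ofReal

lemma minGap_le_sq (hm : 0 < m) (hd : ∀ i, 1 ≤ d i)
    (c : ∀ i, EuclideanSpace ℝ (Exponent (m + 1) (d i))) :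
    minGap c ≤ ((maxDeg d + 1) * sysNorm d (formSys c)) ^ 2 := by
  obtain ⟨⟨x, y⟩, ⟨hx, hy, hxy⟩, hgap⟩ := exists_minGap (by omega) c
  have hderiv : ‖dirDeriv (formSys c) x y‖ ≤ maxDeg d * sysNorm d (formSys c) :=
    norm_dirDeriv_le (totalDegree_formSys_le c) (fun z hz => norm_sysEval_formSys_le c hz) hx hy hxy
  have hsum : ∑ i, dirDeriv (formSys c) x y i ^ 2 / d i ≤ ‖dirDeriv (formSys c) x y‖ ^ 2 := by
    rw [EuclideanSpace.real_norm_sq_eq]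
    exact Finset.sum_le_sum fun i _ => div_le_self (sq_nonneg _) (by exact_mod_cast hd i)
  calc minGap c ≤ ‖dirDeriv (formSys c) x y‖ ^ 2 + ‖sysEval (formSys c) x‖ ^ 2 := by
        rw [← hgap, gap]
        gcongr
    _ ≤ (maxDeg d * sysNorm d (formSys c)) ^ 2 + sysNorm d (formSys c) ^ 2 := by
        gcongr
        exact norm_sysEval_formSys_le c hx
    _ ≤ ((maxDeg d + 1) * sysNorm d (formSys c)) ^ 2 := by
        have : 0 ≤ (maxDeg d : ℝ) * sysNorm d (formSys c) ^ 2 := by positivity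
        linarith

lemma inv_maxDeg_add_one_le_kappa_formSys (hm : 0 < m) (hd : ∀ i, 1 ≤ d i)
    (c : ∀ i, EuclideanSpace ℝ (Exponent (m + 1) (d i))) (hW : 0 < sysNorm d (formSys c)) :
    ENNReal.ofReal ((maxDeg d + 1 : ℝ)⁻¹) ≤ kappa d (formSys c) := by
  rw [kappa_formSys hm hd c,
    ENNReal.le_div_iff_mul_le (Or.inr (by simpa using hW)) (Or.inl ENNReal.ofReal_ne_top),
    ← ENNReal.ofReal_mul (by positivity)]
  refine ENNReal.ofReal_le_ofReal ?_
  rw [inv_mul_le_iff₀ (by positivity)]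
  exact Real.sqrt_le_iff.2 ⟨by positivity, minGap_le_sq hm hd c⟩

end Kappa

section GaussianMoments

lemma lintegral_mul_exp_neg_mul_sq {b : ℝ} (hb : 0 < b) :
    ∫⁻ t in Set.Ioi (0 : ℝ), ENNReal.ofReal (t * Real.exp (-b * t ^ 2))
      = ENNReal.ofReal (1 / (2 * b)) := by
  have hint := integrableOn_rpow_mul_exp_neg_mul_rpow (s := 1) (p := 2) (by norm_num) two_pos hb
  have hval := integral_rpow_mul_exp_neg_mul_rpow (p := 2) (q := 1) two_pos (by norm_num) hb
  simp only [Real.rpow_one, Real.rpow_two] at hint hval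
  rw [← ofReal_integral_eq_lintegral_ofReal hint, hval]
  · norm_num
    rw [Real.rpow_neg_one]
  · filter_upwards [ae_restrict_mem measurableSet_Ioi] with t (ht : 0 < t)
    positivity

lemma lintegral_sq_mul_exp_neg_mul_sq {b : ℝ} (hb : 0 < b) :
    ∫⁻ t in Set.Ioi (0 : ℝ), ENNReal.ofReal (t ^ 2 * Real.exp (-b * t ^ 2))
      = ENNReal.ofReal (√(Real.pi / b) / (4 * b)) := by
  have hint := integrableOn_rpow_mul_exp_neg_mul_rpow (s := 2) (p := 2) (by norm_num) two_pos hb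
  have hval := integral_rpow_mul_exp_neg_mul_rpow (p := 2) (q := 2) two_pos (by norm_num) hb
  simp only [Real.rpow_two] at hint hval
  have hGamma : Real.Gamma ((2 + 1) / 2) = √Real.pi / 2 := by
    rw [show ((2 : ℝ) + 1) / 2 = 1 / 2 + 1 by norm_num, Real.Gamma_add_one (by norm_num),
      Real.Gamma_one_half_eq]
    ring
  have hpow : b ^ (-(2 + 1 : ℝ) / 2) = 1 / (b * √b) := by
    rw [show (-(2 + 1 : ℝ) / 2) = -(1 + 1 / 2) by norm_num, Real.rpow_neg hb.le, Real.rpow_add hb,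
      Real.rpow_one, ← Real.sqrt_eq_rpow, one_div]
  rw [← ofReal_integral_eq_lintegral_ofReal hint (ae_of_all _ fun t => by positivity), hval,
    hGamma, hpow, Real.sqrt_div Real.pi_pos.le]
  congr 1
  have : √b ≠ 0 := by positivity
  field_simp
  norm_num

end GaussianMoments

section OneDim

variable {Ω : Type*} [MeasurableSpace Ω] {μ : Measure Ω} {ξ : Ω → ℝ} {K c₀ : ℝ}

lemma hasDerivAt_exp_mul_sq (b t : ℝ) :
    HasDerivAt (fun t : ℝ => Real.exp (b * t ^ 2)) (2 * b * t * Real.exp (b * t ^ 2)) t := by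
  refine ((hasDerivAt_pow 2 t).const_mul b).exp.congr_deriv ?_
  simp only [Nat.cast_ofNat, Nat.add_one_sub_one, pow_one]
  ring

lemma lintegral_exp_mul_sq_sub_one (hξ : AEMeasurable ξ μ) {b : ℝ} (hb : 0 ≤ b) :
    ∫⁻ ω, ENNReal.ofReal (Real.exp (b * ξ ω ^ 2) - 1) ∂μ =
      ∫⁻ t in Set.Ioi (0 : ℝ), μ {ω | t ≤ |ξ ω|} *
        ENNReal.ofReal (2 * b * t * Real.exp (b * t ^ 2)) := by
  have hprimitive : ∀ x : ℝ,
      ∫ t in (0 : ℝ)..x, 2 * b * t * Real.exp (b * t ^ 2) = Real.exp (b * x ^ 2) - 1 := fun x => by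
    rw [intervalIntegral.integral_eq_sub_of_hasDerivAt (fun t _ => hasDerivAt_exp_mul_sq b t)
      (Continuous.intervalIntegrable (by fun_prop) _ _)]
    simp
  have hlayer := lintegral_comp_eq_lintegral_meas_le_mul μ (f := fun ω => |ξ ω|)
    (g := fun t => 2 * b * t * Real.exp (b * t ^ 2)) (ae_of_all _ fun ω => abs_nonneg _)
    (by fun_prop) (fun t _ => Continuous.intervalIntegrable (by fun_prop) _ _)
    (by filter_upwards [ae_restrict_mem measurableSet_Ioi] with t (ht : 0 < t); positivity)
  simpa only [hprimitive, sq_abs] using hlayer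

lemma lintegral_exp_sq_le [IsProbabilityMeasure μ] (hξ : AEMeasurable ξ μ) (hK : 0 < K)
    (hsub : ∀ t : ℝ, 0 < t → μ.real {ω | t ≤ |ξ ω|} ≤ 2 * Real.exp (-(t ^ 2 / K ^ 2)))
    {a : ℝ} (ha : 0 ≤ a) (ha1 : a < 1) :
    ∫⁻ ω, ENNReal.ofReal (Real.exp (a / K ^ 2 * ξ ω ^ 2)) ∂μ
      ≤ ENNReal.ofReal ((1 + a) / (1 - a)) := by
  have ha1' : 0 < 1 - a := sub_pos.2 ha1
  have hsplit : ∀ ω, ENNReal.ofReal (Real.exp (a / K ^ 2 * ξ ω ^ 2)) =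
      1 + ENNReal.ofReal (Real.exp (a / K ^ 2 * ξ ω ^ 2) - 1) := fun ω => by
    rw [← ENNReal.ofReal_one, ← ENNReal.ofReal_add zero_le_one
      (sub_nonneg.2 (Real.one_le_exp (by positivity))), add_sub_cancel]
  have htail : ∀ t : ℝ, 0 < t →
      μ {ω | t ≤ |ξ ω|} * ENNReal.ofReal (2 * (a / K ^ 2) * t * Real.exp (a / K ^ 2 * t ^ 2)) ≤
        ENNReal.ofReal (4 * (a / K ^ 2)) *
          ENNReal.ofReal (t * Real.exp (-((1 - a) / K ^ 2) * t ^ 2)) := fun t ht => by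
    rw [← ofReal_measureReal, ← ENNReal.ofReal_mul measureReal_nonneg,
      ← ENNReal.ofReal_mul (by positivity)]
    refine ENNReal.ofReal_le_ofReal ((mul_le_mul_of_nonneg_right (hsub t ht)
      (by positivity)).trans_eq ?_)
    have hexp : Real.exp (-((1 - a) / K ^ 2) * t ^ 2)
        = Real.exp (-(t ^ 2 / K ^ 2)) * Real.exp (a / K ^ 2 * t ^ 2) := by
      rw [← Real.exp_add]
      congr 1
      ring
    rw [hexp]
    ring
  calc ∫⁻ ω, ENNReal.ofReal (Real.exp (a / K ^ 2 * ξ ω ^ 2)) ∂μ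
      = 1 + ∫⁻ t in Set.Ioi (0 : ℝ), μ {ω | t ≤ |ξ ω|} *
          ENNReal.ofReal (2 * (a / K ^ 2) * t * Real.exp (a / K ^ 2 * t ^ 2)) := by
        simp only [hsplit]
        rw [lintegral_add_left measurable_const, lintegral_const, measure_univ, one_mul,
          lintegral_exp_mul_sq_sub_one hξ (by positivity)]
    _ ≤ 1 + ENNReal.ofReal (4 * (a / K ^ 2)) * ENNReal.ofReal (1 / (2 * ((1 - a) / K ^ 2))) := by
        rw [← lintegral_mul_exp_neg_mul_sq (by positivity), ← lintegral_const_mul _ (by fun_prop)]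
        gcongr 1 + ?_
        exact setLIntegral_mono' measurableSet_Ioi htail
    _ = ENNReal.ofReal ((1 + a) / (1 - a)) := by
        rw [← ENNReal.ofReal_mul (by positivity), ← ENNReal.ofReal_one,
          ← ENNReal.ofReal_add zero_le_one (by positivity)]
        congr 1
        field_simp
        ring

lemma integrable_exp_sq [IsProbabilityMeasure μ] (hξ : AEMeasurable ξ μ) (hK : 0 < K)
    (hsub : ∀ t : ℝ, 0 < t → μ.real {ω | t ≤ |ξ ω|} ≤ 2 * Real.exp (-(t ^ 2 / K ^ 2)))
    {a : ℝ} (ha : 0 ≤ a) (ha1 : a < 1) :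
    Integrable (fun ω => Real.exp (a / K ^ 2 * ξ ω ^ 2)) μ := by
  refine ⟨by fun_prop, ?_⟩
  rw [hasFiniteIntegral_iff_ofReal (ae_of_all _ fun ω => (Real.exp_pos _).le)]
  exact (lintegral_exp_sq_le hξ hK hsub ha ha1).trans_lt ENNReal.ofReal_lt_top

lemma integral_exp_sq_le [IsProbabilityMeasure μ] (hξ : AEMeasurable ξ μ) (hK : 0 < K)
    (hsub : ∀ t : ℝ, 0 < t → μ.real {ω | t ≤ |ξ ω|} ≤ 2 * Real.exp (-(t ^ 2 / K ^ 2)))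
    {a : ℝ} (ha : 0 ≤ a) (ha1 : a < 1) :
    ∫ ω, Real.exp (a / K ^ 2 * ξ ω ^ 2) ∂μ ≤ (1 + a) / (1 - a) := by
  rw [integral_eq_lintegral_of_nonneg_ae (ae_of_all _ fun ω => (Real.exp_pos _).le) (by fun_prop)]
  exact ENNReal.toReal_le_of_le_ofReal (div_nonneg (by linarith) (by linarith))
    (lintegral_exp_sq_le hξ hK hsub ha ha1)

lemma lintegral_Ioi_mul_exp_neg_mul_sq {b : ℝ} (hb : 0 < b) {x : ℝ} (hx : 0 ≤ x) :
    ∫⁻ t in Set.Ioi x, ENNReal.ofReal (2 * b * t * Real.exp (-b * t ^ 2)) =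
      ENNReal.ofReal (Real.exp (-b * x ^ 2)) := by
  have hderiv : ∀ t ∈ Set.Ici x, HasDerivAt (fun t => -Real.exp (-b * t ^ 2))
      (2 * b * t * Real.exp (-b * t ^ 2)) t := fun t _ =>
    (hasDerivAt_exp_mul_sq (-b) t).neg.congr_deriv (by ring)
  have hnonneg : ∀ t ∈ Set.Ioi x, 0 ≤ 2 * b * t * Real.exp (-b * t ^ 2) :=
    fun t (ht : x < t) => by have := hx.trans_lt ht; positivity
  have hlim : Filter.Tendsto (fun t : ℝ => -Real.exp (-b * t ^ 2)) Filter.atTop (nhds 0) := by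
    rw [← neg_zero]
    refine (Real.tendsto_exp_atBot.comp ?_).neg
    exact (Filter.tendsto_pow_atTop two_ne_zero).const_mul_atTop_of_neg (neg_neg_of_pos hb)
  rw [← ofReal_integral_eq_lintegral_ofReal
      (integrableOn_Ioi_deriv_of_nonneg' hderiv hnonneg hlim)
      ((ae_restrict_iff' measurableSet_Ioi).2 (ae_of_all _ hnonneg)),
    integral_Ioi_of_hasDerivAt_of_nonneg' hderiv hnonneg hlim, zero_sub, neg_neg]

lemma lintegral_exp_neg_mul_sq [SFinite μ] (hξ : Measurable ξ) {b : ℝ} (hb : 0 < b) :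
    ∫⁻ ω, ENNReal.ofReal (Real.exp (-b * ξ ω ^ 2)) ∂μ =
      ∫⁻ t in Set.Ioi (0 : ℝ), μ {ω | |ξ ω| < t} *
        ENNReal.ofReal (2 * b * t * Real.exp (-b * t ^ 2)) := by
  have hlayer : ∀ ω, ENNReal.ofReal (Real.exp (-b * ξ ω ^ 2)) =
      ∫⁻ t in Set.Ioi 0, (Set.Ioi |ξ ω|).indicator
        (fun t => ENNReal.ofReal (2 * b * t * Real.exp (-b * t ^ 2))) t := fun ω => by
    rw [← sq_abs, ← lintegral_Ioi_mul_exp_neg_mul_sq hb (abs_nonneg _),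
      setLIntegral_indicator measurableSet_Ioi,
      Set.inter_eq_left.2 (Set.Ioi_subset_Ioi (abs_nonneg _))]
  have hmeas : MeasurableSet {p : Ω × ℝ | |ξ p.1| < p.2} :=
    measurableSet_lt (by fun_prop) measurable_snd
  simp only [hlayer]
  rw [lintegral_lintegral_swap]
  · refine lintegral_congr fun t => ?_
    calc _ = ∫⁻ ω, {ω | |ξ ω| < t}.indicator
          (fun _ => ENNReal.ofReal (2 * b * t * Real.exp (-b * t ^ 2))) ω ∂μ := rfl
      _ = _ := by
        rw [lintegral_indicator_const (measurableSet_lt (by fun_prop) measurable_const), mul_comm]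
  · exact Measurable.aemeasurable (Measurable.indicator
      (f := fun p : Ω × ℝ => ENNReal.ofReal (2 * b * p.2 * Real.exp (-b * p.2 ^ 2)))
      (by fun_prop) hmeas)

lemma integral_exp_neg_sq_le [IsFiniteMeasure μ] (hξ : Measurable ξ)
    (hball : ∀ t : ℝ, 0 < t → μ.real {ω | |ξ ω| ≤ t} ≤ c₀ * t) {b : ℝ} (hb : 0 < b) :
    ∫ ω, Real.exp (-b * ξ ω ^ 2) ∂μ ≤ c₀ * √(Real.pi / b) / 2 := by
  have hc : 0 ≤ c₀ := by simpa using measureReal_nonneg.trans (hball 1 one_pos)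
  have hsmall : ∀ t : ℝ, 0 < t →
      μ {ω | |ξ ω| < t} * ENNReal.ofReal (2 * b * t * Real.exp (-b * t ^ 2)) ≤
        ENNReal.ofReal (2 * b * c₀) * ENNReal.ofReal (t ^ 2 * Real.exp (-b * t ^ 2)) :=
    fun t ht => by
    rw [← ofReal_measureReal, ← ENNReal.ofReal_mul measureReal_nonneg,
      ← ENNReal.ofReal_mul (by positivity)]
    have hlt : μ.real {ω | |ξ ω| < t} ≤ c₀ * t :=
      (measureReal_mono fun ω (hω : |ξ ω| < t) => hω.le).trans (hball t ht)
    refine ENNReal.ofReal_le_ofReal ((mul_le_mul_of_nonneg_right hlt (by positivity)).trans_eq ?_)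
    ring
  rw [integral_eq_lintegral_of_nonneg_ae (ae_of_all _ fun ω => (Real.exp_pos _).le) (by fun_prop)]
  refine ENNReal.toReal_le_of_le_ofReal (by positivity) ?_
  calc ∫⁻ ω, ENNReal.ofReal (Real.exp (-b * ξ ω ^ 2)) ∂μ
      ≤ ENNReal.ofReal (2 * b * c₀) * ENNReal.ofReal (√(Real.pi / b) / (4 * b)) := by
        rw [lintegral_exp_neg_mul_sq hξ hb, ← lintegral_sq_mul_exp_neg_mul_sq hb,
          ← lintegral_const_mul _ (by fun_prop)]
        exact setLIntegral_mono' measurableSet_Ioi hsmall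
    _ = ENNReal.ofReal (c₀ * √(Real.pi / b) / 2) := by
        rw [← ENNReal.ofReal_mul (by positivity)]
        congr 1
        field_simp
        ring

lemma subGaussian_mul_smallBall_ge [IsProbabilityMeasure μ] (hK : 0 < K)
    (hsub : ∀ t : ℝ, 0 < t → μ.real {ω | t ≤ |ξ ω|} ≤ 2 * Real.exp (-(t ^ 2 / K ^ 2)))
    (hball : ∀ t : ℝ, 0 < t → μ.real {ω | |ξ ω| ≤ t} ≤ c₀ * t) : 12 / 25 ≤ K * c₀ := by
  have hcover : 1 ≤ μ.real {ω | |ξ ω| ≤ 2 * K} + μ.real {ω | 2 * K ≤ |ξ ω|} := by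
    calc (1 : ℝ) = μ.real Set.univ := probReal_univ.symm
      _ ≤ μ.real ({ω | |ξ ω| ≤ 2 * K} ∪ {ω | 2 * K ≤ |ξ ω|}) :=
        measureReal_mono fun ω _ => (le_total |ξ ω| (2 * K) : _ ∨ _)
      _ ≤ _ := measureReal_union_le _ _
  have hexp : Real.exp (-4) ≤ 1 / 50 := by
    have he : Real.exp 4 = Real.exp 1 ^ 4 := by rw [← Real.exp_nat_mul]; norm_num
    rw [Real.exp_neg, one_div, he]
    refine inv_anti₀ (by norm_num) ?_
    calc (50 : ℝ) ≤ 2.7182818283 ^ 4 := by norm_num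
      _ ≤ _ := by gcongr; exact Real.exp_one_gt_d9.le
  have htail : μ.real {ω | 2 * K ≤ |ξ ω|} ≤ 2 * Real.exp (-4) := by
    convert hsub (2 * K) (by positivity) using 4
    field_simp
    norm_num
  linarith [hball (2 * K) (by positivity)]

end OneDim

section SumOfSquares

variable {Ω ι : Type*} [MeasurableSpace Ω] {μ : Measure Ω} [IsProbabilityMeasure μ] [Fintype ι]
  {ξ : ι → Ω → ℝ} {K c₀ : ℝ}

lemma measureReal_sum_sq_le_exp (hξ : ∀ i, Measurable (ξ i)) (hind : iIndepFun ξ μ)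
    (hball : ∀ i, ∀ t : ℝ, 0 < t → μ.real {ω | |ξ i ω| ≤ t} ≤ c₀ * t) {b : ℝ} (hb : 0 < b)
    (s : ℝ) :
    μ.real {ω | ∑ i, ξ i ω ^ 2 ≤ s} ≤
      Real.exp (b * s) * (c₀ * √(Real.pi / b) / 2) ^ Fintype.card ι := by
  have hindSq : iIndepFun (fun i ω => ξ i ω ^ 2) μ :=
    hind.comp (fun _ x => x ^ 2) fun _ => by fun_prop
  have hint : ∀ i, Integrable (fun ω => Real.exp (-b * ξ i ω ^ 2)) μ := fun i => by
    refine Integrable.of_bound (C := 1) (by fun_prop) (ae_of_all _ fun ω => ?_)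
    rw [Real.norm_of_nonneg (Real.exp_pos _).le, Real.exp_le_one_iff, neg_mul, neg_nonpos]
    positivity
  have hchernoff := measure_le_le_exp_mul_mgf (μ := μ) (X := ∑ i, fun ω => ξ i ω ^ 2) (t := -b) s
    (by linarith) (hindSq.integrable_exp_mul_sum (fun i => by fun_prop) fun i _ => hint i)
  rw [hindSq.mgf_sum (fun i => by fun_prop)] at hchernoff
  simp only [Finset.sum_apply, neg_neg] at hchernoff
  refine hchernoff.trans ?_
  rw [← Finset.card_univ]
  gcongr
  exact (Finset.prod_le_prod (fun _ _ => mgf_nonneg)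
    fun i _ => integral_exp_neg_sq_le (hξ i) (hball i) hb).trans_eq (Finset.prod_const _)

lemma sqrt_exp_one_mul_sqrt_two_pi_le : √(Real.exp 1) * √(2 * Real.pi) ≤ 207 / 50 := by
  rw [← Real.sqrt_mul (Real.exp_pos _).le]
  refine Real.sqrt_le_iff.2 ⟨by norm_num, ?_⟩
  nlinarith [Real.exp_one_lt_d9, Real.pi_lt_d4, Real.pi_pos]

lemma measureReal_sum_sq_le [Nonempty ι] (hξ : ∀ i, Measurable (ξ i)) (hind : iIndepFun ξ μ)
    (hball : ∀ i, ∀ t : ℝ, 0 < t → μ.real {ω | |ξ i ω| ≤ t} ≤ c₀ * t) {R : ℝ} (hR : 0 < R) :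
    μ.real {ω | ∑ i, ξ i ω ^ 2 ≤ R ^ 2} ≤
      (207 / 100 * c₀ * R / √(Fintype.card ι)) ^ Fintype.card ι := by
  have hc : 0 ≤ c₀ := by
    simpa using measureReal_nonneg.trans (hball (Classical.arbitrary ι) 1 one_pos)
  -- `b = card ι / (2 R²)` minimizes the Chernoff bound.
  refine (measureReal_sum_sq_le_exp hξ hind hball
    (b := Fintype.card ι / (2 * R ^ 2)) (by positivity) (R ^ 2)).trans ?_
  have hexp : Real.exp (Fintype.card ι / (2 * R ^ 2) * R ^ 2)
      = √(Real.exp 1) ^ Fintype.card ι := by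
    rw [← Real.exp_half, ← Real.exp_nat_mul]
    congr 1
    field_simp
  have hsqrt : √(Real.pi / (Fintype.card ι / (2 * R ^ 2)))
      = √(2 * Real.pi) * R / √(Fintype.card ι) := by
    rw [div_div_eq_mul_div, Real.sqrt_div (by positivity), ← mul_assoc, mul_comm Real.pi,
      Real.sqrt_mul (by positivity), Real.sqrt_sq hR.le]
  rw [hexp, hsqrt, ← mul_pow]
  refine pow_le_pow_left₀ (by positivity) ?_ _
  calc √(Real.exp 1) * (c₀ * (√(2 * Real.pi) * R / √(Fintype.card ι)) / 2)
      = √(Real.exp 1) * √(2 * Real.pi) * (c₀ * R / √(Fintype.card ι) / 2) := by ring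
    _ ≤ 207 / 50 * (c₀ * R / √(Fintype.card ι) / 2) := by
        gcongr
        exact sqrt_exp_one_mul_sqrt_two_pi_le
    _ = _ := by ring

lemma measureReal_le_sum_sq (hξ : ∀ i, Measurable (ξ i)) (hind : iIndepFun ξ μ) (hK : 0 < K)
    (hsub : ∀ i, ∀ t : ℝ, 0 < t → μ.real {ω | t ≤ |ξ i ω|} ≤ 2 * Real.exp (-(t ^ 2 / K ^ 2)))
    {a : ℝ} (ha : 0 ≤ a) (ha1 : a < 1) (s : ℝ) :
    μ.real {ω | s ≤ ∑ i, ξ i ω ^ 2} ≤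
      Real.exp (-(a / K ^ 2) * s) * ((1 + a) / (1 - a)) ^ Fintype.card ι := by
  have hindSq : iIndepFun (fun i ω => ξ i ω ^ 2) μ :=
    hind.comp (fun _ x => x ^ 2) fun _ => by fun_prop
  have hchernoff := measure_ge_le_exp_mul_mgf (μ := μ) (X := ∑ i, fun ω => ξ i ω ^ 2)
    (t := a / K ^ 2) s (by positivity)
    (hindSq.integrable_exp_mul_sum (fun i => by fun_prop)
      fun i _ => integrable_exp_sq (hξ i).aemeasurable hK (hsub i) ha ha1)
  rw [hindSq.mgf_sum (fun i => by fun_prop)] at hchernoff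
  simp only [Finset.sum_apply] at hchernoff
  refine hchernoff.trans ?_
  rw [← Finset.card_univ]
  gcongr
  exact (Finset.prod_le_prod (fun _ _ => mgf_nonneg) fun i _ =>
    integral_exp_sq_le (hξ i).aemeasurable hK (hsub i) ha ha1).trans_eq (Finset.prod_const _)

-- Without independence, convexity of `exp` replaces the product of the moment generating functions
-- by their average, at the price of the factor `card ι` in the exponent.
lemma measureReal_le_sum_sq_of_dependent [Nonempty ι] (hξ : ∀ i, Measurable (ξ i)) (hK : 0 < K)
    (hsub : ∀ i, ∀ t : ℝ, 0 < t → μ.real {ω | t ≤ |ξ i ω|} ≤ 2 * Real.exp (-(t ^ 2 / K ^ 2)))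
    {a : ℝ} (ha : 0 ≤ a) (ha1 : a < 1) (s : ℝ) :
    μ.real {ω | s ≤ ∑ i, ξ i ω ^ 2} ≤
      Real.exp (-(a / K ^ 2 / Fintype.card ι) * s) * ((1 + a) / (1 - a)) := by
  have hint : ∀ i, Integrable (fun ω => Real.exp (a / K ^ 2 * ξ i ω ^ 2)) μ := fun i =>
    integrable_exp_sq (hξ i).aemeasurable hK (hsub i) ha ha1
  set N := (Fintype.card ι : ℝ)
  have hjensen : ∀ ω, Real.exp (a / K ^ 2 / N * ∑ i, ξ i ω ^ 2) ≤
      ∑ i, N⁻¹ * Real.exp (a / K ^ 2 * ξ i ω ^ 2) := fun ω => by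
    refine le_of_eq_of_le ?_ (convexOn_exp.map_sum_le (t := Finset.univ) (w := fun _ : ι => N⁻¹)
      (p := fun i => a / K ^ 2 * ξ i ω ^ 2) (fun _ _ => by positivity)
      (by simp [N]) (fun _ _ => Set.mem_univ _))
    simp only [smul_eq_mul, Finset.mul_sum]
    congr 1
    exact Finset.sum_congr rfl fun i _ => by ring
  have hintAvg : Integrable (fun ω => ∑ i, N⁻¹ * Real.exp (a / K ^ 2 * ξ i ω ^ 2)) μ :=
    integrable_finsetSum _ fun i _ => (hint i).const_mul _
  have hintSum : Integrable (fun ω => Real.exp (a / K ^ 2 / N * ∑ i, ξ i ω ^ 2)) μ :=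
    hintAvg.mono' (by fun_prop) (ae_of_all _ fun ω => by
      simpa only [Real.norm_of_nonneg (Real.exp_pos _).le] using hjensen ω)
  refine (measure_ge_le_exp_mul_mgf (X := fun ω => ∑ i, ξ i ω ^ 2) s (by positivity)
    hintSum).trans ?_
  gcongr
  calc mgf (fun ω => ∑ i, ξ i ω ^ 2) μ (a / K ^ 2 / N)
      ≤ ∫ ω, ∑ i, N⁻¹ * Real.exp (a / K ^ 2 * ξ i ω ^ 2) ∂μ :=
        integral_mono hintSum hintAvg hjensen
    _ = ∑ i, N⁻¹ * ∫ ω, Real.exp (a / K ^ 2 * ξ i ω ^ 2) ∂μ := by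
        rw [integral_finsetSum _ fun i _ => (hint i).const_mul _]
        simp only [integral_const_mul]
    _ ≤ ∑ _i : ι, N⁻¹ * ((1 + a) / (1 - a)) := by
        gcongr with i
        exact integral_exp_sq_le (hξ i).aemeasurable hK (hsub i) ha ha1
    _ = (1 + a) / (1 - a) := by simp [N]

end SumOfSquares

-- Every outcome in `A` forces an event on a proportion `q` of `B`, while at each point of `B` that
-- event has probability at most `p`; compare by Fubini.
lemma measureReal_le_div_of_section {Ω E : Type*} [MeasurableSpace Ω] [MeasurableSpace E]
    {μ : Measure Ω} [IsFiniteMeasure μ] {ν : Measure E} [SFinite ν] {S : Set (Ω × E)}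
    (hS : MeasurableSet S) {B : Set E} (hB0 : ν B ≠ 0) (hB : ν B ≠ ∞)
    {A : Set Ω} {p q : ℝ} (hp : 0 ≤ p) (hq : 0 < q)
    (hA : ∀ ω ∈ A, ENNReal.ofReal q * ν B ≤ ν (Prod.mk ω ⁻¹' S ∩ B))
    (hpS : ∀ᵐ w ∂ν, μ.real {ω | (ω, w) ∈ S} ≤ p) : μ.real A ≤ p / q := by
  have hlower : ENNReal.ofReal q * ν B * μ A ≤ ∫⁻ ω, ν.restrict B (Prod.mk ω ⁻¹' S) ∂μ := by
    refine le_trans ?_ (mul_meas_ge_le_lintegral (measurable_measure_prodMk_left hS)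
      (ENNReal.ofReal q * ν B))
    gcongr
    intro ω hω
    rw [Set.mem_ofPred_eq, Measure.restrict_apply (hS.preimage measurable_prodMk_left)]
    exact hA ω hω
  have hupper : ∫⁻ ω, ν.restrict B (Prod.mk ω ⁻¹' S) ∂μ ≤ ENNReal.ofReal p * ν B := by
    rw [← Measure.prod_apply hS, Measure.prod_apply_symm hS, ← setLIntegral_const]
    refine lintegral_mono_ae ((ae_restrict_of_ae hpS).mono fun w hw => ?_)
    rw [← ofReal_measureReal (μ := μ)]
    exact ENNReal.ofReal_le_ofReal hw
  have hcompare := hlower.trans hupper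
  rw [mul_right_comm, ENNReal.mul_le_mul_iff_left hB0 hB, ← ofReal_measureReal (μ := μ) (s := A),
    ← ENNReal.ofReal_mul hq.le, ENNReal.ofReal_le_ofReal_iff hp] at hcompare
  rwa [le_div_iff₀ hq, mul_comm]

section ProductCoordinates

variable {E ι κ : Type*} [NormedAddCommGroup E] [InnerProductSpace ℝ E] [Fintype ι] [Fintype κ]

lemma norm_sub_sum_repr_inl_smul (b : OrthonormalBasis (ι ⊕ κ) ℝ E) (w : E) :
    ‖w - ∑ i, b.repr w (.inl i) • b (.inl i)‖ = ‖WithLp.toLp 2 fun j => b.repr w (.inr j)‖ := by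
  have hrest : w - ∑ i, b.repr w (.inl i) • b (.inl i) =
      ∑ j, b.repr w (.inr j) • b (.inr j) := by
    rw [sub_eq_iff_eq_add', ← Fintype.sum_sum_type fun k => b.repr w k • b k, b.sum_repr]
  have hinner := (b.orthonormal.comp _ Sum.inr_injective).inner_sum
    (fun j => b.repr w (.inr j)) (fun j => b.repr w (.inr j)) Finset.univ
  simp only [Function.comp_apply, conj_trivial, real_inner_self_eq_norm_sq] at hinner
  rw [hrest, ← sq_eq_sq₀ (norm_nonneg _) (norm_nonneg _), hinner, EuclideanSpace.real_norm_sq_eq]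
  exact Finset.sum_congr rfl fun j _ => (sq _).symm

variable [FiniteDimensional ℝ E] [MeasurableSpace E] [BorelSpace E]

lemma volume_setOf_repr_mem (b : OrthonormalBasis (ι ⊕ κ) ℝ E) {A : Set (ι → ℝ)}
    {B : Set (EuclideanSpace ℝ κ)} (hA : MeasurableSet A) (hB : MeasurableSet B) :
    volume {w | (fun i => b.repr w (.inl i)) ∈ A ∧ (WithLp.toLp 2 fun j => b.repr w (.inr j)) ∈ B} =
      volume A * volume B := by
  have hcoords : MeasurePreserving (fun w : E =>
      MeasurableEquiv.sumPiEquivProdPi (fun _ : ι ⊕ κ => ℝ) (WithLp.ofLp (b.repr w))) :=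
    (volume_measurePreserving_sumPiEquivProdPi fun _ => ℝ).comp
      ((PiLp.volume_preserving_ofLp (ι ⊕ κ)).comp b.measurePreserving_repr)
  have htoLp := PiLp.volume_preserving_toLp κ
  rw [← htoLp.measure_preimage hB.nullMeasurableSet, ← Measure.prod_prod, ← Measure.volume_eq_prod,
    ← hcoords.measure_preimage (hA.prod (htoLp.measurable hB)).nullMeasurableSet]
  rfl

end ProductCoordinates

section Cylinder

variable {E : Type*} [NormedAddCommGroup E] [InnerProductSpace ℝ E] {x y : E}

/-- The points whose component along `x` lies in `[a₁, a₂]`, whose component along `y` is at most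
`ρ` in absolute value, and whose remaining part has norm at most `δ`. It is used for orthonormal
`x`, `y`, when it is isometric to a rectangle times a ball of codimension two. -/
def cylinder (x y : E) (a₁ a₂ ρ δ : ℝ) : Set E :=
  {w | inner ℝ x w ∈ Set.Icc a₁ a₂ ∧ |inner ℝ y w| ≤ ρ ∧
    ‖w - inner ℝ x w • x - inner ℝ y w • y‖ ≤ δ}

lemma inner_left_sub_smul_sub_smul (hx : ‖x‖ = 1) (hxy : inner ℝ x y = 0) (w : E) :
    inner ℝ x (w - inner ℝ x w • x - inner ℝ y w • y) = 0 := by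
  simp [inner_sub_right, inner_smul_right, hxy, hx]

lemma inner_right_sub_smul_sub_smul (hy : ‖y‖ = 1) (hxy : inner ℝ x y = 0) (w : E) :
    inner ℝ y (w - inner ℝ x w • x - inner ℝ y w • y) = 0 := by
  simp [inner_sub_right, inner_smul_right, real_inner_comm x y, hxy, hy]

lemma cylinder_subset_closedBall (hx : ‖x‖ = 1) (hy : ‖y‖ = 1) (hxy : inner ℝ x y = 0)
    {a₁ a₂ ρ δ R : ℝ} (ha₁ : 0 ≤ a₁) (hR : 0 ≤ R) (h : a₂ ^ 2 + ρ ^ 2 + δ ^ 2 ≤ R ^ 2) :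
    cylinder x y a₁ a₂ ρ δ ⊆ Metric.closedBall 0 R := by
  rintro w ⟨⟨hs₁, hs₂⟩, hr, hz⟩
  rw [mem_closedBall_zero_iff]
  refine le_of_sq_le_sq (le_trans ?_ h) hR
  set z := w - inner ℝ x w • x - inner ℝ y w • y with hz_def
  have hxz : inner ℝ x z = 0 := inner_left_sub_smul_sub_smul hx hxy w
  have hyz : inner ℝ y z = 0 := inner_right_sub_smul_sub_smul hy hxy w
  have hpythagoras : ‖w‖ ^ 2 = inner ℝ x w ^ 2 + inner ℝ y w ^ 2 + ‖z‖ ^ 2 := by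
    have hw : w = inner ℝ x w • x + inner ℝ y w • y + z := by rw [hz_def]; abel
    calc ‖w‖ ^ 2 = ‖inner ℝ x w • x + inner ℝ y w • y + z‖ ^ 2 := by rw [← hw]
      _ = _ := by
        rw [norm_add_sq_real, norm_smul_add_smul_sq hx hy hxy, inner_add_left, inner_smul_left,
          inner_smul_left, hxz, hyz]
        simp
  rw [hpythagoras, ← sq_abs (inner ℝ y w)]
  have := ha₁.trans hs₁
  gcongr

variable [FiniteDimensional ℝ E]

lemma exists_orthonormalBasis_extend_pair {k : ℕ} (hdim : Module.finrank ℝ E = k + 2)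
    (hx : ‖x‖ = 1) (hy : ‖y‖ = 1) (hxy : inner ℝ x y = 0) :
    ∃ b : OrthonormalBasis (Fin 2 ⊕ Fin k) ℝ E, b (.inl 0) = x ∧ b (.inl 1) = y := by
  let v : Fin 2 ⊕ Fin k → E := Sum.elim ![x, y] 0
  have hv : Orthonormal ℝ
      ((Set.range (Sum.inl : Fin 2 → Fin 2 ⊕ Fin k)).domRestrict v) := by
    constructor
    · rintro ⟨_, i, rfl⟩
      fin_cases i
      exacts [hx, hy]
    · rintro ⟨_, i, rfl⟩ ⟨_, j, rfl⟩ hij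
      have hyx : inner ℝ y x = 0 := by rw [real_inner_comm, hxy]
      fin_cases i <;> fin_cases j <;> simp [Set.domRestrict, v, hxy, hyx] at hij ⊢
  obtain ⟨b, hb⟩ := hv.exists_orthonormalBasis_extension_of_card_eq (by simp [hdim, add_comm])
  exact ⟨b, hb _ ⟨0, rfl⟩, hb _ ⟨1, rfl⟩⟩

variable [MeasurableSpace E] [BorelSpace E]

lemma volume_cylinder {k : ℕ} (hdim : Module.finrank ℝ E = k + 2) (hx : ‖x‖ = 1) (hy : ‖y‖ = 1)
    (hxy : inner ℝ x y = 0) (a₁ a₂ ρ δ : ℝ) :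
    volume (cylinder x y a₁ a₂ ρ δ) = ENNReal.ofReal (a₂ - a₁) * ENNReal.ofReal (2 * ρ) *
      volume (Metric.closedBall (0 : EuclideanSpace ℝ (Fin k)) δ) := by
  obtain ⟨b, rfl, rfl⟩ := exists_orthonormalBasis_extend_pair hdim hx hy hxy
  have hbox : MeasurableSet
      (Set.univ.pi ![Set.Icc a₁ a₂, Set.Icc (-ρ) ρ] : Set (Fin 2 → ℝ)) :=
    MeasurableSet.univ_pi fun i => by fin_cases i <;> exact measurableSet_Icc
  have hcylinder : cylinder (b (.inl 0)) (b (.inl 1)) a₁ a₂ ρ δ =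
      {w | (fun i => b.repr w (.inl i)) ∈ Set.univ.pi ![Set.Icc a₁ a₂, Set.Icc (-ρ) ρ] ∧
        (WithLp.toLp 2 fun j => b.repr w (.inr j)) ∈ Metric.closedBall 0 δ} := by
    ext w
    rw [Set.mem_ofPred_eq, mem_closedBall_zero_iff, ← norm_sub_sum_repr_inl_smul b w,
      Set.mem_univ_pi, Fin.forall_fin_two, Fin.sum_univ_two, ← sub_sub, and_assoc]
    simp only [cylinder, Set.mem_ofPred_eq, b.repr_apply_apply, abs_le]
    rfl
  rw [hcylinder, volume_setOf_repr_mem b hbox measurableSet_closedBall, volume_pi_pi,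
    Fin.prod_univ_two]
  simp [two_mul]

end Cylinder

section Tube

variable {k : ℕ}

lemma volume_closedBall_add_two (hk : 0 < k) {R : ℝ} (hR : 0 ≤ R) :
    volume (Metric.closedBall (0 : EuclideanSpace ℝ (Fin (k + 2))) R) =
      ENNReal.ofReal (R ^ (k + 2) * (2 * Real.pi / (k + 2))) *
        volume (Metric.closedBall (0 : EuclideanSpace ℝ (Fin k)) 1) := by
  have : Nonempty (Fin k) := ⟨⟨0, hk⟩⟩
  have hGammaSucc : Real.Gamma ((k + 2 : ℕ) / 2 + 1) = (k / 2 + 1) * Real.Gamma (k / 2 + 1) := by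
    rw [← Real.Gamma_add_one (by positivity)]
    congr 1
    push_cast
    ring
  rw [EuclideanSpace.volume_closedBall, EuclideanSpace.volume_closedBall, Fintype.card_fin,
    Fintype.card_fin, hGammaSucc, ENNReal.ofReal_one, one_pow, one_mul, ← ENNReal.ofReal_pow hR,
    ← ENNReal.ofReal_mul (by positivity), ← ENNReal.ofReal_mul (by positivity)]
  congr 1
  rw [pow_add (√Real.pi), Real.sq_sqrt Real.pi_pos.le]
  field_simp

lemma one_add_inv_pow_mul_pi_le (k : ℕ) :
    (1 + 1 / ((k : ℝ) + 2)) ^ (k + 2) * Real.pi ≤ 24 * (1 - 1 / ((k : ℝ) + 2)) ^ (k + 1) := by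
  have hupper : (1 + 1 / ((k : ℝ) + 2)) ^ (k + 2) ≤ Real.exp 1 := by
    simpa using Real.one_add_inv_pow_le_exp (n := k + 2)
  have hlower : Real.exp (-1) ≤ (1 - 1 / ((k : ℝ) + 2)) ^ (k + 1) := by
    have hinv : 1 - 1 / ((k : ℝ) + 2) = (1 + ((k + 1 : ℕ) : ℝ)⁻¹)⁻¹ := by
      push_cast
      field_simp
      ring
    rw [Real.exp_neg, hinv, inv_pow]
    exact inv_anti₀ (by positivity) Real.one_add_inv_pow_le_exp
  have hconst : Real.exp 1 * Real.pi ≤ 24 * Real.exp (-1) := by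
    rw [Real.exp_neg, ← div_eq_mul_inv, le_div_iff₀ (Real.exp_pos 1)]
    calc Real.exp 1 * Real.pi * Real.exp 1 ≤ 2.7182818286 * 3.1416 * 2.7182818286 := by
          gcongr
          exacts [Real.exp_one_lt_d9.le, Real.pi_lt_d4.le, Real.exp_one_lt_d9.le]
      _ ≤ 24 := by norm_num
  calc (1 + 1 / ((k : ℝ) + 2)) ^ (k + 2) * Real.pi ≤ Real.exp 1 * Real.pi := by gcongr
    _ ≤ 24 * Real.exp (-1) := hconst
    _ ≤ 24 * (1 - 1 / ((k : ℝ) + 2)) ^ (k + 1) := by gcongr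

/-- The cylinder of directions close to `x`, thicker along `y`. At `w` in the tube, the component
along `y` is at most `ρ` times the one along `x`, and the remaining part at most `δ` times. -/
def tube (x y : EuclideanSpace ℝ (Fin (k + 2))) (ρ δ : ℝ) : Set (EuclideanSpace ℝ (Fin (k + 2))) :=
  cylinder x y (1 - 1 / (k + 2)) 1 ((1 - 1 / (k + 2)) * ρ) ((1 - 1 / (k + 2)) * δ)

variable {x y : EuclideanSpace ℝ (Fin (k + 2))} {ρ δ : ℝ}

lemma one_sub_inv_add_two_pos (k : ℕ) : 0 < 1 - 1 / ((k : ℝ) + 2) := by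
  rw [sub_pos, div_lt_one (by positivity)]
  linarith [(k.cast_nonneg : (0 : ℝ) ≤ k)]

lemma tube_subset_closedBall (hx : ‖x‖ = 1) (hy : ‖y‖ = 1) (hxy : inner ℝ x y = 0) (hρ : 0 ≤ ρ)
    (hδ : 0 ≤ δ) (h : ρ ^ 2 + δ ^ 2 ≤ 2 / (k + 2)) :
    tube x y ρ δ ⊆ Metric.closedBall 0 (1 + 1 / (k + 2)) := by
  have ha := one_sub_inv_add_two_pos k
  have ha1 : 1 - 1 / ((k : ℝ) + 2) ≤ 1 := by
    rw [sub_le_self_iff]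
    positivity
  refine cylinder_subset_closedBall hx hy hxy ha.le (by positivity) ?_
  calc (1 : ℝ) ^ 2 + ((1 - 1 / ((k : ℝ) + 2)) * ρ) ^ 2 + ((1 - 1 / ((k : ℝ) + 2)) * δ) ^ 2
      ≤ 1 ^ 2 + ρ ^ 2 + δ ^ 2 := by
        gcongr
        exacts [mul_le_of_le_one_left hρ ha1, mul_le_of_le_one_left hδ ha1]
    _ ≤ 1 + 2 / ((k : ℝ) + 2) + (1 / ((k : ℝ) + 2)) ^ 2 := by
        linarith [sq_nonneg (1 / ((k : ℝ) + 2))]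
    _ = (1 + 1 / ((k : ℝ) + 2)) ^ 2 := by ring

lemma ofReal_mul_volume_closedBall_le_volume_tube (hk : 0 < k) (hx : ‖x‖ = 1) (hy : ‖y‖ = 1)
    (hxy : inner ℝ x y = 0) (hρ : 0 ≤ ρ) (hδ : 0 ≤ δ) :
    ENNReal.ofReal (ρ * δ ^ k / 24) *
        volume (Metric.closedBall (0 : EuclideanSpace ℝ (Fin (k + 2))) (1 + 1 / (k + 2)))
      ≤ volume (tube x y ρ δ) := by
  rw [tube]
  have ha := one_sub_inv_add_two_pos k
  set a : ℝ := 1 - 1 / (k + 2)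
  have hlength : 1 - a = 1 / (k + 2) := sub_sub_cancel _ _
  rw [volume_cylinder finrank_euclideanSpace_fin hx hy hxy,
    volume_closedBall_add_two hk (by positivity),
    Measure.addHaar_closedBall' _ _ (mul_nonneg ha.le hδ),
    finrank_euclideanSpace_fin, ← mul_assoc, ← mul_assoc, hlength,
    ← ENNReal.ofReal_mul (by positivity), ← ENNReal.ofReal_mul (by positivity),
    ← ENNReal.ofReal_mul (by positivity)]
  refine mul_le_mul_left (ENNReal.ofReal_le_ofReal ?_) _
  calc ρ * δ ^ k / 24 * ((1 + 1 / ((k : ℝ) + 2)) ^ (k + 2) * (2 * Real.pi / (k + 2)))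
      = ((1 + 1 / ((k : ℝ) + 2)) ^ (k + 2) * Real.pi) * (ρ * δ ^ k / 24 * (2 / (k + 2))) := by ring
    _ ≤ (24 * a ^ (k + 1)) * (ρ * δ ^ k / 24 * (2 / (k + 2))) := by
        gcongr ?_ * _
        exact one_add_inv_pow_mul_pi_le k
    _ = 1 / (k + 2) * (2 * (a * ρ)) * (a * δ) ^ k := by
        rw [mul_pow, pow_succ]
        ring

lemma exists_eq_add_of_mem_tube (hx : ‖x‖ = 1) (hy : ‖y‖ = 1) (hxy : inner ℝ x y = 0)
    (hρ : 0 ≤ ρ) (hδ : 0 ≤ δ) {w : EuclideanSpace ℝ (Fin (k + 2))} (hw : w ∈ tube x y ρ δ) :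
    ∃ (s r : ℝ) (z : EuclideanSpace ℝ (Fin (k + 2))), w = s • x + r • y + z ∧ 0 < s ∧
      |r| / s ≤ ρ ∧ ‖z‖ / s ≤ δ ∧ inner ℝ x z = 0 ∧ inner ℝ y z = 0 := by
  obtain ⟨⟨hs, -⟩, hr, hz⟩ := hw
  have hspos : 0 < inner ℝ x w := (one_sub_inv_add_two_pos k).trans_le hs
  refine ⟨inner ℝ x w, inner ℝ y w, w - inner ℝ x w • x - inner ℝ y w • y, by abel, hspos,
    (div_le_iff₀ hspos).2 ?_, (div_le_iff₀ hspos).2 ?_, inner_left_sub_smul_sub_smul hx hxy w,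
    inner_right_sub_smul_sub_smul hy hxy w⟩
  · exact hr.trans ((mul_le_mul_of_nonneg_right hs hρ).trans_eq (mul_comm _ _))
  · exact hz.trans ((mul_le_mul_of_nonneg_right hs hδ).trans_eq (mul_comm _ _))

end Tube

section Deterministic

variable {m n D : ℕ} {d : Fin m → ℕ} {P : Fin m → MvPolynomial (Fin n) ℝ} {γ : ℝ}
  {x y : EuclideanSpace ℝ (Fin n)}

lemma exists_eq_smul_add_of_norm_sub_le (hx : ‖x‖ = 1) {w : EuclideanSpace ℝ (Fin n)} {η : ℝ}
    (hη : η < 1) (hw : ‖w - x‖ ≤ η) :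
    ∃ (s : ℝ) (v : EuclideanSpace ℝ (Fin n)), w = s • x + v ∧ inner ℝ x v = 0 ∧ 0 < s ∧
      ‖v‖ / s ≤ η / (1 - η) := by
  set e : ℝ := inner ℝ x (w - x)
  set v := w - x - e • x with hv
  have hxv : inner ℝ x v = 0 := by
    rw [hv, inner_sub_right, inner_smul_right, real_inner_self_eq_norm_sq, hx]
    ring
  have he : |e| ≤ η := by
    simpa [hx] using
      (abs_real_inner_le_norm x (w - x)).trans (hx.symm ▸ (one_mul ‖w - x‖).symm ▸ hw)
  have hvη : ‖v‖ ≤ η := by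
    have hpythagoras : ‖w - x‖ ^ 2 = e ^ 2 + ‖v‖ ^ 2 := by
      rw [← add_sub_cancel (e • x) (w - x), norm_add_sq_real, inner_smul_left, hxv, norm_smul, hx]
      simp [hv]
    refine (le_of_sq_le_sq ?_ (norm_nonneg _)).trans hw
    rw [hpythagoras]
    exact le_add_of_nonneg_left (sq_nonneg e)
  have hs : 1 - η ≤ 1 + e := by linarith [neg_le_of_abs_le he]
  have hη0 : 0 < 1 - η := sub_pos.2 hη
  refine ⟨1 + e, v, ?_, hxv, hη0.trans_le hs, by gcongr; exact (abs_nonneg e).trans he⟩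
  rw [hv, add_smul, one_smul]
  abel

lemma le_norm_projEval_of_isMax (hD : 0 < D) (hP : ∀ i, (P i).totalDegree ≤ D) (hx : ‖x‖ = 1)
    (hmax : ∀ z, ‖z‖ = 1 → ‖sysEval P z‖ ≤ ‖sysEval P x‖) {w : EuclideanSpace ℝ (Fin n)}
    (hw : ‖w - x‖ ≤ 1 / (5 * D + 1)) :
    4 / 5 * ‖sysEval P x‖ ≤ ‖projEval P w‖ := by
  have hD0 : (0 : ℝ) < D := Nat.cast_pos.2 hD
  obtain ⟨s, v, rfl, hxv, hs, hvs⟩ := exists_eq_smul_add_of_norm_sub_le hx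
    ((div_lt_one (by positivity)).2 (by linarith)) hw
  have hratio : 1 / (5 * (D : ℝ) + 1) / (1 - 1 / (5 * D + 1)) = 1 / (5 * D) := by
    rw [one_sub_div (by positivity), add_sub_cancel_right]
    field_simp
  have hclose : ‖projEval P (s • x + v) - sysEval P x‖ ≤ ‖sysEval P x‖ / 5 :=
    calc ‖projEval P (s • x + v) - sysEval P x‖
        ≤ D * ‖sysEval P x‖ * (‖v‖ / s) := norm_projEval_sub_le hP hmax hx hxv hs
      _ ≤ D * ‖sysEval P x‖ * (1 / (5 * D)) :=
        mul_le_mul_of_nonneg_left (hvs.trans_eq hratio) (by positivity)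
      _ = ‖sysEval P x‖ / 5 := by field_simp
  linarith [norm_le_norm_add_norm_sub (projEval P (s • x + v)) (sysEval P x)]

lemma norm_sysEval_sq_le_gap (P : Fin m → MvPolynomial (Fin n) ℝ)
    (p : EuclideanSpace ℝ (Fin n) × EuclideanSpace ℝ (Fin n)) :
    ‖sysEval P p.1‖ ^ 2 ≤ gap d P p :=
  le_add_of_nonneg_left (Finset.sum_nonneg fun _ _ => by positivity)

lemma norm_dirDeriv_sq_le_gap (P : Fin m → MvPolynomial (Fin n) ℝ) (hd1 : ∀ i, 1 ≤ d i)
    (hd : ∀ i, d i ≤ D) (p : EuclideanSpace ℝ (Fin n) × EuclideanSpace ℝ (Fin n)) :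
    ‖dirDeriv P p.1 p.2‖ ^ 2 ≤ D * gap d P p := by
  have hterm : ∀ i, dirDeriv P p.1 p.2 i ^ 2 ≤ D * (dirDeriv P p.1 p.2 i ^ 2 / d i) := fun i => by
    have hdi : (0 : ℝ) < d i := Nat.cast_pos.2 (hd1 i)
    have hdD : (d i : ℝ) ≤ D := Nat.cast_le.2 (hd i)
    rw [mul_div_assoc', le_div_iff₀ hdi, mul_comm]
    gcongr
  calc ‖dirDeriv P p.1 p.2‖ ^ 2 = ∑ i, dirDeriv P p.1 p.2 i ^ 2 :=
        EuclideanSpace.real_norm_sq_eq _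
    _ ≤ D * ∑ i, dirDeriv P p.1 p.2 i ^ 2 / d i :=
        (Finset.sum_le_sum fun i _ => hterm i).trans_eq (Finset.mul_sum _ _ _).symm
    _ ≤ D * gap d P p := by
        gcongr
        exact le_add_of_nonneg_right (sq_nonneg _)

lemma norm_projEval_le_of_gap (hD : 0 < D) (hP : ∀ i, (P i).totalDegree ≤ D)
    (hd1 : ∀ i, 1 ≤ d i) (hd : ∀ i, d i ≤ D) (hγ : ∀ z, ‖z‖ = 1 → ‖sysEval P z‖ ≤ γ)
    (hp : (x, y) ∈ orthoPairs n) {ε : ℝ} (hε : 0 ≤ ε) (hε1 : ε ≤ 1)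
    (hgap : gap d P (x, y) ≤ (ε * γ) ^ 2) {s r : ℝ} {z : EuclideanSpace ℝ (Fin n)} (hs : 0 < s)
    (hr : |r| / s ≤ √ε / D) (hz : ‖z‖ / s ≤ 15 * ε / D)
    (hxz : inner ℝ x z = 0) (hyz : inner ℝ y z = 0) :
    ‖projEval P (s • x + r • y + z)‖ ≤ 18 * (ε * γ) := by
  obtain ⟨hx, hy, hxy⟩ := hp
  have hD1 : (1 : ℝ) ≤ D := Nat.one_le_cast.2 hD
  have hγ0 : 0 ≤ γ := (norm_nonneg _).trans (hγ x hx)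
  have hvalue : ‖sysEval P x‖ ≤ ε * γ :=
    le_of_sq_le_sq ((norm_sysEval_sq_le_gap P (x, y)).trans hgap) (by positivity)
  have hderiv : ‖dirDeriv P x y‖ ≤ √D * (ε * γ) := by
    refine le_of_sq_le_sq ((norm_dirDeriv_sq_le_gap P hd1 hd (x, y)).trans ?_) (by positivity)
    rw [mul_pow, Real.sq_sqrt D.cast_nonneg]
    gcongr
  have hlinear : |r| / s * ‖dirDeriv P x y‖ ≤ ε * γ :=
    calc |r| / s * ‖dirDeriv P x y‖ ≤ √ε / D * (√D * (ε * γ)) := by gcongr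
      _ ≤ 1 / D * (D * (ε * γ)) := by
          gcongr
          exacts [Real.sqrt_le_one.2 hε1, (Real.sqrt_le_left D.cast_nonneg).2 (by nlinarith)]
      _ = ε * γ := by field_simp
  have hquadratic : (D : ℝ) ^ 2 * γ * (r / s) ^ 2 ≤ ε * γ :=
    calc (D : ℝ) ^ 2 * γ * (r / s) ^ 2 = D ^ 2 * γ * (|r| / s) ^ 2 := by
          rw [div_pow, div_pow, sq_abs]
      _ ≤ D ^ 2 * γ * (√ε / D) ^ 2 := by gcongr
      _ = ε * γ := by
          rw [div_pow, Real.sq_sqrt hε]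
          field_simp
  have hnormal : (D : ℝ) * γ * (‖z‖ / s) ≤ 15 * (ε * γ) :=
    calc (D : ℝ) * γ * (‖z‖ / s) ≤ D * γ * (15 * ε / D) := by gcongr
      _ = 15 * (ε * γ) := by field_simp
  linarith [norm_projEval_tube_le hP hγ hx hy hxy hs r hxz hyz]

end Deterministic

section RandomForms

variable {Ω : Type*} [MeasurableSpace Ω] {μ : Measure Ω} {m n : ℕ} {d : Fin m → ℕ}
  {C : ∀ i : Fin m, Ω → EuclideanSpace ℝ (Exponent n (d i))} {K c₀ : ℝ}

lemma norm_sysEval_formSys_sq (c : ∀ i, EuclideanSpace ℝ (Exponent n (d i)))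
    (x : EuclideanSpace ℝ (Fin n)) :
    ‖sysEval (formSys c) x‖ ^ 2 = ∑ i, inner ℝ (c i) (veronese (d i) x) ^ 2 := by
  simp only [EuclideanSpace.real_norm_sq_eq, sysEval_formSys]

lemma iIndepFun_inner (hind : iIndepFun C μ) (v : ∀ i, EuclideanSpace ℝ (Exponent n (d i))) :
    iIndepFun (fun i ω => inner ℝ (C i ω) (v i)) μ :=
  hind.comp (fun i c => inner ℝ c (v i)) fun i => by fun_prop

lemma SmallBall.measureReal_abs_inner_le {ι : Type*} [Fintype ι] {X : Ω → EuclideanSpace ℝ ι}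
    (h : SmallBall μ X c₀) {θ : EuclideanSpace ℝ ι} (hθ : ‖θ‖ = 1) {t : ℝ} (ht : 0 < t) :
    μ.real {ω | |inner ℝ (X ω) θ| ≤ t} ≤ c₀ * t := by
  simpa only [hθ, mul_one, real_inner_comm] using h θ (norm_ne_zero_iff.1 (by simp [hθ])) t ht

variable [IsProbabilityMeasure μ]

lemma measureReal_norm_sysEval_le (hm : 0 < m) (hC : ∀ i, Measurable (C i))
    (hind : iIndepFun C μ) (hsb : ∀ i, SmallBall μ (C i) c₀) {R : ℝ} (hR : 0 < R)
    {u : EuclideanSpace ℝ (Fin n)} (hu : ‖u‖ = 1) :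
    μ.real {ω | ‖sysEval (formSys (C · ω)) u‖ ≤ R} ≤ (207 / 100 * c₀ * R / √m) ^ m := by
  have : Nonempty (Fin m) := ⟨⟨0, hm⟩⟩
  have hbound := measureReal_sum_sq_le (ξ := fun i ω => inner ℝ (C i ω) (veronese (d i) u))
    (fun i => by have := hC i; fun_prop) (iIndepFun_inner hind _)
    (fun i _ => (hsb i).measureReal_abs_inner_le (by rw [norm_veronese, hu, one_pow])) hR
  simpa only [← norm_sysEval_formSys_sq, sq_le_sq₀ (norm_nonneg _) hR.le, Fintype.card_fin]
    using hbound

lemma measureReal_le_norm_sysEval (hC : ∀ i, Measurable (C i)) (hind : iIndepFun C μ)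
    (hK : 0 < K) (hsg : ∀ i, SubGaussian μ (C i) K) {a : ℝ} (ha : 0 ≤ a)
    {u : EuclideanSpace ℝ (Fin n)} (hu : ‖u‖ = 1) :
    μ.real {ω | a ≤ ‖sysEval (formSys (C · ω)) u‖} ≤
      Real.exp (-(4 / 5 / K ^ 2) * a ^ 2) * 9 ^ m := by
  have hbound := measureReal_le_sum_sq (ξ := fun i ω => inner ℝ (C i ω) (veronese (d i) u))
    (fun i => by have := hC i; fun_prop) (iIndepFun_inner hind _) hK
    (fun i => hsg i _ (by rw [norm_veronese, hu, one_pow])) (a := 4 / 5) (by norm_num)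
    (by norm_num) (a ^ 2)
  norm_num only [← norm_sysEval_formSys_sq, sq_le_sq₀ ha (norm_nonneg _), Fintype.card_fin]
    at hbound ⊢
  exact hbound

lemma card_sigma_exponent (n : ℕ) (d : Fin m → ℕ) :
    Fintype.card (Σ i, Exponent n (d i)) = numCoeffs n d := by
  simp only [Fintype.card_sigma, numCoeffs, Fintype.card_coe,
    Finset.card_finsuppAntidiag_nat_eq_choose, Finset.card_univ, Fintype.card_fin]

lemma measureReal_le_sysNorm (hC : ∀ i, Measurable (C i)) (hK : 0 < K)
    (hsg : ∀ i, SubGaussian μ (C i) K) (hN : 0 < numCoeffs n d) {a : ℝ} (ha : 0 ≤ a) :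
    μ.real {ω | a ≤ sysNorm d (formSys (C · ω))} ≤
      Real.exp (-(4 / 5 / K ^ 2 / numCoeffs n d) * a ^ 2) * 9 := by
  have : Nonempty (Σ i, Exponent n (d i)) :=
    Fintype.card_pos_iff.1 (hN.trans_eq (card_sigma_exponent n d).symm)
  have hcoord : ∀ (p : Σ i, Exponent n (d i)) (t : ℝ), 0 < t →
      μ.real {ω | t ≤ |C p.1 ω p.2|} ≤ 2 * Real.exp (-(t ^ 2 / K ^ 2)) := fun p => by
    simpa [EuclideanSpace.inner_single_right] using
      hsg p.1 (EuclideanSpace.single p.2 1) (by simp)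
  have hbound := measureReal_le_sum_sq_of_dependent (μ := μ)
    (ξ := fun (p : Σ i, Exponent n (d i)) ω => C p.1 ω p.2)
    (fun p => by have := hC p.1; fun_prop) hK hcoord (a := 4 / 5) (by norm_num) (by norm_num)
    (a ^ 2)
  have hnorm : ∀ ω, (a ^ 2 ≤ ∑ p : Σ i, Exponent n (d i), C p.1 ω p.2 ^ 2) =
      (a ≤ sysNorm d (formSys (C · ω))) := fun ω => by
    rw [sysNorm_formSys, Real.le_sqrt ha (by positivity), Fintype.sum_sigma]
    simp only [EuclideanSpace.real_norm_sq_eq]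
  norm_num only [card_sigma_exponent, hnorm] at hbound ⊢
  exact hbound

lemma measurable_norm_projEval_formSys (hC : ∀ i, Measurable (C i)) :
    Measurable fun p : Ω × EuclideanSpace ℝ (Fin n) =>
      ‖projEval (formSys (C · p.1)) p.2‖ := by
  have hpair : Measurable fun p : Ω × EuclideanSpace ℝ (Fin n) => ((C · p.1), ‖p.2‖⁻¹ • p.2) :=
    (measurable_pi_lambda _ fun i => (hC i).comp measurable_fst).prodMk
      (measurable_snd.norm.inv.smul measurable_snd)
  have hnorm : Measurable fun q : (∀ i, EuclideanSpace ℝ (Exponent n (d i))) ×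
      EuclideanSpace ℝ (Fin n) => ‖sysEval (formSys q.1) q.2‖ :=
    continuous_sysEval_formSys.norm.measurable
  simpa only [projEval, Function.comp_def] using hnorm.comp hpair

lemma continuous_sysEval (P : Fin m → MvPolynomial (Fin n) ℝ) : Continuous (sysEval P) :=
  (PiLp.continuous_toLp 2 _).comp
    (continuous_pi fun i => (MvPolynomial.continuous_eval (P i)).comp (by fun_prop))

lemma exists_isMax_norm_sysEval (P : Fin m → MvPolynomial (Fin n) ℝ)
    {u : EuclideanSpace ℝ (Fin n)} (hu : ‖u‖ = 1) :
    ∃ x : EuclideanSpace ℝ (Fin n), ‖x‖ = 1 ∧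
      ∀ z, ‖z‖ = 1 → ‖sysEval P z‖ ≤ ‖sysEval P x‖ := by
  simpa only [mem_sphere_zero_iff_norm, IsMaxOn, IsMaxFilter, Filter.eventually_principal] using
    (isCompact_sphere (0 : EuclideanSpace ℝ (Fin n)) 1).exists_isMaxOn
      ⟨u, mem_sphere_zero_iff_norm.2 hu⟩ (continuous_sysEval P).norm.continuousOn

lemma ofReal_pow_mul_volume_closedBall (x : EuclideanSpace ℝ (Fin n)) {r R : ℝ} (hr : 0 ≤ r)
    (hR : 0 < R) :
    ENNReal.ofReal ((r / R) ^ n) * volume (Metric.closedBall (0 : EuclideanSpace ℝ (Fin n)) R) =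
      volume (Metric.closedBall x r) := by
  rw [Measure.addHaar_closedBall _ _ hr, Measure.addHaar_closedBall _ _ hR.le,
    finrank_euclideanSpace_fin, ← mul_assoc, ← ENNReal.ofReal_mul (by positivity), ← mul_pow,
    div_mul_cancel₀ _ hR.ne']

lemma closedBall_subset_setOf_le_norm_projEval {P : Fin m → MvPolynomial (Fin n) ℝ} {D : ℕ}
    (hD : 0 < D) (hP : ∀ i, (P i).totalDegree ≤ D) {x : EuclideanSpace ℝ (Fin n)} (hx : ‖x‖ = 1)
    (hmax : ∀ z, ‖z‖ = 1 → ‖sysEval P z‖ ≤ ‖sysEval P x‖) :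
    Metric.closedBall x (1 / (5 * D + 1)) ⊆ {w | 4 / 5 * ‖sysEval P x‖ ≤ ‖projEval P w‖} ∩
      Metric.closedBall 0 (1 + 1 / (5 * D + 1)) := by
  refine Set.subset_inter (fun w hw => ?_) (Metric.closedBall_subset_closedBall' ?_)
  · exact le_norm_projEval_of_isMax hD hP hx hmax (mem_closedBall_iff_norm.1 hw)
  · rw [dist_zero_right, hx, add_comm]

lemma ae_norm_inv_norm_smul_eq_one (hn : 0 < n) :
    ∀ᵐ w : EuclideanSpace ℝ (Fin n), ‖‖w‖⁻¹ • w‖ = 1 := by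
  have : Nonempty (Fin n) := ⟨⟨0, hn⟩⟩
  filter_upwards [compl_mem_ae_iff.2 (measure_singleton (0 : EuclideanSpace ℝ (Fin n)))] with w hw
  exact norm_smul_inv_norm (𝕜 := ℝ) hw

lemma measureReal_exists_lt_norm_sysEval (hn : 0 < n) (hC : ∀ i, Measurable (C i))
    (hind : iIndepFun C μ) (hK : 0 < K) (hsg : ∀ i, SubGaussian μ (C i) K)
    (hd : 0 < maxDeg d) {γ : ℝ} (hγ : 0 ≤ γ) :
    μ.real {ω | ∃ u : EuclideanSpace ℝ (Fin n), ‖u‖ = 1 ∧ γ < ‖sysEval (formSys (C · ω)) u‖} ≤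
      Real.exp (-(4 / 5 / K ^ 2) * (4 / 5 * γ) ^ 2) * 9 ^ m * (5 * maxDeg d + 2) ^ n := by
  set D := maxDeg d
  have hratio : 1 / (5 * (D : ℝ) + 1) / (1 + 1 / (5 * D + 1)) = (5 * (D : ℝ) + 2)⁻¹ := by
    field_simp
    ring
  have hS : MeasurableSet {p : Ω × EuclideanSpace ℝ (Fin n) |
      4 / 5 * γ ≤ ‖projEval (formSys (C · p.1)) p.2‖} :=
    measurableSet_le measurable_const (measurable_norm_projEval_formSys hC)
  rw [← div_inv_eq_mul, ← inv_pow]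
  refine measureReal_le_div_of_section hS
    (Metric.measure_closedBall_pos volume 0 (r := 1 + 1 / (5 * (D : ℝ) + 1)) (by positivity)).ne'
    measure_closedBall_lt_top.ne (by positivity) (by positivity) ?_ ?_
  · rintro ω ⟨u, hu, hγu⟩
    obtain ⟨x, hx, hmax⟩ := exists_isMax_norm_sysEval (formSys (C · ω)) hu
    have hγx : 4 / 5 * γ ≤ 4 / 5 * ‖sysEval (formSys (C · ω)) x‖ := by
      have := hγu.le.trans (hmax u hu)
      linarith
    rw [← hratio, ofReal_pow_mul_volume_closedBall x (by positivity) (by positivity)]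
    exact measure_mono ((closedBall_subset_setOf_le_norm_projEval hd (totalDegree_formSys_le _)
      hx hmax).trans (Set.inter_subset_inter_left _ fun w hw => hγx.trans hw))
  · filter_upwards [ae_norm_inv_norm_smul_eq_one hn] with w hw
    exact measureReal_le_norm_sysEval hC hind hK hsg (by positivity) hw

lemma measureReal_minGap_le {k : ℕ} (hk : 0 < k) {d : Fin (k + 1) → ℕ}
    {C : ∀ i, Ω → EuclideanSpace ℝ (Exponent (k + 2) (d i))} (hC : ∀ i, Measurable (C i))
    (hind : iIndepFun C μ) (hsb : ∀ i, SmallBall μ (C i) c₀) (hd1 : ∀ i, 1 ≤ d i) {γ ε : ℝ}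
    (hγ : 0 < γ) (hε : 0 < ε) (hε1 : ε ≤ 1)
    (hεk : (√ε / maxDeg d) ^ 2 + (15 * ε / maxDeg d) ^ 2 ≤ 2 / (k + 2)) :
    μ.real {ω | (∀ u, ‖u‖ = 1 → ‖sysEval (formSys (C · ω)) u‖ ≤ γ) ∧
        minGap (C · ω) ≤ (ε * γ) ^ 2} ≤
      (207 / 100 * c₀ * (18 * (ε * γ)) / √(k + 1 : ℕ)) ^ (k + 1) /
        (√ε / maxDeg d * (15 * ε / maxDeg d) ^ k / 24) := by
  have hD : 0 < maxDeg d := (hd1 0).trans (le_maxDeg 0)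
  have hc : 0 ≤ c₀ := by
    simpa using measureReal_nonneg.trans ((hsb 0).measureReal_abs_inner_le
      (θ := veronese (d 0) (EuclideanSpace.single 0 1)) (by simp [norm_veronese]) one_pos)
  have hS : MeasurableSet {p : Ω × EuclideanSpace ℝ (Fin (k + 2)) |
      ‖projEval (formSys (C · p.1)) p.2‖ ≤ 18 * (ε * γ)} :=
    measurableSet_le (measurable_norm_projEval_formSys hC) measurable_const
  refine measureReal_le_div_of_section hS
    (Metric.measure_closedBall_pos volume 0 (r := 1 + 1 / ((k : ℝ) + 2)) (by positivity)).ne'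
    measure_closedBall_lt_top.ne (by positivity) (by positivity) ?_ ?_
  · rintro ω ⟨hsup, hgap⟩
    obtain ⟨⟨x, y⟩, ⟨hx, hy, hxy⟩, hmin⟩ := exists_minGap (by omega) (C · ω)
    refine (ofReal_mul_volume_closedBall_le_volume_tube hk hx hy hxy (by positivity)
      (by positivity)).trans (measure_mono (Set.subset_inter (fun w hw => ?_)
        (tube_subset_closedBall hx hy hxy (by positivity) (by positivity) hεk)))
    obtain ⟨s, r, z, rfl, hs, hr, hz, hxz, hyz⟩ :=
      exists_eq_add_of_mem_tube hx hy hxy (by positivity) (by positivity) hw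
    exact norm_projEval_le_of_gap hD (totalDegree_formSys_le _) hd1 le_maxDeg hsup ⟨hx, hy, hxy⟩
      hε.le hε1 (hmin.trans_le hgap) hs hr hz hxz hyz
  · filter_upwards [ae_norm_inv_norm_smul_eq_one (by omega)] with w hw
    exact measureReal_norm_sysEval_le (by omega) hC hind hsb (by positivity) hw

end RandomForms

section Numerics

variable {k m : ℕ} {D K N x q t ε B : ℝ}

lemma le_log_exp_one_mul (hD : 2 ≤ D) : 169 / 100 ≤ Real.log (Real.exp 1 * D) := by
  rw [Real.log_mul (Real.exp_ne_zero _) (by linarith), Real.log_exp]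
  linarith [Real.log_two_gt_d9, Real.log_le_log two_pos hD]

lemma nine_sq_mul_six_mul_pow_le (hD : 2 ≤ D) : 9 ^ 2 * (6 * D) ^ 3 ≤ (Real.exp 1 * D) ^ 7 :=
  calc 9 ^ 2 * (6 * D) ^ 3 ≤ 2.7182818283 ^ 7 * 2 ^ 4 * D ^ 3 := by
        rw [mul_pow, ← mul_assoc]
        exact mul_le_mul_of_nonneg_right (by norm_num) (by positivity)
    _ ≤ Real.exp 1 ^ 7 * D ^ 4 * D ^ 3 := by
        gcongr
        exact Real.exp_one_gt_d9.le
    _ = (Real.exp 1 * D) ^ 7 := by ring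

lemma nine_pow_mul_pow_le_exp (hD : 2 ≤ D) (hm : 2 ≤ m) :
    9 ^ m * (5 * D + 2) ^ (m + 1) ≤ Real.exp (7 / 2 * (m * Real.log (Real.exp 1 * D))) := by
  refine (sq_le_sq₀ (by positivity) (by positivity)).1 ?_
  calc (9 ^ m * (5 * D + 2) ^ (m + 1)) ^ 2 = (9 ^ 2) ^ m * (5 * D + 2) ^ (2 * (m + 1)) := by
        rw [mul_pow, ← pow_mul, ← pow_mul, ← pow_mul, mul_comm m, mul_comm (m + 1)]
    _ ≤ (9 ^ 2) ^ m * (6 * D) ^ (3 * m) := by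
        gcongr
        exact (pow_le_pow_left₀ (by positivity) (by linarith) _).trans
          (pow_le_pow_right₀ (by linarith) (by omega))
    _ = (9 ^ 2 * (6 * D) ^ 3) ^ m := by rw [pow_mul, ← mul_pow]
    _ ≤ ((Real.exp 1 * D) ^ 7) ^ m := by
        gcongr
        exact nine_sq_mul_six_mul_pow_le hD
    _ = Real.exp (7 / 2 * (m * Real.log (Real.exp 1 * D))) ^ 2 := by
        nth_rw 1 [← Real.exp_log (by positivity : 0 < Real.exp 1 * D)]
        simp only [← Real.exp_nat_mul]
        push_cast
        ring_nf

lemma exp_neg_mul_nine_pow_mul_pow_le (hD : 2 ≤ D) (hm : 2 ≤ m) (hK : K ≠ 0)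
    (hx : m * Real.log (Real.exp 1 * D) ≤ x) :
    Real.exp (-(4 / 5 / K ^ 2) * (4 / 5 * (3 * K * √x)) ^ 2) * 9 ^ m * (5 * D + 2) ^ (m + 1) ≤
      Real.exp (-x) := by
  have hx0 : 0 ≤ x :=
    (mul_nonneg m.cast_nonneg (by linarith [le_log_exp_one_mul hD])).trans hx
  calc Real.exp (-(4 / 5 / K ^ 2) * (4 / 5 * (3 * K * √x)) ^ 2) * 9 ^ m * (5 * D + 2) ^ (m + 1)
      = Real.exp (-(576 / 125 * x)) * (9 ^ m * (5 * D + 2) ^ (m + 1)) := by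
        rw [mul_assoc]
        congr 2
        rw [mul_pow, mul_pow, Real.sq_sqrt hx0]
        field_simp
        ring
    _ ≤ Real.exp (-(576 / 125 * x)) * Real.exp (7 / 2 * x) := by
        gcongr
        exact (nine_pow_mul_pow_le_exp hD hm).trans (by gcongr)
    _ ≤ Real.exp (-x) := by
        rw [← Real.exp_add]
        gcongr
        linarith

lemma exp_neg_mul_nine_le (hK : K ≠ 0) (hN : 0 < N) (hx : 2 ≤ x) :
    Real.exp (-(4 / 5 / K ^ 2 / N) * (√N * (3 * K * √x)) ^ 2) * 9 ≤ Real.exp (-x) := by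
  calc Real.exp (-(4 / 5 / K ^ 2 / N) * (√N * (3 * K * √x)) ^ 2) * 9
      = Real.exp (-(36 / 5 * x)) * 9 := by
        congr 2
        rw [mul_pow, mul_pow, Real.sq_sqrt hN.le, Real.sq_sqrt (by linarith)]
        field_simp
        ring
    _ ≤ Real.exp (-(36 / 5 * x)) * Real.exp (31 / 5 * x) := by
        gcongr
        linarith [Real.add_one_le_exp (31 / 5 * x)]
    _ = Real.exp (-x) := by
        rw [← Real.exp_add]
        ring_nf

lemma add_two_le_pow_mul_pow (k : ℕ) (hq : 12 / 25 ≤ q) (hB : 20 ≤ B) :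
    (k : ℝ) + 2 ≤ q ^ (2 * (k + 1)) * B ^ (2 * k + 1) :=
  calc (k : ℝ) + 2 ≤ 2 ^ (k + 1) := mod_cast (Nat.lt_two_pow_self (n := k + 1))
    _ ≤ ((12 / 25) ^ 2 * 20) * ((12 / 25) ^ 2 * 20 ^ 2) ^ k := by
        rw [pow_succ, mul_comm]
        gcongr <;> norm_num
    _ = (12 / 25) ^ (2 * (k + 1)) * 20 ^ (2 * k + 1) := by
        rw [mul_pow, ← pow_mul, ← pow_mul]
        ring
    _ ≤ q ^ (2 * (k + 1)) * B ^ (2 * k + 1) := by gcongr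

lemma mul_pow_succ_le_mul_pow (k : ℕ) (hB : 20 ≤ B) :
    360 ^ 2 * (19 * B) ^ (k + 1) ≤ 10 ^ 7 * B ^ (2 * k + 1) :=
  calc 360 ^ 2 * (19 * B) ^ (k + 1) = (360 ^ 2 * 19) * B * (19 * B) ^ k := by ring
    _ ≤ 10 ^ 7 * B * (B * B) ^ k := by
        gcongr
        · norm_num
        · linarith
    _ = 10 ^ 7 * B ^ (2 * k + 1) := by ring

lemma pow_div_eq_sqrt_mul_pow {y : ℝ} (hD : 0 < D) (hε : 0 < ε) :
    (ε * y) ^ (k + 1) / (√ε / D * (15 * ε / D) ^ k / 24) =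
      360 * √ε * (y * D / 15) ^ (k + 1) := by
  have hbase : ε * y = 15 * ε / D * (y * D / 15) := by field_simp
  have hpow : 0 < (15 * ε / D) ^ k := by positivity
  rw [hbase, mul_pow, pow_succ (15 * ε / D), div_eq_iff (by positivity)]
  generalize (15 * ε / D) ^ k = Y at hpow ⊢
  generalize (y * D / 15) ^ (k + 1) = X
  field_simp
  rw [Real.sq_sqrt hε.le]
  ring

lemma twenty_le_mul_log (hD : 2 ≤ D) : 20 ≤ 3 * D ^ 2 * Real.log (Real.exp 1 * D) := by
  nlinarith [le_log_exp_one_mul hD]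

lemma three_mul_sq_le {r : ℝ} (hr : 2 ≤ r) (hD : 1 ≤ D) (hε : 0 ≤ ε) (hεr : ε ≤ 1 / (10 ^ 7 * r)) :
    ε ≤ 1 ∧ (√ε / D) ^ 2 + (15 * ε / D) ^ 2 ≤ 2 / r := by
  have hε_mul : ε * (10 ^ 7 * r) ≤ 1 := (le_div_iff₀ (by positivity)).1 hεr
  have hε_small : ε ≤ 1 / 10 ^ 7 :=
    hεr.trans (one_div_le_one_div_of_le (by norm_num) (by linarith))
  refine ⟨by linarith, ?_⟩
  calc (√ε / D) ^ 2 + (15 * ε / D) ^ 2 ≤ √ε ^ 2 + (15 * ε) ^ 2 := by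
        gcongr <;> exact div_le_self (by positivity) hD
    _ ≤ 2 * ε := by
        rw [Real.sq_sqrt hε]
        nlinarith
    _ ≤ 2 / r := by
        rw [le_div_iff₀ (by positivity)]
        nlinarith

lemma sqrt_mul_pow_le_one_div_sqrt {b : ℝ} (hq : 0 < q) (hD : 0 < D) (hb : 0 < b)
    (hB : 20 ≤ 3 * D ^ 2 * b) (ht : 0 < t) (hε : 0 ≤ ε)
    (hεt : ε ≤ 1 / (10 ^ 7 * (t * (q ^ (2 * (k + 1)) * (3 * D ^ 2 * b) ^ (2 * k + 1))))) :
    360 * √ε * (1863 / 250 * q * D * √b) ^ (k + 1) ≤ 1 / √t := by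
  have hbase : (1863 / 250 * D * √b) ^ 2 ≤ 19 * (3 * D ^ 2 * b) := by
    rw [mul_pow, Real.sq_sqrt hb.le]
    nlinarith [mul_pos (pow_pos hD 2) hb]
  refine (sq_le_sq₀ (by positivity) (by positivity)).1 ?_
  calc (360 * √ε * (1863 / 250 * q * D * √b) ^ (k + 1)) ^ 2
      = ε * (q ^ (2 * (k + 1)) * (360 ^ 2 * ((1863 / 250 * D * √b) ^ 2) ^ (k + 1))) := by
        rw [mul_pow, mul_pow, Real.sq_sqrt hε, ← pow_mul, ← pow_mul]
        ring
    _ ≤ ε * (q ^ (2 * (k + 1)) * (360 ^ 2 * (19 * (3 * D ^ 2 * b)) ^ (k + 1))) := by gcongr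
    _ ≤ ε * (q ^ (2 * (k + 1)) * (10 ^ 7 * (3 * D ^ 2 * b) ^ (2 * k + 1))) := by
        gcongr ε * (_ * ?_)
        exact mul_pow_succ_le_mul_pow k hB
    _ ≤ 1 / t := by
        rw [le_div_iff₀ (by positivity)] at hεt ⊢
        linarith
    _ = (1 / √t) ^ 2 := by rw [div_pow, one_pow, Real.sq_sqrt ht.le]

lemma exp_neg_le_one_div_sqrt (ht : 0 < t) (hx : Real.log t ≤ 2 * x) :
    Real.exp (-x) ≤ 1 / √t := by
  rw [Real.exp_neg, ← one_div]
  refine one_div_le_one_div_of_le (by positivity) (Real.sqrt_le_iff.2 ⟨by positivity, ?_⟩)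
  rwa [← Real.exp_nat_mul, ← Real.log_le_iff_le_exp ht, Nat.cast_ofNat]

lemma sqrt_le_exp (s : ℝ) : √s ≤ Real.exp ((s - 1) / 2) := by
  refine Real.sqrt_le_iff.2 ⟨by positivity, ?_⟩
  rw [← Real.exp_nat_mul]
  calc s ≤ Real.exp (s - 1) := by linarith [Real.add_one_le_exp (s - 1)]
    _ = Real.exp ((2 : ℕ) * ((s - 1) / 2)) := by
        push_cast
        ring_nf

end Numerics

section Tail

variable {k : ℕ} {d : Fin (k + 1) → ℕ} {A K c₀ t x : ℝ}

/-- The quantity `log (e d)` of the paper, where `d` is the largest degree. -/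
noncomputable def logDeg {m : ℕ} (d : Fin m → ℕ) : ℝ :=
  Real.log (Real.exp 1 * maxDeg d)

lemma le_logDeg (hD : 2 ≤ maxDeg d) : 169 / 100 ≤ logDeg d :=
  le_log_exp_one_mul (by exact_mod_cast hD)

lemma twenty_le_mul_logDeg (hD : 2 ≤ maxDeg d) : 20 ≤ 3 * (maxDeg d : ℝ) ^ 2 * logDeg d :=
  twenty_le_mul_log (by exact_mod_cast hD)

lemma numCoeffs_pos (d : Fin (k + 1) → ℕ) : 0 < numCoeffs (k + 2) d :=
  Finset.sum_pos (fun i _ => Nat.choose_pos (by omega)) Finset.univ_nonempty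

lemma boundM_eq (A K c₀ : ℝ) (d : Fin (k + 1) → ℕ) : boundM A K c₀ (k + 2) d =
    A * √(numCoeffs (k + 2) d) *
      ((K * c₀) ^ (2 * (k + 1)) * (3 * (maxDeg d : ℝ) ^ 2 * logDeg d) ^ (2 * k + 1)) *
        √((k : ℝ) + 2) := by
  rw [boundM, logDeg, show 2 * (k + 2) - 3 = 2 * k + 1 by omega, Nat.cast_add, Nat.cast_ofNat,
    ← mul_assoc]
  rfl

lemma boundM_exp_mul (u A K c₀ : ℝ) (d : Fin (k + 1) → ℕ) :
    boundM (Real.exp u * A) K c₀ (k + 2) d = Real.exp u * boundM A K c₀ (k + 2) d := by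
  simp only [boundM, mul_assoc]

lemma boundM_pos (hA : 0 < A) (hq : 0 < K * c₀) (hD : 2 ≤ maxDeg d) :
    0 < boundM A K c₀ (k + 2) d := by
  have hN : (0 : ℝ) < numCoeffs (k + 2) d := Nat.cast_pos.2 (numCoeffs_pos d)
  have hB := twenty_le_mul_logDeg hD
  rw [boundM_eq]
  positivity

lemma sqrt_numCoeffs_div_boundM_le (hA : 10 ^ 7 ≤ A) (hq : 0 < K * c₀) (hD : 2 ≤ maxDeg d)
    (ht : 0 < t) :
    √(numCoeffs (k + 2) d) / (t * boundM A K c₀ (k + 2) d) ≤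
      1 / (10 ^ 7 * (t * ((K * c₀) ^ (2 * (k + 1)) *
        (3 * (maxDeg d : ℝ) ^ 2 * logDeg d) ^ (2 * k + 1)))) := by
  have hN : (0 : ℝ) < numCoeffs (k + 2) d := Nat.cast_pos.2 (numCoeffs_pos d)
  have hB := twenty_le_mul_logDeg hD
  have hk : 1 ≤ √((k : ℝ) + 2) := Real.one_le_sqrt.2 (by linarith [k.cast_nonneg (α := ℝ)])
  have hM := boundM_pos (d := d) (by linarith : 0 < A) hq hD
  set Q := (K * c₀) ^ (2 * (k + 1)) * (3 * (maxDeg d : ℝ) ^ 2 * logDeg d) ^ (2 * k + 1) with hQ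
  rw [div_le_div_iff₀ (by positivity) (by positivity), one_mul, boundM_eq, ← hQ]
  calc √(numCoeffs (k + 2) d) * (10 ^ 7 * (t * Q)) = √(numCoeffs (k + 2) d) * t * Q * 10 ^ 7 := by
        ring
    _ ≤ √(numCoeffs (k + 2) d) * t * Q * (A * √((k : ℝ) + 2)) := by
        gcongr
        exact hA.trans (le_mul_of_one_le_right (by linarith) hk)
    _ = t * (A * √(numCoeffs (k + 2) d) * Q * √((k : ℝ) + 2)) := by ring

lemma minGap_le_of_le_kappa (hd1 : ∀ i, 1 ≤ d i)
    {c : ∀ i, EuclideanSpace ℝ (Exponent (k + 2) (d i))} {T W : ℝ} (hT : 0 < T)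
    (hκ : ENNReal.ofReal T ≤ kappa d (formSys c)) (hW : sysNorm d (formSys c) ≤ W) :
    minGap c ≤ (W / T) ^ 2 := by
  rw [kappa_formSys k.succ_pos hd1] at hκ
  have hmul := (ENNReal.ofReal_mul hT.le).trans_le (ENNReal.mul_le_of_le_div hκ)
  rw [ENNReal.ofReal_le_ofReal_iff (by unfold sysNorm; positivity)] at hmul
  refine (Real.sqrt_le_iff.1 ?_).2
  rw [le_div_iff₀ hT, mul_comm]
  exact hmul.trans hW

variable {Ω : Type*} [MeasurableSpace Ω] {μ : Measure Ω}
  {C : ∀ i, Ω → EuclideanSpace ℝ (Exponent (k + 2) (d i))}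

/-- The standing assumptions on the random coefficient vectors of a system of `k + 1` forms in
`k + 2` variables: they are independent, sub-Gaussian with constant `K` and have the small ball
property with constant `c₀`. Their expectations are not restricted. -/
structure IsAdmissible (μ : Measure Ω) (C : ∀ i, Ω → EuclideanSpace ℝ (Exponent (k + 2) (d i)))
    (K c₀ : ℝ) : Prop where
  measurable : ∀ i, Measurable (C i)
  indep : iIndepFun C μ
  pos : 0 < K
  subGaussian : ∀ i, SubGaussian μ (C i) K
  smallBall : ∀ i, SmallBall μ (C i) c₀

namespace IsAdmissible

variable [IsProbabilityMeasure μ]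

lemma mul_ge (h : IsAdmissible μ C K c₀) : 12 / 25 ≤ K * c₀ := by
  have hθ : ‖veronese (d 0) (EuclideanSpace.single (0 : Fin (k + 2)) 1)‖ = 1 := by
    simp [norm_veronese]
  exact subGaussian_mul_smallBall_ge h.pos (h.subGaussian 0 _ hθ)
    fun t ht => (h.smallBall 0).measureReal_abs_inner_le hθ ht

lemma boundM_pos (h : IsAdmissible μ C K c₀) (hA : 0 < A) (hD : 2 ≤ maxDeg d) :
    0 < boundM A K c₀ (k + 2) d :=
  RandomSystem.boundM_pos hA (by linarith [h.mul_ge]) hD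

lemma measureReal_exists_lt_norm_sysEval_le (h : IsAdmissible μ C K c₀) (hk : 0 < k)
    (hD : 2 ≤ maxDeg d) (hx : ((k : ℝ) + 1) * logDeg d ≤ x) :
    μ.real {ω | ∃ u : EuclideanSpace ℝ (Fin (k + 2)), ‖u‖ = 1 ∧
      3 * K * √x < ‖sysEval (formSys (C · ω)) u‖} ≤ Real.exp (-x) := by
  have := h.pos
  refine (measureReal_exists_lt_norm_sysEval (by omega) h.measurable h.indep h.pos h.subGaussian
    (by omega) (by positivity)).trans ?_
  exact exp_neg_mul_nine_pow_mul_pow_le (m := k + 1) (by exact_mod_cast hD) (by omega) h.pos.ne'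
    (by push_cast; exact hx)

lemma measureReal_le_sysNorm_le (h : IsAdmissible μ C K c₀) (hx : 2 ≤ x) :
    μ.real {ω | √(numCoeffs (k + 2) d) * (3 * K * √x) ≤ sysNorm d (formSys (C · ω))} ≤
      Real.exp (-x) := by
  have := h.pos
  exact (measureReal_le_sysNorm h.measurable h.pos h.subGaussian (numCoeffs_pos d)
    (by positivity)).trans
      (exp_neg_mul_nine_le h.pos.ne' (Nat.cast_pos.2 (numCoeffs_pos d)) hx)

lemma measureReal_minGap_le (h : IsAdmissible μ C K c₀) (hk : 0 < k) (hd1 : ∀ i, 1 ≤ d i)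
    (hD : 2 ≤ maxDeg d) (hx : 0 < x) (ht : 1 ≤ t) {ε : ℝ} (hε : 0 < ε)
    (hεt : ε ≤ 1 / (10 ^ 7 * (t * ((K * c₀) ^ (2 * (k + 1)) *
      (3 * (maxDeg d : ℝ) ^ 2 * logDeg d) ^ (2 * k + 1))))) :
    μ.real {ω | (∀ u, ‖u‖ = 1 → ‖sysEval (formSys (C · ω)) u‖ ≤ 3 * K * √x) ∧
        minGap (C · ω) ≤ (ε * (3 * K * √x)) ^ 2} ≤
      1 / √t * √(x / (((k : ℝ) + 1) * logDeg d)) ^ (k + 1) := by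
  have hK := h.pos
  have hq := h.mul_ge
  have hq0 : 0 < K * c₀ := by linarith
  have hD2 : (2 : ℝ) ≤ maxDeg d := by exact_mod_cast hD
  have hb : 0 < logDeg d := by linarith [le_logDeg hD]
  have hB := twenty_le_mul_logDeg hD
  obtain ⟨hε1, hεk⟩ := three_mul_sq_le (D := maxDeg d) (r := (k : ℝ) + 2)
    (by linarith [k.cast_nonneg (α := ℝ)]) (by linarith) hε.le (hεt.trans (by
      gcongr
      exact (add_two_le_pow_mul_pow k hq hB).trans (le_mul_of_one_le_left (by positivity) ht)))
  have hfactor : 207 / 100 * c₀ * (18 * (3 * K * √x)) / √(k + 1 : ℕ) * maxDeg d / 15 =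
      1863 / 250 * (K * c₀) * maxDeg d * √(logDeg d) * √(x / (((k : ℝ) + 1) * logDeg d)) := by
    rw [Real.sqrt_div hx.le, Real.sqrt_mul (by positivity)]
    push_cast
    field_simp
    ring
  calc _ ≤ _ := RandomSystem.measureReal_minGap_le hk h.measurable h.indep h.smallBall hd1
        (by positivity) hε hε1 hεk
    _ = 360 * √ε * (1863 / 250 * (K * c₀) * maxDeg d * √(logDeg d)) ^ (k + 1) *
          √(x / (((k : ℝ) + 1) * logDeg d)) ^ (k + 1) := by
        rw [mul_assoc (360 * √ε), ← mul_pow, ← hfactor, ← pow_div_eq_sqrt_mul_pow (by linarith) hε]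
        ring_nf
    _ ≤ _ := by
        gcongr
        exact sqrt_mul_pow_le_one_div_sqrt hq0 (by linarith) hb hB (by linarith) hε.le hεt

end IsAdmissible

end Tail

section ConditionNumberTail

variable {k : ℕ} {d : Fin (k + 1) → ℕ} {A K c₀ t x : ℝ}

lemma log_threshold (d : Fin (k + 1) → ℕ) :
    Real.log (threshold (k + 2) d) = 2 * (((k : ℝ) + 1) * logDeg d) := by
  change Real.log ((Real.exp 1 * (maxDeg d : ℝ)) ^ (2 * (k + 1))) = _
  rw [Real.log_pow, logDeg]
  push_cast
  ring

lemma one_le_threshold (hD : 0 < maxDeg d) : 1 ≤ threshold (k + 2) d :=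
  one_le_pow₀ (one_le_mul_of_one_le_of_one_le (Real.one_le_exp zero_le_one) (by exact_mod_cast hD))

variable {Ω : Type*} [MeasurableSpace Ω] {μ : Measure Ω} [IsProbabilityMeasure μ]
  {C : ∀ i, Ω → EuclideanSpace ℝ (Exponent (k + 2) (d i))}

namespace IsAdmissible

lemma measureReal_le_randomKappa (h : IsAdmissible μ C K c₀) (hk : 0 < k) (hd1 : ∀ i, 1 ≤ d i)
    (hD : 2 ≤ maxDeg d) (hA : 10 ^ 7 ≤ A) (ht : 1 ≤ t) (hx : ((k : ℝ) + 1) * logDeg d ≤ x)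
    (htx : Real.log t ≤ 2 * x) :
    μ.real {ω | ENNReal.ofReal (t * boundM A K c₀ (k + 2) d) ≤ randomKappa C ω} ≤
      (2 + √(x / (((k : ℝ) + 1) * logDeg d)) ^ (k + 1)) / √t := by
  set γ := 3 * K * √x
  set N := numCoeffs (k + 2) d
  set T := t * boundM A K c₀ (k + 2) d
  have hq0 : 0 < K * c₀ := by linarith [h.mul_ge]
  have hT0 : 0 < T := mul_pos (by linarith) (h.boundM_pos (by linarith) hD)
  have hN0 : (0 : ℝ) < N := Nat.cast_pos.2 (numCoeffs_pos d)
  have hx2 : 2 ≤ x := by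
    have hk1 : (1 : ℝ) ≤ k := by exact_mod_cast hk
    nlinarith [le_logDeg hD]
  have hexp : Real.exp (-x) ≤ 1 / √t := exp_neg_le_one_div_sqrt (by linarith) htx
  have hgap := h.measureReal_minGap_le hk hd1 hD (by linarith : 0 < x) ht
    (div_pos (Real.sqrt_pos.2 hN0) hT0) (sqrt_numCoeffs_div_boundM_le hA hq0 hD (by linarith))
  calc μ.real {ω | ENNReal.ofReal T ≤ randomKappa C ω}
      ≤ μ.real ({ω | ∃ u : EuclideanSpace ℝ (Fin (k + 2)), ‖u‖ = 1 ∧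
            γ < ‖sysEval (formSys (C · ω)) u‖} ∪
          ({ω | √N * γ ≤ sysNorm d (formSys (C · ω))} ∪
          {ω | (∀ u, ‖u‖ = 1 → ‖sysEval (formSys (C · ω)) u‖ ≤ γ) ∧
            minGap (C · ω) ≤ (√N / T * γ) ^ 2})) := by
        refine measureReal_mono fun ω hκ => ?_
        by_cases hsup : ∃ u : EuclideanSpace ℝ (Fin (k + 2)), ‖u‖ = 1 ∧
          γ < ‖sysEval (formSys (C · ω)) u‖
        · exact .inl hsup
        refine .inr ((le_total (√N * γ) (sysNorm d (formSys (C · ω)))).imp id fun hnorm => ?_)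
        refine ⟨fun u hu => not_lt.1 fun hlt => hsup ⟨u, hu, hlt⟩, ?_⟩
        rw [div_mul_eq_mul_div]
        exact minGap_le_of_le_kappa hd1 hT0 hκ hnorm
    _ ≤ 1 / √t + (1 / √t + 1 / √t * √(x / (((k : ℝ) + 1) * logDeg d)) ^ (k + 1)) := by
        refine (measureReal_union_le _ _).trans (add_le_add ?_ ?_)
        · exact (h.measureReal_exists_lt_norm_sysEval_le hk hD hx).trans hexp
        refine (measureReal_union_le _ _).trans (add_le_add ?_ hgap)
        exact (h.measureReal_le_sysNorm_le hx2).trans hexp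
    _ = _ := by ring

lemma measureReal_le_randomKappa_mid (h : IsAdmissible μ C K c₀) (hk : 0 < k)
    (hd1 : ∀ i, 1 ≤ d i) (hD : 2 ≤ maxDeg d) (hA : 10 ^ 7 ≤ A) (ht : 1 ≤ t)
    (ht' : t ≤ threshold (k + 2) d) :
    μ.real {ω | ENNReal.ofReal (t * boundM A K c₀ (k + 2) d) ≤ randomKappa C ω} ≤
      3 * t ^ (-(1 / 2) : ℝ) := by
  have hb : 0 < logDeg d := by linarith [le_logDeg hD]
  have hlog := Real.log_le_log (by linarith) ht'
  rw [log_threshold] at hlog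
  refine (h.measureReal_le_randomKappa hk hd1 hD hA ht le_rfl hlog).trans_eq ?_
  rw [div_self (by positivity), Real.sqrt_one, one_pow, Real.rpow_neg (by linarith),
    ← Real.sqrt_eq_rpow]
  ring

lemma measureReal_le_randomKappa_high (h : IsAdmissible μ C K c₀) (hk : 0 < k)
    (hd1 : ∀ i, 1 ≤ d i) (hD : 2 ≤ maxDeg d) (hA : 10 ^ 7 ≤ A) (ht : threshold (k + 2) d ≤ t) :
    μ.real {ω | ENNReal.ofReal (t * boundM A K c₀ (k + 2) d) ≤ randomKappa C ω} ≤
      3 * t ^ (-(1 / 2) : ℝ) * (t / threshold (k + 2) d) ^ (1 / (4 * logDeg d)) := by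
  have hb : 0 < logDeg d := by linarith [le_logDeg hD]
  have hthr := one_le_threshold (d := d) (by omega)
  have ht1 : 1 ≤ t := hthr.trans ht
  have hlog := Real.log_le_log (by linarith) ht
  rw [log_threshold] at hlog
  set s := Real.log t / 2 / (((k : ℝ) + 1) * logDeg d) with hs
  have hsqrt : √s ^ (k + 1) ≤ (t / threshold (k + 2) d) ^ (1 / (4 * logDeg d)) :=
    calc √s ^ (k + 1) ≤ Real.exp ((s - 1) / 2) ^ (k + 1) := by
          gcongr
          exact sqrt_le_exp s
      _ = (t / threshold (k + 2) d) ^ (1 / (4 * logDeg d)) := by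
          rw [Real.rpow_def_of_pos (by positivity), Real.log_div (by linarith) (by linarith),
            log_threshold, ← Real.exp_nat_mul, hs]
          congr 1
          push_cast
          field_simp
          ring
  have hone : 1 ≤ (t / threshold (k + 2) d) ^ (1 / (4 * logDeg d)) :=
    Real.one_le_rpow ((one_le_div (by linarith)).2 ht) (by positivity)
  refine (h.measureReal_le_randomKappa hk hd1 hD hA ht1 (x := Real.log t / 2) (by linarith)
    (by linarith)).trans ?_
  rw [Real.rpow_neg (by linarith), ← Real.sqrt_eq_rpow, div_eq_mul_inv, mul_right_comm]
  gcongr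
  linarith

lemma measureReal_exp_mul_le_randomKappa (h : IsAdmissible μ C K c₀) (hk : 0 < k)
    (hd1 : ∀ i, 1 ≤ d i) (hD : 2 ≤ maxDeg d) (hA : 10 ^ 7 ≤ A) {u : ℝ} (hu : 0 ≤ u) :
    μ.real {ω | ENNReal.ofReal (Real.exp u * boundM A K c₀ (k + 2) d) ≤ randomKappa C ω} ≤
      3 * Real.exp (-(1 / 4) * u) := by
  have hb := le_logDeg hD
  have hpow : Real.exp u ^ (-(1 / 2) : ℝ) = Real.exp (-(1 / 2) * u) := by
    rw [← Real.exp_mul, mul_comm]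
  rcases le_total (Real.exp u) (threshold (k + 2) d) with hut | hut
  · refine (h.measureReal_le_randomKappa_mid hk hd1 hD hA (Real.one_le_exp hu) hut).trans ?_
    rw [hpow]
    gcongr
    linarith
  · have hthr := one_le_threshold (d := d) (by omega)
    calc _ ≤ _ := h.measureReal_le_randomKappa_high hk hd1 hD hA hut
      _ ≤ 3 * Real.exp (-(1 / 2) * u) * Real.exp u ^ (1 / 4 : ℝ) := by
          rw [hpow]
          gcongr ?_ * ?_
          refine (Real.rpow_le_rpow (by positivity) (div_le_self (by positivity) hthr)
            (by positivity)).trans (Real.rpow_le_rpow_of_exponent_le (Real.one_le_exp hu) ?_)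
          exact one_div_le_one_div_of_le (by norm_num) (by linarith)
      _ = 3 * Real.exp (-(1 / 4) * u) := by
          rw [← Real.exp_mul, mul_assoc, ← Real.exp_add]
          ring_nf

end IsAdmissible

end ConditionNumberTail

section ExponentialTail

variable {Ω : Type*} [MeasurableSpace Ω] {μ : Measure Ω} {Y : Ω → ℝ} {a b B c : ℝ}

lemma lintegral_ofReal_posPart_sub_le [IsFiniteMeasure μ] (hY : Measurable Y) (hc : 0 < c)
    (hB : 0 ≤ B) (htail : ∀ u, 0 ≤ u → μ.real {ω | b + u ≤ Y ω} ≤ B * Real.exp (-c * u)) :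
    ∫⁻ ω, ENNReal.ofReal (max (Y ω - b) 0) ∂μ ≤ ENNReal.ofReal (B / c) := by
  have hint : IntegrableOn (fun u : ℝ => B * Real.exp (-c * u)) (Set.Ioi 0) :=
    (exp_neg_integrableOn_Ioi 0 hc).const_mul B
  have hval : ∫ u in Set.Ioi (0 : ℝ), B * Real.exp (-c * u) = B / c := by
    rw [integral_const_mul, integral_exp_mul_Ioi (neg_neg_of_pos hc), mul_zero, Real.exp_zero,
      neg_div_neg_eq, mul_one_div]
  have hnonneg : 0 ≤ᵐ[μ] fun ω => max (Y ω - b) 0 := .of_forall fun ω => le_max_right _ _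
  rw [lintegral_eq_lintegral_meas_le μ hnonneg
    (by fun_prop : Measurable fun ω => max (Y ω - b) 0).aemeasurable, ← hval,
    ofReal_integral_eq_lintegral_ofReal hint (.of_forall fun u => by positivity)]
  refine setLIntegral_mono (by fun_prop) fun u (hu : 0 < u) => ?_
  rw [← ofReal_measureReal]
  refine ENNReal.ofReal_le_ofReal ((measureReal_mono fun ω hω => ?_).trans (htail u hu.le))
  have hmax := (le_max_iff.1 hω).resolve_right hu.not_ge
  exact (by linarith : b + u ≤ Y ω)

lemma integrable_and_integral_le_of_exp_tail [IsProbabilityMeasure μ] (hY : Measurable Y)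
    (ha : ∀ᵐ ω ∂μ, a ≤ Y ω) (hc : 0 < c) (hB : 0 ≤ B)
    (htail : ∀ u, 0 ≤ u → μ.real {ω | b + u ≤ Y ω} ≤ B * Real.exp (-c * u)) :
    Integrable Y μ ∧ ∫ ω, Y ω ∂μ ≤ b + B / c := by
  have hnonneg : 0 ≤ᵐ[μ] fun ω => max (Y ω - b) 0 := .of_forall fun ω => le_max_right _ _
  have hmeas : Measurable fun ω => max (Y ω - b) 0 := by fun_prop
  have hle := lintegral_ofReal_posPart_sub_le hY hc hB htail
  have hpos : Integrable (fun ω => max (Y ω - b) 0) μ :=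
    ⟨hmeas.aestronglyMeasurable, (hasFiniteIntegral_iff_ofReal hnonneg).2
      (hle.trans_lt ENNReal.ofReal_lt_top)⟩
  have hbound : ∀ ω, Y ω ≤ b + max (Y ω - b) 0 := fun ω => by
    linarith [le_max_left (Y ω - b) 0]
  have hY_int : Integrable Y μ :=
    integrable_of_le_of_le hY.aestronglyMeasurable ha (.of_forall hbound) (integrable_const a)
      ((integrable_const b).add hpos)
  refine ⟨hY_int, ?_⟩
  calc ∫ ω, Y ω ∂μ ≤ ∫ ω, (b + max (Y ω - b) 0) ∂μ :=
        integral_mono hY_int ((integrable_const b).add hpos) hbound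
    _ = b + ∫ ω, max (Y ω - b) 0 ∂μ := by
        rw [integral_add (integrable_const b) hpos, integral_const, probReal_univ, one_smul]
    _ ≤ b + B / c := by
        rw [integral_eq_lintegral_of_nonneg_ae hnonneg hmeas.aestronglyMeasurable]
        gcongr
        exact ENNReal.toReal_le_of_le_ofReal (by positivity) hle

end ExponentialTail

section LogCond

variable {Ω : Type*} [MeasurableSpace Ω] {μ : Measure Ω} [IsProbabilityMeasure μ] {A K c₀ : ℝ}

lemma SmallBall.ae_ne_zero {ι : Type*} [Fintype ι] [Nonempty ι] {X : Ω → EuclideanSpace ℝ ι}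
    (hX : SmallBall μ X c₀) : ∀ᵐ ω ∂μ, X ω ≠ 0 := by
  classical
  have hle : ∀ ε : ℝ, 0 < ε → μ.real {ω | X ω = 0} ≤ c₀ * ε := fun ε hε => by
    refine (measureReal_mono fun ω (hω : X ω = 0) => ?_).trans
      (hX (EuclideanSpace.single (Classical.arbitrary ι) 1) (by simp) ε hε)
    simp only [Set.mem_ofPred_eq, hω, inner_zero_right, abs_zero]
    positivity
  have hlim : Filter.Tendsto (fun ε : ℝ => c₀ * ε) (nhdsWithin 0 (Set.Ioi 0)) (nhds 0) := by
    simpa only [mul_zero] using ((continuous_const_mul c₀).tendsto 0).mono_left nhdsWithin_le_nhds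
  have hzero : μ.real {ω | X ω = 0} = 0 :=
    (ge_of_tendsto hlim (eventually_nhdsWithin_of_forall hle)).antisymm measureReal_nonneg
  simpa only [ae_iff, not_not] using (measureReal_eq_zero_iff).1 hzero

variable {k : ℕ} {d : Fin (k + 1) → ℕ} {C : ∀ i, Ω → EuclideanSpace ℝ (Exponent (k + 2) (d i))}

lemma measurable_randomKappa (hd1 : ∀ i, 1 ≤ d i) (hC : ∀ i, Measurable (C i)) :
    Measurable (randomKappa C) :=
  (measurable_kappa_formSys k.succ_pos hd1).comp (measurable_pi_lambda (fun ω i => C i ω) hC)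

namespace IsAdmissible

lemma ae_inv_maxDeg_add_one_le_randomKappa (h : IsAdmissible μ C K c₀) (hd1 : ∀ i, 1 ≤ d i) :
    ∀ᵐ ω ∂μ, ENNReal.ofReal ((maxDeg d + 1 : ℝ)⁻¹) ≤ randomKappa C ω := by
  have : Nonempty (Exponent (k + 2) (d 0)) := by
    rw [← Fintype.card_pos_iff, Fintype.card_coe, Finset.card_finsuppAntidiag_nat_eq_choose,
      Finset.card_univ, Fintype.card_fin]
    exact Nat.choose_pos (by omega)
  filter_upwards [(h.smallBall 0).ae_ne_zero] with ω hω
  refine inv_maxDeg_add_one_le_kappa_formSys k.succ_pos hd1 _ ?_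
  rw [sysNorm_formSys]
  exact Real.sqrt_pos.2 (Finset.sum_pos' (fun i _ => sq_nonneg _)
    ⟨0, Finset.mem_univ _, pow_pos (norm_pos_iff.2 hω) 2⟩)

lemma ae_randomKappa_ne_top (h : IsAdmissible μ C K c₀) (hk : 0 < k) (hd1 : ∀ i, 1 ≤ d i)
    (hD : 2 ≤ maxDeg d) : ∀ᵐ ω ∂μ, randomKappa C ω ≠ ∞ := by
  have hle : ∀ u : ℝ, 0 ≤ u → μ.real {ω | randomKappa C ω = ∞} ≤ 3 * Real.exp (-(1 / 4) * u) :=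
    fun u hu => (measureReal_mono fun ω (hω : randomKappa C ω = ∞) => le_top.trans_eq hω.symm).trans
      (h.measureReal_exp_mul_le_randomKappa hk hd1 hD le_rfl hu)
  have hlim : Filter.Tendsto (fun u : ℝ => 3 * Real.exp (-(1 / 4) * u)) Filter.atTop
      (nhds 0) := by
    simpa only [mul_zero, Function.comp_def, id] using (Real.tendsto_exp_atBot.comp
      (Filter.tendsto_id.const_mul_atTop_of_neg (by norm_num : -(1 / 4 : ℝ) < 0))).const_mul 3
  have hzero : μ.real {ω | randomKappa C ω = ∞} = 0 :=
    (ge_of_tendsto hlim ((Filter.eventually_ge_atTop 0).mono hle)).antisymm measureReal_nonneg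
  simpa only [ae_iff, not_not] using (measureReal_eq_zero_iff).1 hzero

lemma ae_randomKappa_ne_zero (h : IsAdmissible μ C K c₀) (hd1 : ∀ i, 1 ≤ d i) :
    ∀ᵐ ω ∂μ, randomKappa C ω ≠ 0 :=
  (h.ae_inv_maxDeg_add_one_le_randomKappa hd1).mono fun _ hω =>
    ((ENNReal.ofReal_pos.2 (by positivity)).trans_le hω).ne'

lemma integrable_log_randomKappa_and_integral_le (h : IsAdmissible μ C K c₀) (hk : 0 < k)
    (hd1 : ∀ i, 1 ≤ d i) (hD : 2 ≤ maxDeg d) (hA : 10 ^ 7 ≤ A) :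
    Integrable (fun ω => Real.log (randomKappa C ω).toReal) μ ∧
      ∫ ω, Real.log (randomKappa C ω).toReal ∂μ ≤
        Real.log (boundM A K c₀ (k + 2) d) + 3 / (1 / 4) := by
  have hM := h.boundM_pos (by linarith : 0 < A) hD
  have htop := h.ae_randomKappa_ne_top hk hd1 hD
  have hlow : ∀ᵐ ω ∂μ, (maxDeg d + 1 : ℝ)⁻¹ ≤ (randomKappa C ω).toReal := by
    filter_upwards [htop, h.ae_inv_maxDeg_add_one_le_randomKappa hd1] with ω hω hle
    exact (ENNReal.ofReal_le_iff_le_toReal hω).1 hle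
  refine integrable_and_integral_le_of_exp_tail (a := Real.log (maxDeg d + 1 : ℝ)⁻¹)
    (Real.measurable_log.comp (measurable_randomKappa hd1 h.measurable).ennreal_toReal)
    (hlow.mono fun ω => Real.log_le_log (by positivity)) (by norm_num) (by norm_num) fun u hu => ?_
  refine le_trans ?_ (h.measureReal_exp_mul_le_randomKappa hk hd1 hD hA hu)
  refine ENNReal.toReal_mono (measure_ne_top _ _) (measure_mono_ae ?_)
  filter_upwards [htop, hlow] with ω hω hle (hlog : Real.log (boundM A K c₀ (k + 2) d) + u ≤ _)
  have hκ : 0 < (randomKappa C ω).toReal := (by positivity : (0 : ℝ) < _).trans_le hle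
  refine (ENNReal.ofReal_le_iff_le_toReal hω).2 ?_
  rwa [Real.le_log_iff_exp_le hκ, Real.exp_add, Real.exp_log hM,
    mul_comm] at hlog

lemma integral_log_randomKappa_le (h : IsAdmissible μ C K c₀) (hk : 0 < k) (hd1 : ∀ i, 1 ≤ d i)
    (hD : 2 ≤ maxDeg d) (hA : 10 ^ 7 ≤ A) :
    ∫ ω, Real.log (randomKappa C ω).toReal ∂μ ≤
      1 + Real.log (boundM (Real.exp 11 * A) K c₀ (k + 2) d) := by
  have hM := h.boundM_pos (by linarith : 0 < A) hD
  rw [boundM_exp_mul, Real.log_mul (Real.exp_ne_zero _) hM.ne', Real.log_exp]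
  linarith [(h.integrable_log_randomKappa_and_integral_le hk hd1 hD hA).2]

end IsAdmissible

end LogCond

end RandomSystem

theorem corollary1p3_general :
    ∃ A : ℝ, 0 < A ∧
      ∀ (n : ℕ) (_ : 3 ≤ n) (d : Fin (n - 1) → ℕ) (_ : ∀ i, 1 ≤ d i)
        (_ : 2 ≤ RandomSystem.maxDeg d)
        (Ω : Type*) [MeasurableSpace Ω] (μ : Measure Ω) [IsProbabilityMeasure μ]
        (C : ∀ i : Fin (n - 1), Ω → EuclideanSpace ℝ (RandomSystem.Exponent n (d i)))
        (_ : ∀ i, Measurable (C i)) (_ : iIndepFun C μ)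
        (K c₀ : ℝ) (_ : 0 < K)
        (_ : ∀ i, RandomSystem.SubGaussian μ (C i) K)
        (_ : ∀ i, RandomSystem.SmallBall μ (C i) c₀),
        (∀ t : ℝ, 1 ≤ t → t ≤ RandomSystem.threshold n d →
          μ.real {ω | ENNReal.ofReal (t * RandomSystem.boundM A K c₀ n d) ≤
              RandomSystem.randomKappa C ω} ≤ 3 * t ^ (-(1 / 2) : ℝ)) ∧
        (∀ t : ℝ, RandomSystem.threshold n d ≤ t →
          μ.real {ω | ENNReal.ofReal (t * RandomSystem.boundM A K c₀ n d) ≤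
              RandomSystem.randomKappa C ω} ≤
            3 * t ^ (-(1 / 2) : ℝ) *
              (t / RandomSystem.threshold n d) ^
                (1 / (4 * Real.log (Real.exp 1 * (RandomSystem.maxDeg d : ℝ))))) ∧
        (∀ᵐ ω ∂μ, RandomSystem.randomKappa C ω ≠ 0 ∧ RandomSystem.randomKappa C ω ≠ ∞) ∧
        Integrable (fun ω => Real.log (RandomSystem.randomKappa C ω).toReal) μ ∧
        ∫ ω, Real.log (RandomSystem.randomKappa C ω).toReal ∂μ ≤
          1 + Real.log (RandomSystem.boundM A K c₀ n d) := by
  refine ⟨Real.exp 11 * 10 ^ 7, by positivity, ?_⟩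
  intro n hn d hd1 hD Ω _ μ _ C hC hind K c₀ hK hsg hsb
  obtain ⟨k, rfl⟩ : ∃ k, n = k + 2 := Nat.exists_eq_add_of_le' (by omega)
  have h : RandomSystem.IsAdmissible μ C K c₀ := ⟨hC, hind, hK, hsg, hsb⟩
  have hk : 0 < k := by omega
  have hA : (10 : ℝ) ^ 7 ≤ Real.exp 11 * 10 ^ 7 :=
    le_mul_of_one_le_left (by positivity) (Real.one_le_exp (by norm_num))
  exact ⟨fun t => h.measureReal_le_randomKappa_mid hk hd1 hD hA,
    fun t => h.measureReal_le_randomKappa_high hk hd1 hD hA,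
    (h.ae_randomKappa_ne_zero hd1).and (h.ae_randomKappa_ne_top hk hd1 hD),
    (h.integrable_log_randomKappa_and_integral_le hk hd1 hD le_rfl).1,
    h.integral_log_randomKappa_le hk hd1 hD le_rfl⟩

theorem corollary1p3 :
    ∃ A : ℝ, 0 < A ∧
      ∀ (n : ℕ) (_ : 3 ≤ n) (d : Fin (n - 1) → ℕ) (_ : ∀ i, 1 ≤ d i)
        (_ : 2 ≤ RandomSystem.maxDeg d)
        (Ω : Type*) [MeasurableSpace Ω] (μ : Measure Ω) [IsProbabilityMeasure μ]
        (C : ∀ i : Fin (n - 1), Ω → EuclideanSpace ℝ (RandomSystem.Exponent n (d i)))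
        (_ : ∀ i, Measurable (C i)) (_ : iIndepFun C μ)
        (K c₀ : ℝ) (_ : 0 < K) (_ : 0 < c₀)
        (_ : ∀ i, RandomSystem.Centered μ (C i))
        (_ : ∀ i, RandomSystem.SubGaussian μ (C i) K)
        (_ : ∀ i, RandomSystem.SmallBall μ (C i) c₀),
        (∀ t : ℝ, 1 ≤ t → t ≤ RandomSystem.threshold n d →
          μ.real {ω | ENNReal.ofReal (t * RandomSystem.boundM A K c₀ n d) ≤
              RandomSystem.randomKappa C ω} ≤ 3 * t ^ (-(1 / 2) : ℝ)) ∧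
        (∀ t : ℝ, RandomSystem.threshold n d ≤ t →
          μ.real {ω | ENNReal.ofReal (t * RandomSystem.boundM A K c₀ n d) ≤
              RandomSystem.randomKappa C ω} ≤
            3 * t ^ (-(1 / 2) : ℝ) *
              (t / RandomSystem.threshold n d) ^
                (1 / (4 * Real.log (Real.exp 1 * (RandomSystem.maxDeg d : ℝ))))) ∧
        (∀ᵐ ω ∂μ, RandomSystem.randomKappa C ω ≠ 0 ∧ RandomSystem.randomKappa C ω ≠ ∞) ∧
        Integrable (fun ω => Real.log (RandomSystem.randomKappa C ω).toReal) μ ∧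
        ∫ ω, Real.log (RandomSystem.randomKappa C ω).toReal ∂μ ≤
          1 + Real.log (RandomSystem.boundM A K c₀ n d) := by
  obtain ⟨A, hA, h⟩ := corollary1p3_general
  exact ⟨A, hA, fun n hn d hd1 hD Ω _ μ _ C hC hind K c₀ hK _ _ hsg hsb =>
    h n hn d hd1 hD Ω μ C hC hind K c₀ hK hsg hsb⟩
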